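/- **Setting.** Let $K$ be a commutative ring. A $K$-linear 2-category is a (strict) 2-category $\mathfrak C$ whose 2-morphisms $f\Rightarrow g$ form $K$-modules, vertical and horizontal composition being $K$-bilinear. A $K$-linear semigroupal 2-category $(\mathfrak C,\otimes,a,\pi)$ consists of such a $\mathfrak C$ and * a pseudofunctor $\otimes:\mathfrak C\times\mathfrak C\to\mathfrak C$, $K$-bilinear on 2-morphisms, with structural 2-isomorphisms $\widehat\otimes((f',g'),(f,g)):(f'\otimes g')\circ(f\otimes g)\Rightarrow(f'\circ f)\otimes(g'\circ g)$ and $\otimes_0(X,Y):id_X\otimes id_Y\Rightarrow id_{X\otimes Y}$; * a pseudonatural isomorphism $a$ with components 1-isomorphisms $a_{X,Y,Z}:X\otimes(Y\otimes Z)\to(X\otimes Y)\otimes Z$ and structural 2-isomorphisms $\widehat a(f,g,h)$; * an invertible modification $\pi$ from $a^{(4)}$ to ${}^{(4)}a$, where $a^{(4)}_{X,Y,Z,T}=(a_{X,Y,Z}\otimes id_T)\circ a_{X,Y\otimes Z,T}\circ(id_X\otimes a_{Y,Z,T})$ and ${}^{(4)}a_{X,Y,Z,T}=a_{X\otimes Y,Z,T}\circ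 a_{X,Y,Z\otimes T}$, such that for all $X,Y,Z,U,V$ the two pastings of the six pentagons (instances of $\pi$) and three squares (instances of $\widehat a$) on the boundary of the 3-dimensional Stasheff polytope $K_5$ agree. **The complex.** Let $$a^{(5)}_{X,Y,Z,U,V}=((a_{X,Y,Z}\otimes id_U)\otimes id_V)\circ(a_{X,Y\otimes Z,U}\otimes id_V)\circ a_{X,(Y\otimes Z)\otimes U,V}\circ(id_X\otimes(a_{Y,Z,U}\otimes id_V))\circ(id_X\otimes a_{Y,Z\otimes U,V})\circ(id_X\otimes(id_Y\otimes a_{Z,U,V}))$$ and ${}^{(5)}a_{X,Y,Z,U,V}=a_{(X\otimes Y)\otimes Z,U,V}\circ a_{X\otimes Y,Z,U\otimes V}\circ a_{X,Y,Z\otimes(U\otimes V)}$, and let $a^{(3)}={}^{(3)}a=a$. If $\sigma$ is a 2-morphism between composites of (tensor products with identities of) components of $a$, the padding $\lceil\lceil\sigma\rceil\rceil$ is the 2-morphism $a^{(n)}\Rightarrow{}^{(n)}a$ obtained from $\sigma$ by horizontal composition with such composites and vertical composition with canonical 2-isomorphisms, that is, pastings of the structural 2-isomorphisms $\widehat\otimes,\otimes_0,\widehat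 a,\pi$ and their inverses. For a family of 2-morphisms $n_{X_1,\dots,X_m}:a^{(m)}_{X_1,\dots,X_m}\Rightarrow{}^{(m)}a_{X_1,\dots,X_m}$ with $m\in\{3,4\}$ put $$(\delta n)_{X_0,\dots,X_m}=\lceil\lceil 1_{id_{X_0}}\otimes n_{X_1,\dots,X_m}\rceil\rceil+\sum_{i=1}^m(-1)^i\lceil\lceil n_{X_0,\dots,X_{i-1}\otimes X_i,\dots,X_m}\rceil\rceil+(-1)^{m+1}\lceil\lceil n_{X_0,\dots,X_{m-1}}\otimes 1_{id_{X_m}}\rceil\rceil .$$ The pentagonator-deformation complex has in degree $m-1$ the $K$-module $\mathrm{Mod}(a^{(m)},{}^{(m)}a)$ of modifications (families as above which are natural in all their arguments), with coboundary $\delta$. In degree 3 its cohomology is $$H^3_{pent}(\mathfrak C)=\frac{\{n\in\mathrm{Mod}(a^{(4)},{}^{(4)}a):\delta n=0\}}{\delta\,\mathrm{Mod}(a,a)} .$$ **Deformations.** Let $\mathfrak C_\epsilon$ be the extension of scalars of $\mathfrak C$ to $K[\epsilon]/(\epsilon^2)$: same objects and 1-morphisms, and 2-morphisms $\tau+\tau^{(1)}\epsilon$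 with $\tau,\tau^{(1)}:f\Rightarrow g$ in $\mathfrak C$. A first order pentagonator-deformation of $(\mathfrak C,\otimes,a,\pi)$ is a family $\pi_\epsilon=\pi+\pi^{(1)}\epsilon$ such that $(\mathfrak C_\epsilon,\otimes,a,\pi_\epsilon)$, with $\otimes$ and $a$ (and all their structural 2-isomorphisms) extended linearly and not deformed, is a semigroupal 2-category. A semigroupal structure $(\psi,\omega)$ on the identity 2-functor from $(\mathfrak C_\epsilon,\otimes,a,\pi_\epsilon)$ to $(\mathfrak C_\epsilon,\otimes,a,\pi'_\epsilon)$ is a pseudonatural isomorphism $\psi$ with components 1-isomorphisms $\psi_{X,Y}:X\otimes Y\to X\otimes Y$ and structural 2-isomorphisms $\widehat\psi(f,g):(f\otimes g)\circ\psi_{X,Y}\Rightarrow\psi_{X',Y'}\circ(f\otimes g)$, together with an invertible modification $\omega$ with components $$\omega_{X,Y,Z}:a_{X,Y,Z}\circ\psi_{X,Y\otimes Z}\circ(id_X\otimes\psi_{Y,Z})\Rightarrow\psi_{X\otimes Y,Z}\circ(\psi_{X,Y}\otimes id_Z)\circ a_{X,Y,Z},$$ such that for all $X,Y,Z,T$ the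 usual coherence relation for a morphism of one-object tricategories without units holds: the pasting of $\pi_\epsilon$ with $\omega_{X,Y,Z\otimes T}$, $\omega_{X\otimes Y,Z,T}$ equals the pasting of $1_{id_X}\otimes\omega_{Y,Z,T}$, $\omega_{X,Y\otimes Z,T}$, $\omega_{X,Y,Z}\otimes 1_{id_T}$ with $\pi'_\epsilon$, up to the structural 2-isomorphisms of $\otimes$, $a$, $\psi$. Two first order pentagonator-deformations $\pi_\epsilon,\pi'_\epsilon$ are $\omega$-equivalent if there is such a $(\psi,\omega)$ with $\psi_{X,Y}=id_{X\otimes Y}$ for all $X,Y$, $\widehat\psi(f,g)=1_{f\otimes g}$ for all $f,g$, and $\omega_{X,Y,Z}\equiv(\otimes_0(X\otimes Y,Z)^{-1}\circ 1_{a_{X,Y,Z}})\cdot(1_{a_{X,Y,Z}}\circ\otimes_0(X,Y\otimes Z))\pmod\epsilon$ for all $X,Y,Z$. **Theorem.** For every $K$-linear semigroupal 2-category $(\mathfrak C,\otimes,a,\pi)$, $\omega$-equivalence is an equivalence relation on its first order pentagonator-deformations; for every such deformation $\pi_\epsilon=\pi+\pi^{(1)}\epsilon$ the family $\pi^{(1)}$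 is a 3-cocycle of the pentagonator-deformation complex; and $\pi_\epsilon\mapsto[\pi^{(1)}]$ induces a bijection from the set of $\omega$-equivalence classes of first order pentagonator-deformations of $(\mathfrak C,\otimes,a,\pi)$ onto $H^3_{pent}(\mathfrak C)$. -/

import Mathlib

open CategoryTheory Bicategory
open scoped TensorProduct CategoryTheory.Prod

universe w v u

/-! Composition is written in diagrammatic order: `f ≫ g` is first `f`, then `g`. For 2-morphisms
`≫` is vertical composition, `f ◁ η` and `η ▷ f` are the horizontal composites with an identity
2-morphism, and `η ⊗≫ θ` is vertical composition up to the unique structural (associator and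
unitor) 2-isomorphism of the bicategory, which is an identity in a 2-category. -/

/-- A bicategory whose hom-categories are `K`-linear (that is, 2-morphisms form `K`-modules and
vertical composition is `K`-bilinear) is `K`-linear if horizontal composition is `K`-bilinear too.
It suffices to say so for the whiskerings, since `η ∘ θ` is a vertical composite of these. -/
class LinearBicategory (K : Type*) [CommRing K] (C : Type u) [Bicategory.{w, v} C]
    [∀ X Y : C, Preadditive (X ⟶ Y)] [∀ X Y : C, Linear K (X ⟶ Y)] : Prop where
  whiskerLeft_add : ∀ {X Y Z : C} (f : X ⟶ Y) {g h : Y ⟶ Z} (η θ : g ⟶ h),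
    f ◁ (η + θ) = f ◁ η + f ◁ θ
  whiskerLeft_smul : ∀ {X Y Z : C} (f : X ⟶ Y) {g h : Y ⟶ Z} (k : K) (η : g ⟶ h),
    f ◁ (k • η) = k • (f ◁ η)
  whiskerRight_add : ∀ {X Y Z : C} {f g : X ⟶ Y} (η θ : f ⟶ g) (h : Y ⟶ Z),
    (η + θ) ▷ h = η ▷ h + θ ▷ h
  whiskerRight_smul : ∀ {X Y Z : C} {f g : X ⟶ Y} (k : K) (η : f ⟶ g) (h : Y ⟶ Z),
    (k • η) ▷ h = k • (η ▷ h)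

/-- The `R`-linear extension of a `K`-linear bicategory `C`: it has the same objects and the same
1-morphisms, and its 2-morphisms `f ⟶ g` are the elements of `(f ⟶ g) ⊗[K] R`; all compositions
are extended `R`-bilinearly. -/
structure ScalarExt (K R : Type*) (C : Type u) where
  of ::
  as : C

namespace ScalarExt

section
variable {K R : Type*} [CommRing K] [CommRing R] [Algebra K R]
  {C : Type u} [Bicategory.{w, v} C]
  [∀ X Y : C, Preadditive (X ⟶ Y)] [∀ X Y : C, Linear K (X ⟶ Y)]

/-- The 1-morphisms of the extension are those of `C`. -/
structure Hom (X Y : ScalarExt K R C) where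
  of ::
  as : X.as ⟶ Y.as

instance : CategoryStruct (ScalarExt K R C) where
  Hom X Y := Hom X Y
  id X := ⟨𝟙 X.as⟩
  comp f g := ⟨f.as ≫ g.as⟩

/-- 2-morphisms and vertical composition, `(τ ⊗ r) ≫ (σ ⊗ s) = (τ ≫ σ) ⊗ (r * s)`. -/
instance homCategory (X Y : ScalarExt K R C) : Category (X ⟶ Y) where
  Hom f g := (f.as ⟶ g.as) ⊗[K] R
  id f := 𝟙 f.as ⊗ₜ 1
  comp {f g h} η θ :=
    TensorProduct.map₂ (Linear.comp f.as g.as h.as) (LinearMap.mul K R) η θ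
  id_comp {f g} η := by
    induction η using TensorProduct.induction_on with
    | zero => simp
    | tmul a r => simp
    | add a b ha hb => rw [map_add, ha, hb]
  comp_id {f g} η := by
    induction η using TensorProduct.induction_on with
    | zero => simp
    | tmul a r => simp
    | add a b ha hb => rw [map_add, LinearMap.add_apply, ha, hb]
  assoc {f g h k} η θ ζ := by
    induction η using TensorProduct.induction_on with
    | zero => simp
    | add a b ha hb => simp only [map_add, LinearMap.add_apply, ha, hb]
    | tmul a r =>
      induction θ using TensorProduct.induction_on with
      | zero => simp
      | add a b ha hb => simp only [map_add, LinearMap.add_apply, ha, hb]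
      | tmul b s =>
        induction ζ using TensorProduct.induction_on with
        | zero => simp
        | add a b ha hb => simp only [map_add, ha, hb]
        | tmul c t => simp [mul_assoc]

end

end ScalarExt

namespace ScalarExt
section
variable {K R : Type*} [CommRing K] [CommRing R] [Algebra K R]
  {C : Type u} [Bicategory.{w, v} C]
  [∀ X Y : C, Preadditive (X ⟶ Y)] [∀ X Y : C, Linear K (X ⟶ Y)]

variable {X Y Z W : ScalarExt K R C}

/-- The 2-morphism `τ ⊗ r`. -/
def tm {f g : X ⟶ Y} (τ : f.as ⟶ g.as) (r : R) : f ⟶ g := τ ⊗ₜ[K] r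

instance homAddCommGroup (f g : X ⟶ Y) : AddCommGroup (f ⟶ g) :=
  inferInstanceAs (AddCommGroup ((f.as ⟶ g.as) ⊗[K] R))

instance homPreadditive : Preadditive (X ⟶ Y) where
  add_comp f g h η θ ζ := by
    change TensorProduct.map₂ _ _ _ _ = _
    rw [map_add]; rfl
  comp_add f g h η θ ζ := by
    change TensorProduct.map₂ _ _ _ _ = _
    rw [map_add]; rfl

lemma ind {f g : X ⟶ Y} {P : (f ⟶ g) → Prop} (η : f ⟶ g)
    (tmul : ∀ (τ : f.as ⟶ g.as) (r : R), P (tm τ r)) (add : ∀ η θ, P η → P θ → P (η + θ)) :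
    P η := by
  induction η using TensorProduct.induction_on with
  | zero => simpa [tm] using tmul 0 0
  | tmul a r => exact tmul a r
  | add a b ha hb => exact add a b ha hb

lemma id_eq (f : X ⟶ Y) : 𝟙 f = tm (𝟙 f.as) (1 : R) := rfl

lemma tm_comp {f g h : X ⟶ Y} (τ : f.as ⟶ g.as) (r : R) (σ : g.as ⟶ h.as) (s : R) :
    (tm τ r : f ⟶ g) ≫ (tm σ s : g ⟶ h) = tm (τ ≫ σ) (r * s) := rfl

/-- The extension `τ ⊗ 1` of a 2-isomorphism `τ`. -/
def tmIso {f g : X ⟶ Y} (τ : f.as ≅ g.as) : f ≅ g where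
  hom := tm τ.hom 1
  inv := tm τ.inv 1
  hom_inv_id := by rw [tm_comp, id_eq]; simp
  inv_hom_id := by rw [tm_comp, id_eq]; simp

lemma tmIso_hom {f g : X ⟶ Y} (τ : f.as ≅ g.as) :
    (tmIso τ : f ≅ g).hom = tm τ.hom (1 : R) := rfl

lemma tmIso_inv {f g : X ⟶ Y} (τ : f.as ≅ g.as) :
    (tmIso τ : f ≅ g).inv = tm τ.inv (1 : R) := rfl

lemma tm_congr {f g : X ⟶ Y} {τ σ : f.as ⟶ g.as} {r s : R} (h : τ = σ) (h' : r = s) :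
    (tm τ r : f ⟶ g) = tm σ s := by rw [h, h']

lemma tmIso_eqToIso {f g : X ⟶ Y} (h : f = g) (τ : f.as ≅ g.as)
    (hτ : τ = eqToIso (congrArg Hom.as h)) : (tmIso τ : f ≅ g) = eqToIso h := by
  subst h hτ
  rfl

variable [LinearBicategory K C]

/-- Left whiskering, `f ◁ (τ ⊗ r) = (f ◁ τ) ⊗ r`. -/
def wL (f : X ⟶ Y) {g h : Y ⟶ Z} : (g ⟶ h) →+ (f ≫ g ⟶ f ≫ h) :=
  (LinearMap.rTensor R
    ({ toFun := fun τ : g.as ⟶ h.as => f.as ◁ τ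
       map_add' := LinearBicategory.whiskerLeft_add K _
       map_smul' := LinearBicategory.whiskerLeft_smul _ } :
       (g.as ⟶ h.as) →ₗ[K] (f.as ≫ g.as ⟶ f.as ≫ h.as))).toAddMonoidHom

/-- Right whiskering, `(τ ⊗ r) ▷ h = (τ ▷ h) ⊗ r`. -/
def wR {f g : X ⟶ Y} (h : Y ⟶ Z) : (f ⟶ g) →+ (f ≫ h ⟶ g ≫ h) :=
  (LinearMap.rTensor R
    ({ toFun := fun τ : f.as ⟶ g.as => τ ▷ h.as
       map_add' := fun a b => LinearBicategory.whiskerRight_add K a b _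
       map_smul' := fun a b => LinearBicategory.whiskerRight_smul a b _ } :
       (f.as ⟶ g.as) →ₗ[K] (f.as ≫ h.as ⟶ g.as ≫ h.as))).toAddMonoidHom

lemma wL_tm (f : X ⟶ Y) {g h : Y ⟶ Z} (τ : g.as ⟶ h.as) (r : R) :
    wL f (tm τ r : g ⟶ h) = (tm (f.as ◁ τ) r : f ≫ g ⟶ f ≫ h) := rfl

lemma wR_tm {f g : X ⟶ Y} (h : Y ⟶ Z) (τ : f.as ⟶ g.as) (r : R) :
    wR h (tm τ r : f ⟶ g) = (tm (τ ▷ h.as) r : f ≫ h ⟶ g ≫ h) := rfl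

/-- The `R`-linear extension; the structural 2-isomorphisms are those of `C`, tensored with `1`. -/
instance bicategory : Bicategory (ScalarExt K R C) where
  homCategory := homCategory
  whiskerLeft f _ _ η := wL f η
  whiskerRight η h := wR h η
  associator f g h := tmIso (α_ f.as g.as h.as)
  leftUnitor f := tmIso (λ_ f.as)
  rightUnitor f := tmIso (ρ_ f.as)
  whiskerLeft_id f g := tm_congr (whiskerLeft_id _ _) rfl
  id_whiskerRight f g := tm_congr (id_whiskerRight _ _) rfl
  whiskerLeft_comp {_ _ _} f {_ _ _} η θ := by
    refine ind (P := fun η => wL f (η ≫ θ) = wL f η ≫ wL f θ) η (fun a r => ?_)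
      (fun a b ha hb => by simp only [Preadditive.add_comp, map_add, ha, hb])
    refine ind (P := fun θ => wL f (tm a r ≫ θ) = wL f (tm a r) ≫ wL f θ) θ (fun b s => ?_)
      (fun a b ha hb => by simp only [Preadditive.comp_add, map_add, ha, hb])
    exact tm_congr (whiskerLeft_comp _ _ _) rfl
  comp_whiskerRight {_ _ _ _ _ _} η θ i := by
    refine ind (P := fun η => wR i (η ≫ θ) = wR i η ≫ wR i θ) η (fun a r => ?_)
      (fun a b ha hb => by simp only [Preadditive.add_comp, map_add, ha, hb])
    refine ind (P := fun θ => wR i (tm a r ≫ θ) = wR i (tm a r) ≫ wR i θ) θ (fun b s => ?_)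
      (fun a b ha hb => by simp only [Preadditive.comp_add, map_add, ha, hb])
    exact tm_congr (comp_whiskerRight _ _ _) rfl
  id_whiskerLeft {X Y f g} η := by
    refine ind (P := fun η => wL (𝟙 X) η =
      (tmIso (λ_ f.as) : 𝟙 X ≫ f ≅ f).hom ≫ η ≫ (tmIso (λ_ g.as) : 𝟙 X ≫ g ≅ g).inv) η
      (fun a r => ?_) (fun a b ha hb => ?_)
    · exact tm_congr (id_whiskerLeft _) (by simp)
    · simp only [Preadditive.add_comp, Preadditive.comp_add, map_add, ha, hb]
  whiskerRight_id {X Y f g} η := by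
    refine ind (P := fun η => wR (𝟙 Y) η =
      (tmIso (ρ_ f.as) : f ≫ 𝟙 Y ≅ f).hom ≫ η ≫ (tmIso (ρ_ g.as) : g ≫ 𝟙 Y ≅ g).inv) η
      (fun a r => ?_) (fun a b ha hb => ?_)
    · exact tm_congr (whiskerRight_id _) (by simp)
    · simp only [Preadditive.add_comp, Preadditive.comp_add, map_add, ha, hb]
  comp_whiskerLeft {_ _ _ _} f g {h h'} η := by
    refine ind (P := fun η => wL (f ≫ g) η =
      (tmIso (α_ f.as g.as h.as) : (f ≫ g) ≫ h ≅ f ≫ g ≫ h).hom ≫ wL f (wL g η) ≫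
        (tmIso (α_ f.as g.as h'.as) : (f ≫ g) ≫ h' ≅ f ≫ g ≫ h').inv) η
      (fun a r => ?_) (fun a b ha hb => ?_)
    · exact tm_congr (comp_whiskerLeft _ _ _) (by simp)
    · simp only [Preadditive.add_comp, Preadditive.comp_add, map_add, ha, hb]
  whiskerRight_comp {_ _ _ _ f f'} η g h := by
    refine ind (P := fun η => wR (g ≫ h) η =
      (tmIso (α_ f.as g.as h.as) : (f ≫ g) ≫ h ≅ f ≫ g ≫ h).inv ≫ wR h (wR g η) ≫
        (tmIso (α_ f'.as g.as h.as) : (f' ≫ g) ≫ h ≅ f' ≫ g ≫ h).hom) η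
      (fun a r => ?_) (fun a b ha hb => ?_)
    · exact tm_congr (whiskerRight_comp _ _ _) (by simp)
    · simp only [Preadditive.add_comp, Preadditive.comp_add, map_add, ha, hb]
  whisker_assoc {_ _ _ _} f {g g'} η h := by
    refine ind (P := fun η => wR h (wL f η) =
      (tmIso (α_ f.as g.as h.as) : (f ≫ g) ≫ h ≅ f ≫ g ≫ h).hom ≫ wL f (wR h η) ≫
        (tmIso (α_ f.as g'.as h.as) : (f ≫ g') ≫ h ≅ f ≫ g' ≫ h).inv) η
      (fun a r => ?_) (fun a b ha hb => ?_)
    · exact tm_congr (whisker_assoc _ _ _) (by simp)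
    · simp only [Preadditive.add_comp, Preadditive.comp_add, map_add, ha, hb]
  whisker_exchange {_ _ _ f g h i} η θ := by
    refine ind (P := fun η => wL f θ ≫ wR i η = wR h η ≫ wL g θ) η (fun a r => ?_)
      (fun a b ha hb => by simp only [Preadditive.add_comp, Preadditive.comp_add, map_add, ha, hb])
    refine ind (P := fun θ => wL f θ ≫ wR i (tm a r) = wR h (tm a r) ≫ wL g θ) θ (fun b s => ?_)
      (fun a b ha hb => by simp only [Preadditive.add_comp, Preadditive.comp_add, map_add, ha, hb])
    exact tm_congr (whisker_exchange _ _) (mul_comm _ _)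
  pentagon f g h i := tm_congr (pentagon _ _ _ _) (by simp)
  triangle f g := tm_congr (triangle _ _) (by simp)

lemma whiskerLeft_add' (f : X ⟶ Y) {g h : Y ⟶ Z} (η θ : g ⟶ h) :
    f ◁ (η + θ) = f ◁ η + f ◁ θ :=
  map_add (wL f) η θ

lemma whiskerRight_add' {f g : X ⟶ Y} (η θ : f ⟶ g) (h : Y ⟶ Z) :
    (η + θ) ▷ h = η ▷ h + θ ▷ h :=
  map_add (wR h) η θ

/-- The `R`-linear extension of a 2-category is a 2-category. -/
instance strict [Strict C] : Strict (ScalarExt K R C) where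
  id_comp f := congrArg Hom.of (Strict.id_comp f.as)
  comp_id f := congrArg Hom.of (Strict.comp_id f.as)
  assoc f g h := congrArg Hom.of (Strict.assoc f.as g.as h.as)
  leftUnitor_eqToIso f := tmIso_eqToIso _ _ (Strict.leftUnitor_eqToIso f.as)
  rightUnitor_eqToIso f := tmIso_eqToIso _ _ (Strict.rightUnitor_eqToIso f.as)
  associator_eqToIso f g h := tmIso_eqToIso _ _ (Strict.associator_eqToIso f.as g.as h.as)

end
end ScalarExt

/-- A tensor product on a 2-category `C` is a pseudofunctor `C × C ⥤ C`. Its constraints are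
`T.mapComp : (f ≫ f') ⊗ (g ≫ g') ≅ (f ⊗ g) ≫ (f' ⊗ g')` and `T.mapId : id_X ⊗ id_Y ≅ id_{X ⊗ Y}`. -/
abbrev TensorFunctor (C : Type u) [Bicategory.{w, v} C] := Pseudofunctor (C × C) C

namespace TensorFunctor

section
variable {C : Type u} [Bicategory.{w, v} C] (T : TensorFunctor C)

/-- `X ⊗ Y` for objects. -/
abbrev tObj (X Y : C) : C := T.obj (X, Y)

variable {X X' X'' Y Y' Y'' Z : C}

/-- `f ⊗ g` for 1-morphisms. -/
abbrev tHom (f : X ⟶ X') (g : Y ⟶ Y') : T.tObj X Y ⟶ T.tObj X' Y' :=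
  T.map (X := (X, Y)) (Y := (X', Y')) (f ×ₘ g)

/-- `τ ⊗ σ` for 2-morphisms. -/
abbrev tHom₂ {f f' : X ⟶ X'} {g g' : Y ⟶ Y'} (τ : f ⟶ f') (σ : g ⟶ g') :
    T.tHom f g ⟶ T.tHom f' g' :=
  T.map₂ (a := (X, Y)) (b := (X', Y')) (f := f ×ₘ g) (g := f' ×ₘ g') (τ ×ₘ σ)

/-- `(f ≫ f') ⊗ (g ≫ g') ≅ (f ⊗ g) ≫ (f' ⊗ g')` -/
abbrev tComp (f : X ⟶ X') (f' : X' ⟶ X'') (g : Y ⟶ Y') (g' : Y' ⟶ Y'') :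
    T.tHom (f ≫ f') (g ≫ g') ≅ T.tHom f g ≫ T.tHom f' g' :=
  T.mapComp (a := (X, Y)) (b := (X', Y')) (c := (X'', Y'')) (f ×ₘ g) (f' ×ₘ g')

/-- `id_X ⊗ id_Y ≅ id_{X ⊗ Y}` -/
abbrev tId (X Y : C) : T.tHom (𝟙 X) (𝟙 Y) ≅ 𝟙 (T.tObj X Y) := T.mapId (X, Y)

/-- `id_X ⊗ f` -/
abbrev idL (X : C) (f : Y ⟶ Y') : T.tObj X Y ⟶ T.tObj X Y' := T.tHom (𝟙 X) f

/-- `f ⊗ id_Y` -/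
abbrev idR (f : X ⟶ X') (Y : C) : T.tObj X Y ⟶ T.tObj X' Y := T.tHom f (𝟙 Y)

/-- `id_X ⊗ (f ≫ g) ≅ (id_X ⊗ f) ≫ (id_X ⊗ g)` -/
def idLComp (X : C) (f : Y ⟶ Y') (g : Y' ⟶ Y'') :
    T.idL X (f ≫ g) ≅ T.idL X f ≫ T.idL X g :=
  T.map₂Iso (a := (X, Y)) (b := (X, Y'')) (f := 𝟙 X ×ₘ (f ≫ g)) (g := (𝟙 X ≫ 𝟙 X) ×ₘ (f ≫ g))
    (Iso.prod (λ_ (𝟙 X)).symm (Iso.refl _)) ≪≫ T.tComp (𝟙 X) (𝟙 X) f g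

/-- `(f ≫ g) ⊗ id_Y ≅ (f ⊗ id_Y) ≫ (g ⊗ id_Y)` -/
def idRComp (f : X ⟶ X') (g : X' ⟶ X'') (Y : C) :
    T.idR (f ≫ g) Y ≅ T.idR f Y ≫ T.idR g Y :=
  T.map₂Iso (a := (X, Y)) (b := (X'', Y)) (f := (f ≫ g) ×ₘ 𝟙 Y) (g := (f ≫ g) ×ₘ (𝟙 Y ≫ 𝟙 Y))
    (Iso.prod (Iso.refl _) (λ_ (𝟙 Y)).symm) ≪≫ T.tComp f g (𝟙 Y) (𝟙 Y)

/-- `id_X ⊗ (f ≫ g ≫ h) ≅ (id_X ⊗ f) ≫ (id_X ⊗ g) ≫ (id_X ⊗ h)` -/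
def idLComp₃ (X : C) (f : Y ⟶ Y') (g : Y' ⟶ Y'') (h : Y'' ⟶ Z) :
    T.idL X (f ≫ g ≫ h) ≅ T.idL X f ≫ T.idL X g ≫ T.idL X h :=
  T.idLComp X f (g ≫ h) ≪≫ whiskerLeftIso _ (T.idLComp X g h)

/-- `(f ≫ g ≫ h) ⊗ id_Y ≅ (f ⊗ id_Y) ≫ (g ⊗ id_Y) ≫ (h ⊗ id_Y)` -/
def idRComp₃ (f : X ⟶ X') (g : X' ⟶ X'') (h : X'' ⟶ Z) (Y : C) :
    T.idR (f ≫ g ≫ h) Y ≅ T.idR f Y ≫ T.idR g Y ≫ T.idR h Y :=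
  T.idRComp f (g ≫ h) Y ≪≫ whiskerLeftIso _ (T.idRComp g h Y)

/-- The square `(id_X ⊗ p) ≫ (f ⊗ q') ⟶ (f ⊗ q) ≫ (id_{X'} ⊗ p')` obtained by tensoring the
2-morphism `θ : p ≫ q' ⟶ q ≫ p'` with `1_f` on the left, up to the constraints of `⊗`. -/
def sqL (f : X ⟶ X') {Y₁ Y₂ Y₃ Y₄ : C} {p : Y₁ ⟶ Y₂} {q' : Y₂ ⟶ Y₄} {q : Y₁ ⟶ Y₃} {p' : Y₃ ⟶ Y₄}
    (θ : p ≫ q' ⟶ q ≫ p') : T.idL X p ≫ T.tHom f q' ⟶ T.tHom f q ≫ T.idL X' p' :=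
  (T.tComp (𝟙 X) f p q').inv ≫ T.tHom₂ ((λ_ f).hom ≫ (ρ_ f).inv) θ ≫ (T.tComp f (𝟙 X') q p').hom

/-- The square `(p ⊗ id_X) ≫ (q' ⊗ f) ⟶ (q ⊗ f) ≫ (p' ⊗ id_{X'})` obtained by tensoring the
2-morphism `θ : p ≫ q' ⟶ q ≫ p'` with `1_f` on the right, up to the constraints of `⊗`. -/
def sqR {Y₁ Y₂ Y₃ Y₄ : C} {p : Y₁ ⟶ Y₂} {q' : Y₂ ⟶ Y₄} {q : Y₁ ⟶ Y₃} {p' : Y₃ ⟶ Y₄}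
    (θ : p ≫ q' ⟶ q ≫ p') (f : X ⟶ X') : T.idR p X ≫ T.tHom q' f ⟶ T.tHom q f ≫ T.idR p' X' :=
  (T.tComp p q' (𝟙 X) f).inv ≫ T.tHom₂ θ ((λ_ f).hom ≫ (ρ_ f).inv) ≫ (T.tComp q p' f (𝟙 X')).hom

/-- The tensor product is `K`-bilinear on 2-morphisms. -/
class IsBilinear (K : Type*) [CommRing K] [∀ X Y : C, Preadditive (X ⟶ Y)]
    [∀ X Y : C, Linear K (X ⟶ Y)] (T : TensorFunctor C) : Prop where
  add_left : ∀ {X X' Y Y' : C} {f f' : X ⟶ X'} {g g' : Y ⟶ Y'} (τ₁ τ₂ : f ⟶ f') (σ : g ⟶ g'),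
    T.tHom₂ (τ₁ + τ₂) σ = T.tHom₂ τ₁ σ + T.tHom₂ τ₂ σ
  add_right : ∀ {X X' Y Y' : C} {f f' : X ⟶ X'} {g g' : Y ⟶ Y'} (τ : f ⟶ f') (σ₁ σ₂ : g ⟶ g'),
    T.tHom₂ τ (σ₁ + σ₂) = T.tHom₂ τ σ₁ + T.tHom₂ τ σ₂
  smul_left : ∀ {X X' Y Y' : C} {f f' : X ⟶ X'} {g g' : Y ⟶ Y'} (k : K) (τ : f ⟶ f') (σ : g ⟶ g'),
    T.tHom₂ (k • τ) σ = k • T.tHom₂ τ σ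
  smul_right : ∀ {X X' Y Y' : C} {f f' : X ⟶ X'} {g g' : Y ⟶ Y'} (k : K) (τ : f ⟶ f') (σ : g ⟶ g'),
    T.tHom₂ τ (k • σ) = k • T.tHom₂ τ σ

end
end TensorFunctor

/-- A 1-isomorphism: a 1-morphism with a strict two-sided inverse. -/
def IsOneIso {C : Type u} [Bicategory.{w, v} C] {X Y : C} (f : X ⟶ Y) : Prop :=
  ∃ g : Y ⟶ X, f ≫ g = 𝟙 X ∧ g ≫ f = 𝟙 Y

/-- An associator for the tensor product: a pseudonatural isomorphism with components
1-isomorphisms `a_{X,Y,Z} : X ⊗ (Y ⊗ Z) ⟶ (X ⊗ Y) ⊗ Z` and naturality 2-isomorphisms `â(f, g, h)`,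
which are natural in the 2-morphisms and compatible with composition and with identities. -/
structure TensorAssociator {C : Type u} [Bicategory.{w, v} C] (T : TensorFunctor C) where
  a (X Y Z : C) : T.tObj X (T.tObj Y Z) ⟶ T.tObj (T.tObj X Y) Z
  a_isOneIso (X Y Z : C) : IsOneIso (a X Y Z)
  hat {X X' Y Y' Z Z' : C} (f : X ⟶ X') (g : Y ⟶ Y') (h : Z ⟶ Z') :
    a X Y Z ≫ T.tHom (T.tHom f g) h ≅ T.tHom f (T.tHom g h) ≫ a X' Y' Z'
  hat_natural {X X' Y Y' Z Z' : C} {f₁ f₂ : X ⟶ X'} {g₁ g₂ : Y ⟶ Y'} {h₁ h₂ : Z ⟶ Z'}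
    (τ : f₁ ⟶ f₂) (σ : g₁ ⟶ g₂) (η : h₁ ⟶ h₂) :
    (hat f₁ g₁ h₁).hom ≫ T.tHom₂ τ (T.tHom₂ σ η) ▷ a X' Y' Z' =
      a X Y Z ◁ T.tHom₂ (T.tHom₂ τ σ) η ≫ (hat f₂ g₂ h₂).hom
  hat_comp {X X' X'' Y Y' Y'' Z Z' Z'' : C} (f : X ⟶ X') (f' : X' ⟶ X'') (g : Y ⟶ Y')
    (g' : Y' ⟶ Y'') (h : Z ⟶ Z') (h' : Z' ⟶ Z'') :
    a X Y Z ◁ (T.tComp (T.tHom f g) (T.tHom f' g') h h').inv ≫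
        a X Y Z ◁ T.tHom₂ (T.tComp f f' g g').inv (𝟙 (h ≫ h')) ≫
        (hat (f ≫ f') (g ≫ g') (h ≫ h')).hom =
      𝟙 _ ⊗≫ (hat f g h).hom ▷ T.tHom (T.tHom f' g') h' ⊗≫
        T.tHom f (T.tHom g h) ◁ (hat f' g' h').hom ⊗≫
        (T.tComp f f' (T.tHom g h) (T.tHom g' h')).inv ▷ a X'' Y'' Z'' ≫
        T.tHom₂ (𝟙 (f ≫ f')) (T.tComp g g' h h').inv ▷ a X'' Y'' Z''
  hat_id (X Y Z : C) :
    (hat (𝟙 X) (𝟙 Y) (𝟙 Z)).hom =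
      a X Y Z ◁ (T.tHom₂ (T.tId X Y).hom (𝟙 (𝟙 Z)) ≫ (T.tId (T.tObj X Y) Z).hom) ⊗≫
        ((T.tId X (T.tObj Y Z)).inv ≫ T.tHom₂ (𝟙 (𝟙 X)) (T.tId Y Z).inv) ▷ a X Y Z

namespace TensorAssociator
section
variable {C : Type u} [Bicategory.{w, v} C] {T : TensorFunctor C} (A : TensorAssociator T)

/-- The pseudonatural isomorphism `a^(4)`, on objects. -/
abbrev a₄ (X Y Z W : C) :
    T.tObj X (T.tObj Y (T.tObj Z W)) ⟶ T.tObj (T.tObj (T.tObj X Y) Z) W :=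
  T.idL X (A.a Y Z W) ≫ A.a X (T.tObj Y Z) W ≫ T.idR (A.a X Y Z) W

/-- The pseudonatural isomorphism `^(4)a`, on objects. -/
abbrev b₄ (X Y Z W : C) :
    T.tObj X (T.tObj Y (T.tObj Z W)) ⟶ T.tObj (T.tObj (T.tObj X Y) Z) W :=
  A.a X Y (T.tObj Z W) ≫ A.a (T.tObj X Y) Z W

variable {X X' Y Y' Z Z' W W' : C}

/-- The naturality 2-isomorphisms of `a^(4)`, the pasting of those of its three factors. -/
def a₄Hat (f : X ⟶ X') (g : Y ⟶ Y') (h : Z ⟶ Z') (k : W ⟶ W') :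
    A.a₄ X Y Z W ≫ T.tHom (T.tHom (T.tHom f g) h) k ⟶
      T.tHom f (T.tHom g (T.tHom h k)) ≫ A.a₄ X' Y' Z' W' :=
  𝟙 _ ⊗≫ (T.idL X (A.a Y Z W) ≫ A.a X (T.tObj Y Z) W) ◁ T.sqR (A.hat f g h).hom k
    ⊗≫ T.idL X (A.a Y Z W) ◁ (A.hat f (T.tHom g h) k).hom ▷ T.idR (A.a X' Y' Z') W'
    ⊗≫ T.sqL f (A.hat g h k).hom ▷ (A.a X' (T.tObj Y' Z') W' ≫ T.idR (A.a X' Y' Z') W') ⊗≫ 𝟙 _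

/-- The naturality 2-isomorphisms of `^(4)a`, the pasting of those of its two factors. -/
def b₄Hat (f : X ⟶ X') (g : Y ⟶ Y') (h : Z ⟶ Z') (k : W ⟶ W') :
    A.b₄ X Y Z W ≫ T.tHom (T.tHom (T.tHom f g) h) k ⟶
      T.tHom f (T.tHom g (T.tHom h k)) ≫ A.b₄ X' Y' Z' W' :=
  𝟙 _ ⊗≫ A.a X Y (T.tObj Z W) ◁ (A.hat (T.tHom f g) h k).hom
    ⊗≫ (A.hat f g (T.tHom h k)).hom ▷ A.a (T.tObj X' Y') Z' W' ⊗≫ 𝟙 _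

/-- Pseudomodifications `a ⇛ a`: families of 2-morphisms, without naturality. -/
abbrev PseudoMod₃ := ∀ X Y Z : C, A.a X Y Z ⟶ A.a X Y Z

/-- Pseudomodifications `a^(4) ⇛ ^(4)a`: families of 2-morphisms, without naturality. -/
abbrev PseudoMod₄ := ∀ X Y Z W : C, A.a₄ X Y Z W ⟶ A.b₄ X Y Z W

/-- `n` is a modification `a ⇛ a`, that is, natural in `X, Y, Z`. -/
def IsMod₃ (n : A.PseudoMod₃) : Prop :=
  ∀ {X X' Y Y' Z Z' : C} (f : X ⟶ X') (g : Y ⟶ Y') (h : Z ⟶ Z'),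
    n X Y Z ▷ T.tHom (T.tHom f g) h ≫ (A.hat f g h).hom =
      (A.hat f g h).hom ≫ T.tHom f (T.tHom g h) ◁ n X' Y' Z'

/-- `n` is a modification `a^(4) ⇛ ^(4)a`, that is, natural in `X, Y, Z, W`. -/
def IsMod₄ (n : A.PseudoMod₄) : Prop :=
  ∀ {X X' Y Y' Z Z' W W' : C} (f : X ⟶ X') (g : Y ⟶ Y') (h : Z ⟶ Z') (k : W ⟶ W'),
    n X Y Z W ▷ T.tHom (T.tHom (T.tHom f g) h) k ≫ A.b₄Hat f g h k =
      A.a₄Hat f g h k ≫ T.tHom f (T.tHom g (T.tHom h k)) ◁ n X' Y' Z' W'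

section
variable (X Y Z U V : C)

/-- The reference path `a^(5) : X(Y(Z(UV))) ⟶ (((XY)Z)U)V`, the composite of
`id_X ⊗ a^(4)_{Y,Z,U,V}` (factor by factor), `a_{X,(YZ)U,V}`, `a_{X,YZ,U} ⊗ id_V` and
`(a_{X,Y,Z} ⊗ id_U) ⊗ id_V`. -/
abbrev a₅ : T.tObj X (T.tObj Y (T.tObj Z (T.tObj U V))) ⟶
    T.tObj (T.tObj (T.tObj (T.tObj X Y) Z) U) V :=
  T.idL X (T.idL Y (A.a Z U V)) ≫ T.idL X (A.a Y (T.tObj Z U) V) ≫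
    T.idL X (T.idR (A.a Y Z U) V) ≫ A.a X (T.tObj (T.tObj Y Z) U) V ≫
    T.idR (A.a X (T.tObj Y Z) U) V ≫ T.idR (T.idR (A.a X Y Z) U) V

/-- The reference path `^(5)a : X(Y(Z(UV))) ⟶ (((XY)Z)U)V`. -/
abbrev b₅ : T.tObj X (T.tObj Y (T.tObj Z (T.tObj U V))) ⟶
    T.tObj (T.tObj (T.tObj (T.tObj X Y) Z) U) V :=
  A.a X Y (T.tObj Z (T.tObj U V)) ≫ A.a (T.tObj X Y) Z (T.tObj U V) ≫
    A.a (T.tObj (T.tObj X Y) Z) U V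

/-! The paths of associators between `a^(5)` and `^(5)a` along the two halves of the boundary of the
three-dimensional associahedron: `a₅, p₁, p₂, p₃, p₄, b₅` and `a₅, q₁, q₂, q₃, b₅`. Two consecutive
ones differ by one face, a pentagon (an instance of `n`) or a square (an instance of `â`). -/

/-- The path after the square `â(id_X, a_{Y,Z,U}, id_V)`. -/
abbrev p₁ : T.tObj X (T.tObj Y (T.tObj Z (T.tObj U V))) ⟶
    T.tObj (T.tObj (T.tObj (T.tObj X Y) Z) U) V :=
  T.idL X (T.idL Y (A.a Z U V)) ≫ T.idL X (A.a Y (T.tObj Z U) V) ≫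
    A.a X (T.tObj Y (T.tObj Z U)) V ≫ T.idR (T.idL X (A.a Y Z U)) V ≫
    T.idR (A.a X (T.tObj Y Z) U) V ≫ T.idR (T.idR (A.a X Y Z) U) V

/-- The path after the pentagon of `X, Y, Z, U`, tensored with `V`. -/
abbrev p₂ : T.tObj X (T.tObj Y (T.tObj Z (T.tObj U V))) ⟶
    T.tObj (T.tObj (T.tObj (T.tObj X Y) Z) U) V :=
  T.idL X (T.idL Y (A.a Z U V)) ≫ T.idL X (A.a Y (T.tObj Z U) V) ≫
    A.a X (T.tObj Y (T.tObj Z U)) V ≫ T.idR (A.a X Y (T.tObj Z U)) V ≫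
    T.idR (A.a (T.tObj X Y) Z U) V

/-- The path after the pentagon of `X, Y, Z ⊗ U, V`. -/
abbrev p₃ : T.tObj X (T.tObj Y (T.tObj Z (T.tObj U V))) ⟶
    T.tObj (T.tObj (T.tObj (T.tObj X Y) Z) U) V :=
  T.idL X (T.idL Y (A.a Z U V)) ≫ A.a X Y (T.tObj (T.tObj Z U) V) ≫
    A.a (T.tObj X Y) (T.tObj Z U) V ≫ T.idR (A.a (T.tObj X Y) Z U) V

/-- The path after the square `â(id_X, id_Y, a_{Z,U,V})`. -/
abbrev p₄ : T.tObj X (T.tObj Y (T.tObj Z (T.tObj U V))) ⟶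
    T.tObj (T.tObj (T.tObj (T.tObj X Y) Z) U) V :=
  A.a X Y (T.tObj Z (T.tObj U V)) ≫ T.idL (T.tObj X Y) (A.a Z U V) ≫
    A.a (T.tObj X Y) (T.tObj Z U) V ≫ T.idR (A.a (T.tObj X Y) Z U) V

/-- The path after the pentagon of `Y, Z, U, V`, tensored with `X`. -/
abbrev q₁ : T.tObj X (T.tObj Y (T.tObj Z (T.tObj U V))) ⟶
    T.tObj (T.tObj (T.tObj (T.tObj X Y) Z) U) V :=
  T.idL X (A.a Y Z (T.tObj U V)) ≫ T.idL X (A.a (T.tObj Y Z) U V) ≫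
    A.a X (T.tObj (T.tObj Y Z) U) V ≫ T.idR (A.a X (T.tObj Y Z) U) V ≫
    T.idR (T.idR (A.a X Y Z) U) V

/-- The path after the pentagon of `X, Y ⊗ Z, U, V`. -/
abbrev q₂ : T.tObj X (T.tObj Y (T.tObj Z (T.tObj U V))) ⟶
    T.tObj (T.tObj (T.tObj (T.tObj X Y) Z) U) V :=
  T.idL X (A.a Y Z (T.tObj U V)) ≫ A.a X (T.tObj Y Z) (T.tObj U V) ≫
    A.a (T.tObj X (T.tObj Y Z)) U V ≫ T.idR (T.idR (A.a X Y Z) U) V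

/-- The path after the square `â(a_{X,Y,Z}, id_U, id_V)`. -/
abbrev q₃ : T.tObj X (T.tObj Y (T.tObj Z (T.tObj U V))) ⟶
    T.tObj (T.tObj (T.tObj (T.tObj X Y) Z) U) V :=
  T.idL X (A.a Y Z (T.tObj U V)) ≫ A.a X (T.tObj Y Z) (T.tObj U V) ≫
    T.idR (A.a X Y Z) (T.tObj U V) ≫ A.a (T.tObj (T.tObj X Y) Z) U V

variable {A}

/-- The square `â(id_X, a_{Y,Z,U}, id_V)`. -/
def faceP₀ : A.a₅ X Y Z U V ≅ A.p₁ X Y Z U V :=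
  Iso.refl _ ≪⊗≫ whiskerLeftIso (T.idL X (T.idL Y (A.a Z U V)) ≫ T.idL X (A.a Y (T.tObj Z U) V))
    (whiskerRightIso (A.hat (𝟙 X) (A.a Y Z U) (𝟙 V)).symm
      (T.idR (A.a X (T.tObj Y Z) U) V ≫ T.idR (T.idR (A.a X Y Z) U) V)) ≪⊗≫ Iso.refl _

/-- The face `n_{X,Y,Z,U} ⊗ 1_{id_V}`, with the constraints of `⊗` that distribute `- ⊗ id_V`. -/
def faceP₁ (n : A.PseudoMod₄) : A.p₁ X Y Z U V ⟶ A.p₂ X Y Z U V :=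
  𝟙 _ ⊗≫ (T.idL X (T.idL Y (A.a Z U V)) ≫ T.idL X (A.a Y (T.tObj Z U) V) ≫
    A.a X (T.tObj Y (T.tObj Z U)) V) ◁ ((T.idRComp₃ _ _ _ V).inv ≫
      T.tHom₂ (n X Y Z U) (𝟙 (𝟙 V)) ≫ (T.idRComp _ _ V).hom) ⊗≫ 𝟙 _

/-- The face `n_{X,Y,Z⊗U,V}`. -/
def faceP₂ (n : A.PseudoMod₄) : A.p₂ X Y Z U V ⟶ A.p₃ X Y Z U V :=
  𝟙 _ ⊗≫ T.idL X (T.idL Y (A.a Z U V)) ◁ n X Y (T.tObj Z U) V ▷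
    T.idR (A.a (T.tObj X Y) Z U) V ⊗≫ 𝟙 _

/-- The square `â(id_X, id_Y, a_{Z,U,V})`, with `id_X ⊗ id_Y ≅ id_{X ⊗ Y}`. -/
def faceP₃ : A.p₃ X Y Z U V ⟶ A.p₄ X Y Z U V :=
  𝟙 _ ⊗≫ ((A.hat (𝟙 X) (𝟙 Y) (A.a Z U V)).inv ≫
    A.a X Y (T.tObj Z (T.tObj U V)) ◁ T.tHom₂ (T.tId X Y).hom (𝟙 (A.a Z U V))) ▷
      (A.a (T.tObj X Y) (T.tObj Z U) V ≫ T.idR (A.a (T.tObj X Y) Z U) V) ⊗≫ 𝟙 _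

/-- The face `n_{X⊗Y,Z,U,V}`. -/
def faceP₄ (n : A.PseudoMod₄) : A.p₄ X Y Z U V ⟶ A.b₅ X Y Z U V :=
  A.a X Y (T.tObj Z (T.tObj U V)) ◁ n (T.tObj X Y) Z U V

/-- The face `1_{id_X} ⊗ n_{Y,Z,U,V}`, with the constraints of `⊗` that distribute `id_X ⊗ -`. -/
def faceQ₀ (n : A.PseudoMod₄) : A.a₅ X Y Z U V ⟶ A.q₁ X Y Z U V :=
  𝟙 _ ⊗≫ ((T.idLComp₃ X _ _ _).inv ≫ T.tHom₂ (𝟙 (𝟙 X)) (n Y Z U V) ≫ (T.idLComp X _ _).hom) ▷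
    (A.a X (T.tObj (T.tObj Y Z) U) V ≫ T.idR (A.a X (T.tObj Y Z) U) V ≫
      T.idR (T.idR (A.a X Y Z) U) V) ⊗≫ 𝟙 _

/-- The face `n_{X,Y⊗Z,U,V}`. -/
def faceQ₁ (n : A.PseudoMod₄) : A.q₁ X Y Z U V ⟶ A.q₂ X Y Z U V :=
  𝟙 _ ⊗≫ T.idL X (A.a Y Z (T.tObj U V)) ◁ n X (T.tObj Y Z) U V ▷
    T.idR (T.idR (A.a X Y Z) U) V ⊗≫ 𝟙 _

/-- The square `â(a_{X,Y,Z}, id_U, id_V)`, with `id_U ⊗ id_V ≅ id_{U ⊗ V}`. -/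
def faceQ₂ : A.q₂ X Y Z U V ⟶ A.q₃ X Y Z U V :=
  𝟙 _ ⊗≫ (T.idL X (A.a Y Z (T.tObj U V)) ≫ A.a X (T.tObj Y Z) (T.tObj U V)) ◁
    ((A.hat (A.a X Y Z) (𝟙 U) (𝟙 V)).hom ≫
      T.tHom₂ (𝟙 (A.a X Y Z)) (T.tId U V).hom ▷ A.a (T.tObj (T.tObj X Y) Z) U V) ⊗≫ 𝟙 _

/-- The face `n_{X,Y,Z,U⊗V}`. -/
def faceQ₃ (n : A.PseudoMod₄) : A.q₃ X Y Z U V ⟶ A.b₅ X Y Z U V :=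
  𝟙 _ ⊗≫ n X Y Z (T.tObj U V) ▷ A.a (T.tObj (T.tObj X Y) Z) U V ⊗≫ 𝟙 _

end
end
end TensorAssociator

/-- A pentagonator for `(C, ⊗, a)`: an invertible modification `π : a^(4) ⇛ ^(4)a` such that the
`K₅` relation holds, the equality of the two pastings of the faces of the associahedron. A
2-category with `⊗`, `a` and `π` is a semigroupal 2-category. -/
structure Pentagonator {C : Type u} [Bicategory.{w, v} C] {T : TensorFunctor C}
    (A : TensorAssociator T) where
  π (X Y Z W : C) : A.a₄ X Y Z W ≅ A.b₄ X Y Z W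
  isMod : A.IsMod₄ fun X Y Z W => (π X Y Z W).hom
  k₅ (X Y Z U V : C) :
    (A.faceP₀ X Y Z U V).hom ≫ A.faceP₁ X Y Z U V (fun X Y Z W => (π X Y Z W).hom) ≫
        A.faceP₂ X Y Z U V (fun X Y Z W => (π X Y Z W).hom) ≫ A.faceP₃ X Y Z U V ≫
        A.faceP₄ X Y Z U V (fun X Y Z W => (π X Y Z W).hom) =
      A.faceQ₀ X Y Z U V (fun X Y Z W => (π X Y Z W).hom) ≫
        A.faceQ₁ X Y Z U V (fun X Y Z W => (π X Y Z W).hom) ≫ A.faceQ₂ X Y Z U V ≫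
        A.faceQ₃ X Y Z U V (fun X Y Z W => (π X Y Z W).hom)

namespace Pentagonator
section
variable {C : Type u} [Bicategory.{w, v} C] {T : TensorFunctor C} {A : TensorAssociator T}
  (P : Pentagonator A)

/-- The underlying pseudomodification. -/
abbrev hom : A.PseudoMod₄ := fun X Y Z W => (P.π X Y Z W).hom

/-! The padding `⌈⌈σ⌉⌉` of a 2-morphism `σ` between paths of associators is the whiskering of `σ` by
paths of associators, composed with the canonical 2-isomorphisms (pastings of structural
2-isomorphisms and their inverses) from and to the reference paths. For the terms of the coboundary
of `n : a ⇛ a` one of the two canonical 2-isomorphisms is an identity and the other one is `π`. -/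

/-- The padding of `1_{id_X} ⊗ n_{Y,Z,W}`. -/
def pad₃₁ (n : A.PseudoMod₃) : A.PseudoMod₄ := fun X Y Z W =>
  (T.tHom₂ (𝟙 (𝟙 X)) (n Y Z W) ▷ (A.a X (T.tObj Y Z) W ≫ T.idR (A.a X Y Z) W)) ≫ P.hom X Y Z W

/-- The padding of `n_{X⊗Y,Z,W}`. -/
def pad₃₂ (n : A.PseudoMod₃) : A.PseudoMod₄ := fun X Y Z W =>
  P.hom X Y Z W ≫ A.a X Y (T.tObj Z W) ◁ n (T.tObj X Y) Z W

/-- The padding of `n_{X,Y⊗Z,W}`. -/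
def pad₃₃ (n : A.PseudoMod₃) : A.PseudoMod₄ := fun X Y Z W =>
  (T.idL X (A.a Y Z W) ◁ n X (T.tObj Y Z) W ▷ T.idR (A.a X Y Z) W) ≫ P.hom X Y Z W

/-- The padding of `n_{X,Y,Z⊗W}`. -/
def pad₃₄ (n : A.PseudoMod₃) : A.PseudoMod₄ := fun X Y Z W =>
  P.hom X Y Z W ≫ n X Y (T.tObj Z W) ▷ A.a (T.tObj X Y) Z W

/-- The padding of `n_{X,Y,Z} ⊗ 1_{id_W}`. -/
def pad₃₅ (n : A.PseudoMod₃) : A.PseudoMod₄ := fun X Y Z W =>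
  (T.idL X (A.a Y Z W) ◁ A.a X (T.tObj Y Z) W ◁ T.tHom₂ (n X Y Z) (𝟙 (𝟙 W))) ≫ P.hom X Y Z W

/-- Pseudomodifications `a^(5) ⇛ ^(5)a`. -/
abbrev PseudoMod₅ (A : TensorAssociator T) := ∀ X Y Z U V : C, A.a₅ X Y Z U V ⟶ A.b₅ X Y Z U V

variable (K : Type*) [CommRing K] [∀ X Y : C, Preadditive (X ⟶ Y)]
  [∀ X Y : C, Linear K (X ⟶ Y)] [LinearBicategory K C] [T.IsBilinear K]

/-- The coboundary from degree 2 to degree 3. -/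
def δ₂ : A.PseudoMod₃ →ₗ[K] A.PseudoMod₄ where
  toFun n := P.pad₃₁ n - P.pad₃₂ n + P.pad₃₃ n - P.pad₃₄ n + P.pad₃₅ n
  map_add' n m := by
    funext X Y Z W
    simp [pad₃₁, pad₃₂, pad₃₃, pad₃₄, pad₃₅,
      TensorFunctor.IsBilinear.add_left K, TensorFunctor.IsBilinear.add_right K,
      LinearBicategory.whiskerLeft_add K, LinearBicategory.whiskerRight_add K]
    abel
  map_smul' k n := by
    funext X Y Z W
    simp [pad₃₁, pad₃₂, pad₃₃, pad₃₄, pad₃₅,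
      TensorFunctor.IsBilinear.smul_left, TensorFunctor.IsBilinear.smul_right,
      LinearBicategory.whiskerLeft_smul, LinearBicategory.whiskerRight_smul,
      smul_add, smul_sub]

end
end Pentagonator

namespace ScalarExt
section
variable {K R : Type*} [CommRing K] [CommRing R] [Algebra K R]
  {C : Type u} [Bicategory.{w, v} C]
  [∀ X Y : C, Preadditive (X ⟶ Y)] [∀ X Y : C, Linear K (X ⟶ Y)]

variable (T : TensorFunctor C) [T.IsBilinear K]

/-- The tensor product of 2-morphisms as a bilinear map. -/
def tensorLin {X X' Y Y' : C} (f f' : X ⟶ X') (g g' : Y ⟶ Y') :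
    (f ⟶ f') →ₗ[K] (g ⟶ g') →ₗ[K] (T.tHom f g ⟶ T.tHom f' g') :=
  LinearMap.mk₂ K (fun τ σ => T.tHom₂ τ σ)
    (TensorFunctor.IsBilinear.add_left K) TensorFunctor.IsBilinear.smul_left
    (TensorFunctor.IsBilinear.add_right K) TensorFunctor.IsBilinear.smul_right

/-- `X ⊗ Y` for objects. -/
def tensorObj (X Y : ScalarExt K R C) : ScalarExt K R C := ⟨T.tObj X.as Y.as⟩

/-- The extended tensor product on 1-morphisms. -/
def tensorHom {X X' Y Y' : ScalarExt K R C} (f : X ⟶ X') (g : Y ⟶ Y') :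
    tensorObj T X Y ⟶ tensorObj T X' Y' := ⟨T.tHom f.as g.as⟩

/-- The extended tensor product on 2-morphisms, `(τ ⊗ r) ⊗ (σ ⊗ s) = (τ ⊗ σ) ⊗ (r * s)`. -/
def tensorHom₂ {X X' Y Y' : ScalarExt K R C} {f f' : X ⟶ X'} {g g' : Y ⟶ Y'}
    (τ : f ⟶ f') (σ : g ⟶ g') : tensorHom T f g ⟶ tensorHom T f' g' :=
  TensorProduct.map₂ (tensorLin (K := K) T f.as f'.as g.as g'.as) (LinearMap.mul K R) τ σ

section
variable {X X' Y Y' : ScalarExt K R C} {f f' f'' : X ⟶ X'} {g g' g'' : Y ⟶ Y'}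

lemma tensorHom₂_add_left (τ τ' : f ⟶ f') (σ : g ⟶ g') :
    tensorHom₂ T (τ + τ') σ = tensorHom₂ T τ σ + tensorHom₂ T τ' σ := by
  change TensorProduct.map₂ _ _ _ _ = _
  rw [map_add]; rfl

lemma tensorHom₂_add_right (τ : f ⟶ f') (σ σ' : g ⟶ g') :
    tensorHom₂ T τ (σ + σ') = tensorHom₂ T τ σ + tensorHom₂ T τ σ' := by
  change TensorProduct.map₂ _ _ _ _ = _
  rw [map_add]; rfl

lemma tensorHom₂_tm (τ : f.as ⟶ f'.as) (σ : g.as ⟶ g'.as) (r s : R) :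
    tensorHom₂ T (tm τ r : f ⟶ f') (tm σ s : g ⟶ g') = tm (T.tHom₂ τ σ) (r * s) := rfl

lemma tensorHom₂_ind {P : (f ⟶ f') → (g ⟶ g') → Prop} (τ : f ⟶ f') (σ : g ⟶ g')
    (htm : ∀ (τ : f.as ⟶ f'.as) (r : R) (σ : g.as ⟶ g'.as) (s : R), P (tm τ r) (tm σ s))
    (hl : ∀ τ τ' σ, P τ σ → P τ' σ → P (τ + τ') σ)
    (hr : ∀ τ σ σ', P τ σ → P τ σ' → P τ (σ + σ')) : P τ σ :=
  ind (P := fun τ => P τ σ) τ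
    (fun a r => ind (P := fun σ => P (tm a r) σ) σ (fun b s => htm a r b s) (fun _ _ => hr _ _ _))
    (fun _ _ => hl _ _ _)

lemma tensorHom₂_comp (τ : f ⟶ f') (τ' : f' ⟶ f'') (σ : g ⟶ g') (σ' : g' ⟶ g'') :
    tensorHom₂ T (τ ≫ τ') (σ ≫ σ') = tensorHom₂ T τ σ ≫ tensorHom₂ T τ' σ' := by
  refine tensorHom₂_ind (P := fun τ σ =>
    tensorHom₂ T (τ ≫ τ') (σ ≫ σ') = tensorHom₂ T τ σ ≫ tensorHom₂ T τ' σ') τ σ ?_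
    (fun a b σ ha hb => ?_) (fun τ a b ha hb => ?_)
  · intro τ r σ s
    refine tensorHom₂_ind (P := fun τ' σ' =>
      tensorHom₂ T (tm τ r ≫ τ') (tm σ s ≫ σ') = tensorHom₂ T (tm τ r) (tm σ s) ≫
        tensorHom₂ T τ' σ') τ' σ' ?_
      (fun a b σ ha hb => ?_) (fun τ a b ha hb => ?_)
    · intro τ' r' σ' s'
      refine tm_congr ?_ (mul_mul_mul_comm _ _ _ _)
      exact T.map₂_comp (a := (_, _)) (b := (_, _)) (f := _ ×ₘ _) (g := _ ×ₘ _) (h := _ ×ₘ _)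
        (τ ×ₘ σ) (τ' ×ₘ σ')
    · simp only [Preadditive.comp_add, tensorHom₂_add_left, ha, hb]
    · simp only [Preadditive.comp_add, tensorHom₂_add_right, ha, hb]
  · simp only [Preadditive.add_comp, tensorHom₂_add_left, ha, hb]
  · simp only [Preadditive.add_comp, tensorHom₂_add_right, ha, hb]

end

variable [LinearBicategory K C]

/-- The `R`-linear extension of a `K`-bilinear tensor product, with the same constraints. -/
def tensorExt : TensorFunctor (ScalarExt K R C) where
  obj X := tensorObj T X.1 X.2
  map f := tensorHom T f.1 f.2
  map₂ η := tensorHom₂ T η.1 η.2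
  map₂_id {X Y} f := tm_congr (T.map₂_id (a := (X.1.as, X.2.as)) (b := (Y.1.as, Y.2.as))
    (f.1.as ×ₘ f.2.as)) (one_mul 1)
  map₂_comp η θ := tensorHom₂_comp T _ _ _ _
  mapId X := tmIso (T.tId X.1.as X.2.as)
  mapComp f g := tmIso (T.tComp f.1.as g.1.as f.2.as g.2.as)
  map₂_whisker_left {X Y Z} f {g h} η := by
    refine tensorHom₂_ind (P := fun η₁ η₂ => tensorHom₂ T (f.1 ◁ η₁) (f.2 ◁ η₂) =
      (tmIso (T.tComp f.1.as g.1.as f.2.as g.2.as) :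
        tensorHom T (f.1 ≫ g.1) (f.2 ≫ g.2) ≅ tensorHom T f.1 f.2 ≫ tensorHom T g.1 g.2).hom ≫
      tensorHom T f.1 f.2 ◁ tensorHom₂ T η₁ η₂ ≫
      (tmIso (T.tComp f.1.as h.1.as f.2.as h.2.as) :
        tensorHom T (f.1 ≫ h.1) (f.2 ≫ h.2) ≅ tensorHom T f.1 f.2 ≫ tensorHom T h.1 h.2).inv)
      η.1 η.2 (fun τ r σ s => ?_) (fun a b σ ha hb => ?_) (fun τ a b ha hb => ?_)
    · exact tm_congr (T.map₂_whisker_left (a := (X.1.as, X.2.as)) (b := (Y.1.as, Y.2.as))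
        (c := (Z.1.as, Z.2.as)) (f.1.as ×ₘ f.2.as) (g := g.1.as ×ₘ g.2.as)
        (h := h.1.as ×ₘ h.2.as) (τ ×ₘ σ)) (by simp)
    · simp only [tensorHom₂_add_left, whiskerLeft_add', ha, hb, Preadditive.add_comp,
        Preadditive.comp_add]
    · simp only [tensorHom₂_add_right, whiskerLeft_add', ha, hb, Preadditive.add_comp,
        Preadditive.comp_add]
  map₂_whisker_right {X Y Z} f g η h := by
    refine tensorHom₂_ind (P := fun η₁ η₂ => tensorHom₂ T (η₁ ▷ h.1) (η₂ ▷ h.2) =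
      (tmIso (T.tComp f.1.as h.1.as f.2.as h.2.as) :
        tensorHom T (f.1 ≫ h.1) (f.2 ≫ h.2) ≅ tensorHom T f.1 f.2 ≫ tensorHom T h.1 h.2).hom ≫
      tensorHom₂ T η₁ η₂ ▷ tensorHom T h.1 h.2 ≫
      (tmIso (T.tComp g.1.as h.1.as g.2.as h.2.as) :
        tensorHom T (g.1 ≫ h.1) (g.2 ≫ h.2) ≅ tensorHom T g.1 g.2 ≫ tensorHom T h.1 h.2).inv)
      η.1 η.2 (fun τ r σ s => ?_) (fun a b σ ha hb => ?_) (fun τ a b ha hb => ?_)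
    · exact tm_congr (T.map₂_whisker_right (a := (X.1.as, X.2.as)) (b := (Y.1.as, Y.2.as))
        (c := (Z.1.as, Z.2.as)) (f := f.1.as ×ₘ f.2.as) (g := g.1.as ×ₘ g.2.as)
        (τ ×ₘ σ) (h.1.as ×ₘ h.2.as)) (by simp)
    · simp only [tensorHom₂_add_left, whiskerRight_add', ha, hb, Preadditive.add_comp,
        Preadditive.comp_add]
    · simp only [tensorHom₂_add_right, whiskerRight_add', ha, hb, Preadditive.add_comp,
        Preadditive.comp_add]
  map₂_associator {X Y Z W} f g h := tm_congr (T.map₂_associator (a := (X.1.as, X.2.as))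
    (b := (Y.1.as, Y.2.as)) (c := (Z.1.as, Z.2.as)) (d := (W.1.as, W.2.as))
    (f.1.as ×ₘ f.2.as) (g.1.as ×ₘ g.2.as) (h.1.as ×ₘ h.2.as)) (by simp)
  map₂_left_unitor {X Y} f := tm_congr (T.map₂_left_unitor (a := (X.1.as, X.2.as))
    (b := (Y.1.as, Y.2.as)) (f.1.as ×ₘ f.2.as)) (by simp)
  map₂_right_unitor {X Y} f := tm_congr (T.map₂_right_unitor (a := (X.1.as, X.2.as))
    (b := (Y.1.as, Y.2.as)) (f.1.as ×ₘ f.2.as)) (by simp)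

/-- The `R`-linear extension of an associator, with the same components and 2-isomorphisms. -/
def associatorExt {T : TensorFunctor C} [T.IsBilinear K] (A : TensorAssociator T) :
    TensorAssociator (tensorExt (K := K) (R := R) T) where
  a X Y Z := ⟨A.a X.as Y.as Z.as⟩
  a_isOneIso X Y Z := by
    obtain ⟨g, h₁, h₂⟩ := A.a_isOneIso X.as Y.as Z.as
    exact ⟨⟨g⟩, congrArg Hom.of h₁, congrArg Hom.of h₂⟩
  hat f g h := tmIso (A.hat f.as g.as h.as)
  hat_natural {X X' Y Y' Z Z' f₁ f₂ g₁ g₂ h₁ h₂} τ σ η := by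
    let A₁ : tensorObj T X (tensorObj T Y Z) ⟶ tensorObj T (tensorObj T X Y) Z :=
      ⟨A.a X.as Y.as Z.as⟩
    let A₂ : tensorObj T X' (tensorObj T Y' Z') ⟶ tensorObj T (tensorObj T X' Y') Z' :=
      ⟨A.a X'.as Y'.as Z'.as⟩
    let H (f : X ⟶ X') (g : Y ⟶ Y') (h : Z ⟶ Z') :
        A₁ ≫ tensorHom T (tensorHom T f g) h ⟶ tensorHom T f (tensorHom T g h) ≫ A₂ :=
      tm (A.hat f.as g.as h.as).hom 1
    change H f₁ g₁ h₁ ≫ tensorHom₂ T τ (tensorHom₂ T σ η) ▷ A₂ =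
      A₁ ◁ tensorHom₂ T (tensorHom₂ T τ σ) η ≫ H f₂ g₂ h₂
    refine tensorHom₂_ind (P := fun τ σ => H f₁ g₁ h₁ ≫ tensorHom₂ T τ (tensorHom₂ T σ η) ▷ A₂ =
      A₁ ◁ tensorHom₂ T (tensorHom₂ T τ σ) η ≫ H f₂ g₂ h₂) τ σ (fun τ r σ s => ?_)
      (fun a b σ ha hb => ?_) (fun τ a b ha hb => ?_)
    · refine ind (P := fun η => H f₁ g₁ h₁ ≫
          tensorHom₂ T (tm τ r) (tensorHom₂ T (tm σ s) η) ▷ A₂ =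
        A₁ ◁ tensorHom₂ T (tensorHom₂ T (tm τ r) (tm σ s)) η ≫ H f₂ g₂ h₂) η
        (fun η t => ?_) (fun a b ha hb => ?_)
      · exact tm_congr (A.hat_natural τ σ η) (by simp [mul_assoc])
      · simp only [tensorHom₂_add_right, whiskerLeft_add', whiskerRight_add',
          Preadditive.add_comp, Preadditive.comp_add, ha, hb]
    · simp only [tensorHom₂_add_left, whiskerLeft_add', whiskerRight_add',
          Preadditive.add_comp, Preadditive.comp_add, ha, hb]
    · simp only [tensorHom₂_add_left, tensorHom₂_add_right, whiskerLeft_add', whiskerRight_add',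
          Preadditive.add_comp, Preadditive.comp_add, ha, hb]
  hat_comp f f' g g' h h' := by
    refine tm_congr (A.hat_comp f.as f'.as g.as g'.as h.as h'.as) ?_
    simp
  hat_id X Y Z := by
    refine tm_congr (A.hat_id X.as Y.as Z.as) ?_
    simp

end
end ScalarExt

namespace Pentagonator
section
variable {C : Type u} [Bicategory.{w, v} C] {T : TensorFunctor C} {A : TensorAssociator T}
  (P : Pentagonator A)

/-! The paddings of the six terms of the coboundary of `n : a^(4) ⇛ ^(4)a`: in each of them, the
composite before and the composite after the face that contains `n` are canonical 2-isomorphisms,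
pastings of instances of `π`, `â` and the constraints of `⊗`. -/

/-- The padding of `1_{id_X} ⊗ n_{Y,Z,U,V}`. -/
def pad₄₁ (n : A.PseudoMod₄) : PseudoMod₅ A := fun X Y Z U V =>
  A.faceQ₀ X Y Z U V n ≫ A.faceQ₁ X Y Z U V P.hom ≫ A.faceQ₂ X Y Z U V ≫ A.faceQ₃ X Y Z U V P.hom

/-- The padding of `n_{X⊗Y,Z,U,V}`. -/
def pad₄₂ (n : A.PseudoMod₄) : PseudoMod₅ A := fun X Y Z U V =>
  (A.faceP₀ X Y Z U V).hom ≫ A.faceP₁ X Y Z U V P.hom ≫ A.faceP₂ X Y Z U V P.hom ≫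
    A.faceP₃ X Y Z U V ≫ A.faceP₄ X Y Z U V n

/-- The padding of `n_{X,Y⊗Z,U,V}`. -/
def pad₄₃ (n : A.PseudoMod₄) : PseudoMod₅ A := fun X Y Z U V =>
  A.faceQ₀ X Y Z U V P.hom ≫ A.faceQ₁ X Y Z U V n ≫ A.faceQ₂ X Y Z U V ≫ A.faceQ₃ X Y Z U V P.hom

/-- The padding of `n_{X,Y,Z⊗U,V}`. -/
def pad₄₄ (n : A.PseudoMod₄) : PseudoMod₅ A := fun X Y Z U V =>
  (A.faceP₀ X Y Z U V).hom ≫ A.faceP₁ X Y Z U V P.hom ≫ A.faceP₂ X Y Z U V n ≫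
    A.faceP₃ X Y Z U V ≫ A.faceP₄ X Y Z U V P.hom

/-- The padding of `n_{X,Y,Z,U⊗V}`. -/
def pad₄₅ (n : A.PseudoMod₄) : PseudoMod₅ A := fun X Y Z U V =>
  A.faceQ₀ X Y Z U V P.hom ≫ A.faceQ₁ X Y Z U V P.hom ≫ A.faceQ₂ X Y Z U V ≫ A.faceQ₃ X Y Z U V n

/-- The padding of `n_{X,Y,Z,U} ⊗ 1_{id_V}`. -/
def pad₄₆ (n : A.PseudoMod₄) : PseudoMod₅ A := fun X Y Z U V =>
  (A.faceP₀ X Y Z U V).hom ≫ A.faceP₁ X Y Z U V n ≫ A.faceP₂ X Y Z U V P.hom ≫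
    A.faceP₃ X Y Z U V ≫ A.faceP₄ X Y Z U V P.hom

variable (K : Type*) [CommRing K] [∀ X Y : C, Preadditive (X ⟶ Y)]
  [∀ X Y : C, Linear K (X ⟶ Y)] [LinearBicategory K C] [T.IsBilinear K]

/-- The coboundary from degree 3 to degree 4. -/
def δ₃ : A.PseudoMod₄ →ₗ[K] PseudoMod₅ A where
  toFun n := P.pad₄₁ n - P.pad₄₂ n + P.pad₄₃ n - P.pad₄₄ n + P.pad₄₅ n - P.pad₄₆ n
  map_add' n m := by
    funext X Y Z U V
    simp [pad₄₁, pad₄₂, pad₄₃, pad₄₄, pad₄₅, pad₄₆, TensorAssociator.faceP₁,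
      TensorAssociator.faceP₂, TensorAssociator.faceP₄, TensorAssociator.faceQ₀,
      TensorAssociator.faceQ₁, TensorAssociator.faceQ₃, bicategoricalComp,
      TensorFunctor.IsBilinear.add_left K, TensorFunctor.IsBilinear.add_right K,
      LinearBicategory.whiskerLeft_add K, LinearBicategory.whiskerRight_add K,
      -comp_whiskerRight, -whiskerRight_comp, -comp_whiskerLeft, -whisker_assoc,
      -whiskerLeft_comp]
    abel
  map_smul' k n := by
    funext X Y Z U V
    simp [pad₄₁, pad₄₂, pad₄₃, pad₄₄, pad₄₅, pad₄₆, TensorAssociator.faceP₁,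
      TensorAssociator.faceP₂, TensorAssociator.faceP₄, TensorAssociator.faceQ₀,
      TensorAssociator.faceQ₁, TensorAssociator.faceQ₃, bicategoricalComp,
      TensorFunctor.IsBilinear.smul_left, TensorFunctor.IsBilinear.smul_right,
      LinearBicategory.whiskerLeft_smul, LinearBicategory.whiskerRight_smul,
      smul_add, smul_sub,
      -comp_whiskerRight, -whiskerRight_comp, -comp_whiskerLeft, -whisker_assoc,
      -whiskerLeft_comp]

variable (A) in
/-- The cochains of degree 2 of the pentagonator-deformation complex, the modifications `a ⇛ a`. -/
def Mod₃ : Submodule K A.PseudoMod₃ where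
  carrier := {n | A.IsMod₃ n}
  add_mem' {n m} hn hm := fun f g h => by
    have h₁ := hn f g h
    have h₂ := hm f g h
    simp only [Pi.add_apply, LinearBicategory.whiskerLeft_add K,
      LinearBicategory.whiskerRight_add K, Preadditive.add_comp, Preadditive.comp_add, h₁, h₂]
  zero_mem' := fun f g h => by
    have h₁ := LinearBicategory.whiskerLeft_smul (K := K) (T.tHom f (T.tHom g h)) 0
      (0 : A.a _ _ _ ⟶ A.a _ _ _)
    have h₂ := LinearBicategory.whiskerRight_smul (K := K) 0
      (0 : A.a _ _ _ ⟶ A.a _ _ _) (T.tHom (T.tHom f g) h)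
    simp only [zero_smul] at h₁ h₂
    simp only [Pi.zero_apply, h₁, h₂, Limits.zero_comp, Limits.comp_zero]
  smul_mem' k n hn := fun f g h => by
    have h₁ := hn f g h
    simp only [Pi.smul_apply, LinearBicategory.whiskerLeft_smul,
      LinearBicategory.whiskerRight_smul, Linear.smul_comp, Linear.comp_smul, h₁]

variable (A) in
/-- The cochains of degree 3, the modifications `a^(4) ⇛ ^(4)a`. -/
def Mod₄ : Submodule K A.PseudoMod₄ where
  carrier := {n | A.IsMod₄ n}
  add_mem' {n m} hn hm := fun f g h k => by
    have h₁ := hn f g h k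
    have h₂ := hm f g h k
    simp only [Pi.add_apply, LinearBicategory.whiskerLeft_add K,
      LinearBicategory.whiskerRight_add K, Preadditive.add_comp, Preadditive.comp_add, h₁, h₂]
  zero_mem' := fun f g h k => by
    have h₁ := LinearBicategory.whiskerLeft_smul (K := K) (T.tHom f (T.tHom g (T.tHom h k))) 0
      (0 : A.a₄ _ _ _ _ ⟶ A.b₄ _ _ _ _)
    have h₂ := LinearBicategory.whiskerRight_smul (K := K) 0
      (0 : A.a₄ _ _ _ _ ⟶ A.b₄ _ _ _ _) (T.tHom (T.tHom (T.tHom f g) h) k)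
    simp only [zero_smul] at h₁ h₂
    simp only [Pi.zero_apply, h₁, h₂, Limits.zero_comp, Limits.comp_zero]
  smul_mem' r n hn := fun f g h k => by
    have h₁ := hn f g h k
    simp only [Pi.smul_apply, LinearBicategory.whiskerLeft_smul,
      LinearBicategory.whiskerRight_smul, Linear.smul_comp, Linear.comp_smul, h₁]

/-- The 3-cocycles of the pentagonator-deformation complex. -/
def Z₃ : Submodule K A.PseudoMod₄ := Mod₄ A K ⊓ LinearMap.ker (P.δ₃ K)

/-- The 3-coboundaries of the pentagonator-deformation complex. -/
def B₃ : Submodule K A.PseudoMod₄ := (Mod₃ A K).map (P.δ₂ K)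

/-- The third cohomology of the pentagonator-deformation complex, 3-cocycles modulo 3-coboundaries. -/
abbrev H₃ : Type _ := P.Z₃ K ⧸ (P.B₃ K).submoduleOf (P.Z₃ K)

end
end Pentagonator

/-- A semigroupal structure `(ψ, ω)` on the identity 2-functor from `(C, ⊗, a, π)` to
`(C, ⊗', a', π')` with given 1-morphisms `ψ_{X,Y} : X ⊗' Y ⟶ X ⊗ Y`: these are 1-isomorphisms and the
components of a pseudonatural isomorphism, with 2-isomorphisms `hat`, and `ω` is an invertible
modification, such that the coherence relation with the pentagonators holds. -/
structure IdSemigroupal {C : Type u} [Bicategory.{w, v} C] {T T' : TensorFunctor C}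
    {A : TensorAssociator T} {A' : TensorAssociator T'} (P : Pentagonator A) (P' : Pentagonator A')
    (ψ : ∀ X Y : C, T'.tObj X Y ⟶ T.tObj X Y) where
  ψ_isOneIso (X Y : C) : IsOneIso (ψ X Y)
  hat {X X' Y Y' : C} (f : X ⟶ X') (g : Y ⟶ Y') :
    ψ X Y ≫ T.tHom f g ≅ T'.tHom f g ≫ ψ X' Y'
  hat_natural {X X' Y Y' : C} {f₁ f₂ : X ⟶ X'} {g₁ g₂ : Y ⟶ Y'} (τ : f₁ ⟶ f₂) (σ : g₁ ⟶ g₂) :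
    (hat f₁ g₁).hom ≫ T'.tHom₂ τ σ ▷ ψ X' Y' = ψ X Y ◁ T.tHom₂ τ σ ≫ (hat f₂ g₂).hom
  hat_comp {X X' X'' Y Y' Y'' : C} (f : X ⟶ X') (f' : X' ⟶ X'') (g : Y ⟶ Y') (g' : Y' ⟶ Y'') :
    ψ X Y ◁ (T.tComp f f' g g').inv ≫ (hat (f ≫ f') (g ≫ g')).hom =
      𝟙 _ ⊗≫ (hat f g).hom ▷ T.tHom f' g' ⊗≫ T'.tHom f g ◁ (hat f' g').hom ⊗≫
        (T'.tComp f f' g g').inv ▷ ψ X'' Y''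
  hat_id (X Y : C) :
    (hat (𝟙 X) (𝟙 Y)).hom = ψ X Y ◁ (T.tId X Y).hom ⊗≫ (T'.tId X Y).inv ▷ ψ X Y
  ω (X Y Z : C) :
    T'.idL X (ψ Y Z) ≫ ψ X (T.tObj Y Z) ≫ A.a X Y Z ≅
      A'.a X Y Z ≫ T'.idR (ψ X Y) Z ≫ ψ (T.tObj X Y) Z
  ω_natural {X X' Y Y' Z Z' : C} (f : X ⟶ X') (g : Y ⟶ Y') (h : Z ⟶ Z') :
    𝟙 _ ⊗≫ (T'.idL X (ψ Y Z) ≫ ψ X (T.tObj Y Z)) ◁ (A.hat f g h).hom ⊗≫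
        T'.idL X (ψ Y Z) ◁ (hat f (T.tHom g h)).hom ▷ A.a X' Y' Z' ⊗≫
        T'.sqL f (hat g h).hom ▷ (ψ X' (T.tObj Y' Z') ≫ A.a X' Y' Z') ⊗≫
        T'.tHom f (T'.tHom g h) ◁ (ω X' Y' Z').hom =
      (ω X Y Z).hom ▷ T.tHom (T.tHom f g) h ⊗≫
        (A'.a X Y Z ≫ T'.idR (ψ X Y) Z) ◁ (hat (T.tHom f g) h).hom ⊗≫
        A'.a X Y Z ◁ T'.sqR (hat f g).hom h ▷ ψ (T.tObj X' Y') Z' ⊗≫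
        (A'.hat f g h).hom ▷ (T'.idR (ψ X' Y') Z' ≫ ψ (T.tObj X' Y') Z') ⊗≫ 𝟙 _
  ω_coherence (X Y Z W : C) :
    𝟙 (T'.idL X (T'.idL Y (ψ Z W)) ≫ T'.idL X (ψ Y (T.tObj Z W)) ≫
          ψ X (T.tObj Y (T.tObj Z W)) ≫ A.a₄ X Y Z W) ⊗≫
        (T'.idL X (T'.idL Y (ψ Z W)) ≫ T'.idL X (ψ Y (T.tObj Z W)) ≫
          ψ X (T.tObj Y (T.tObj Z W))) ◁ (P.π X Y Z W).hom ⊗≫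
        T'.idL X (T'.idL Y (ψ Z W)) ◁ (ω X Y (T.tObj Z W)).hom ▷ A.a (T.tObj X Y) Z W ⊗≫
        (A'.hat (𝟙 X) (𝟙 Y) (ψ Z W)).inv ▷ (T'.idR (ψ X Y) (T.tObj Z W) ≫
          ψ (T.tObj X Y) (T.tObj Z W) ≫ A.a (T.tObj X Y) Z W) ⊗≫
        A'.a X Y (T'.tObj Z W) ◁
          ((T'.tComp (T'.tHom (𝟙 X) (𝟙 Y)) (ψ X Y) (ψ Z W) (𝟙 (T.tObj Z W))).inv ≫
            T'.tHom₂ ((hat (𝟙 X) (𝟙 Y)).inv ≫ ψ X Y ◁ (T.tId X Y).hom)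
              (ψ Z W ◁ (T.tId Z W).inv ≫ (hat (𝟙 Z) (𝟙 W)).hom) ≫
            (T'.tComp (ψ X Y) (𝟙 (T.tObj X Y)) (T'.tHom (𝟙 Z) (𝟙 W)) (ψ Z W)).hom) ▷
          (ψ (T.tObj X Y) (T.tObj Z W) ≫ A.a (T.tObj X Y) Z W) ⊗≫
        (A'.a X Y (T'.tObj Z W) ≫ T'.tHom (ψ X Y) (T'.tHom (𝟙 Z) (𝟙 W))) ◁
          (ω (T.tObj X Y) Z W).hom ⊗≫
        A'.a X Y (T'.tObj Z W) ◁ (A'.hat (ψ X Y) (𝟙 Z) (𝟙 W)).inv ▷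
          (T'.idR (ψ (T.tObj X Y) Z) W ≫ ψ (T.tObj (T.tObj X Y) Z) W) ⊗≫
        𝟙 (A'.a X Y (T'.tObj Z W) ≫ A'.a (T'.tObj X Y) Z W ≫ T'.idR (T'.idR (ψ X Y) Z) W ≫
          T'.idR (ψ (T.tObj X Y) Z) W ≫ ψ (T.tObj (T.tObj X Y) Z) W) =
      𝟙 _ ⊗≫ (T'.idL X (T'.idL Y (ψ Z W)) ≫ T'.idL X (ψ Y (T.tObj Z W))) ◁
          (hat (𝟙 X) (A.a Y Z W)).hom ▷ (A.a X (T.tObj Y Z) W ≫ T.idR (A.a X Y Z) W) ⊗≫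
        ((T'.idLComp₃ X (T'.idL Y (ψ Z W)) (ψ Y (T.tObj Z W)) (A.a Y Z W)).inv ≫
            T'.tHom₂ (𝟙 (𝟙 X)) (ω Y Z W).hom ≫
            (T'.idLComp₃ X (A'.a Y Z W) (T'.idR (ψ Y Z) W) (ψ (T.tObj Y Z) W)).hom) ▷
          (ψ X (T.tObj (T.tObj Y Z) W) ≫ A.a X (T.tObj Y Z) W ≫ T.idR (A.a X Y Z) W) ⊗≫
        (T'.idL X (A'.a Y Z W) ≫ T'.idL X (T'.idR (ψ Y Z) W)) ◁ (ω X (T.tObj Y Z) W).hom ▷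
          T.idR (A.a X Y Z) W ⊗≫
        T'.idL X (A'.a Y Z W) ◁ (A'.hat (𝟙 X) (ψ Y Z) (𝟙 W)).inv ▷
          (T'.idR (ψ X (T.tObj Y Z)) W ≫ ψ (T.tObj X (T.tObj Y Z)) W ≫
            T.idR (A.a X Y Z) W) ⊗≫
        (T'.idL X (A'.a Y Z W) ≫ A'.a X (T'.tObj Y Z) W ≫ T'.idR (T'.idL X (ψ Y Z)) W ≫
          T'.idR (ψ X (T.tObj Y Z)) W) ◁ (hat (A.a X Y Z) (𝟙 W)).hom ⊗≫
        (T'.idL X (A'.a Y Z W) ≫ A'.a X (T'.tObj Y Z) W) ◁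
          ((T'.idRComp₃ (T'.idL X (ψ Y Z)) (ψ X (T.tObj Y Z)) (A.a X Y Z) W).inv ≫
            T'.tHom₂ (ω X Y Z).hom (𝟙 (𝟙 W)) ≫
            (T'.idRComp₃ (A'.a X Y Z) (T'.idR (ψ X Y) Z) (ψ (T.tObj X Y) Z) W).hom) ▷
          ψ (T.tObj (T.tObj X Y) Z) W ⊗≫
        (P'.π X Y Z W).hom ▷ (T'.idR (T'.idR (ψ X Y) Z) W ≫
          T'.idR (ψ (T.tObj X Y) Z) W ≫ ψ (T.tObj (T.tObj X Y) Z) W) ⊗≫ 𝟙 _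

namespace ScalarExt
section
variable {K : Type*} [CommRing K] {C : Type u} [Bicategory.{w, v} C]
  [∀ X Y : C, Preadditive (X ⟶ Y)] [∀ X Y : C, Linear K (X ⟶ Y)]

/-- Reduction of 2-morphisms modulo `ε`, `τ ⊗ (r + s ε) ↦ r • τ`. -/
def red {X Y : ScalarExt K (DualNumber K) C} {f g : X ⟶ Y} (η : f ⟶ g) : f.as ⟶ g.as :=
  TensorProduct.rid K (f.as ⟶ g.as)
    (LinearMap.lTensor (f.as ⟶ g.as) (TrivSqZeroExt.fstHom K K K).toLinearMap η)

end
end ScalarExt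

section Deformations
variable {K : Type*} [CommRing K] {C : Type u} [Bicategory.{w, v} C]
  [∀ X Y : C, Preadditive (X ⟶ Y)] [∀ X Y : C, Linear K (X ⟶ Y)] [LinearBicategory K C]
  {T : TensorFunctor C} [T.IsBilinear K] {A : TensorAssociator T}

variable (K) in
/-- A first order pentagonator-deformation of `(C, ⊗, a, π)`: a semigroupal structure on the
extension of `C` to `K[ε]/(ε²)` in which `⊗` and `a`, with all their structural 2-isomorphisms, are
the undeformed ones and the pentagonator reduces modulo `ε` to `π`. -/
structure PentagonatorDeformation (P : Pentagonator A) where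
  toPentagonator : Pentagonator (ScalarExt.associatorExt (K := K) (R := DualNumber K) A)
  red_π (X Y Z W : ScalarExt K (DualNumber K) C) :
    ScalarExt.red (toPentagonator.π X Y Z W).hom = (P.π X.as Y.as Z.as W.as).hom

/-- The 2-morphism `(id_X ⊗ id_{Y⊗Z}) ≫ a_{X,Y,Z} ⟶ a_{X,Y,Z} ≫ (id_{X⊗Y} ⊗ id_Z)` given by the
unit constraints of `⊗`. -/
def TensorAssociator.ω₀ {C : Type u} [Bicategory.{w, v} C] {T : TensorFunctor C}
    (A : TensorAssociator T) (X Y Z : C) :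
    T.idL X (𝟙 (T.tObj Y Z)) ≫ 𝟙 (T.tObj X (T.tObj Y Z)) ≫ A.a X Y Z ⟶
      A.a X Y Z ≫ T.idR (𝟙 (T.tObj X Y)) Z ≫ 𝟙 (T.tObj (T.tObj X Y) Z) :=
  (T.tId X (T.tObj Y Z)).hom ▷ (𝟙 _ ≫ A.a X Y Z) ⊗≫
    A.a X Y Z ◁ (T.tId (T.tObj X Y) Z).inv ⊗≫ 𝟙 _

/-- `ω`-equivalence of deformations: the identity 2-functor has a semigroupal structure `(ψ, ω)` with
`ψ_{X,Y} = id_{X⊗Y}`, with all `ψ̂(f, g)` identities (up to the unitors, which are identities in a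
2-category), and with `ω` reducing modulo `ε` to the 2-morphism given by the unit constraints. -/
def OmegaEquivalent {P : Pentagonator A} (D D' : PentagonatorDeformation K P) : Prop :=
  ∃ M : IdSemigroupal D.toPentagonator D'.toPentagonator (fun X Y => 𝟙 ((ScalarExt.tensorExt T).tObj X Y)),
    (∀ {X X' Y Y' : ScalarExt K (DualNumber K) C} (f : X ⟶ X') (g : Y ⟶ Y'),
      (M.hat f g).hom = (λ_ _).hom ≫ (ρ_ _).inv) ∧
    ∀ X Y Z : ScalarExt K (DualNumber K) C,
      ScalarExt.red (M.ω X Y Z).hom = A.ω₀ X.as Y.as Z.as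

end Deformations

/-! ### Functoriality and unit constraints of the tensor product. -/

namespace TensorFunctor
section
variable {C : Type u} [Bicategory.{w, v} C] (T : TensorFunctor C)
variable {X X' X'' Y Y' Y'' : C}

/-! A 2-morphism over `K[ε]/(ε²)` is uniquely `τ + σ ε` (`dual_red_coef`, `dual_inj`), and
composition obeys the Leibniz rule (`dual_comp`). An equation over the dual numbers is therefore a
pair of equations in `C`, one for each power of `ε`, and the theorem amounts to reading off the
coefficients of `ε`.

For the family `π + n ε`, naturality says that `π` and `n` are both natural (`isMod₄_dual₄`). In the
`K₅` relation each instance of `π` is one factor of a pasting, so the Leibniz rule replaces one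
pentagon at a time by `n`. The six resulting terms are the six paddings: the three on one half of
the associahedron carry the sign `+` in `δ₃`, the three on the other half the sign `-`. Hence `K₅`
for `π + n ε` is `δ₃ n = 0` (`k₅_dual₄`). Since `π + n ε` is always invertible, deformations
correspond to 3-cocycles.

For `ω`-equivalence the 1-morphisms `ψ` are identities, but the tensor products `id ⊗ id` occurring
in `ω` are identities only up to the constraints of `⊗`. Most of the work is the removal of these
loops. Each loop has a contraction to an identity, and every structural 2-morphism that moves a loop
across a path is compatible with the contractions. Pushing the contractions through a whole pasting
leaves only `π`, `π'` and the 2-morphisms `n : a ⟶ a` obtained from `ω` (`contract_pentagon_left`,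
`contract_pentagon_right` and their analogues for naturality). So `(id, ω)` is the same thing as an
invertible modification `n` satisfying the short relation `Intertwines` (`IdSemigroupal.ofMod`,
`IdSemigroupal.exists_mod`).

The condition on `ω` modulo `ε` says `n = 1 + m ε`. The coefficient of `ε` in `Intertwines` is then
the statement that the two first order terms differ by `δ₂ m` (`intertwines_dual₃`), whence
`omegaEquivalent_iff`, from which the theorem is formal. -/

lemma tHom₂_comp {f f' f'' : X ⟶ X'} {g g' g'' : Y ⟶ Y'} (τ : f ⟶ f') (τ' : f' ⟶ f'')
    (σ : g ⟶ g') (σ' : g' ⟶ g'') :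
    T.tHom₂ τ σ ≫ T.tHom₂ τ' σ' = T.tHom₂ (τ ≫ τ') (σ ≫ σ') :=
  (T.map₂_comp (a := (X, Y)) (b := (X', Y')) (f := f ×ₘ g) (g := f' ×ₘ g') (h := f'' ×ₘ g'')
    (τ ×ₘ σ) (τ' ×ₘ σ')).symm

lemma tHom₂_comp_assoc {f f' f'' : X ⟶ X'} {g g' g'' : Y ⟶ Y'} (τ : f ⟶ f') (τ' : f' ⟶ f'')
    (σ : g ⟶ g') (σ' : g' ⟶ g'') {k : T.tObj X Y ⟶ T.tObj X' Y'} (η : T.tHom f'' g'' ⟶ k) :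
    T.tHom₂ τ σ ≫ T.tHom₂ τ' σ' ≫ η = T.tHom₂ (τ ≫ τ') (σ ≫ σ') ≫ η := by
  rw [← Category.assoc, tHom₂_comp]

@[simp]
lemma tHom₂_id (f : X ⟶ X') (g : Y ⟶ Y') : T.tHom₂ (𝟙 f) (𝟙 g) = 𝟙 (T.tHom f g) :=
  T.map₂_id (a := (X, Y)) (b := (X', Y')) (f ×ₘ g)

instance isIso_tHom₂ {f f' : X ⟶ X'} {g g' : Y ⟶ Y'} (τ : f ⟶ f') (σ : g ⟶ g') [IsIso τ] [IsIso σ] :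
    IsIso (T.tHom₂ τ σ) :=
  ⟨T.tHom₂ (inv τ) (inv σ), by simp [tHom₂_comp], by simp [tHom₂_comp]⟩

lemma tHom₂_whiskerLeft (f : X ⟶ X') (g : Y ⟶ Y') {h h' : X' ⟶ X''} {k k' : Y' ⟶ Y''}
    (τ : h ⟶ h') (σ : k ⟶ k') :
    T.tHom₂ (f ◁ τ) (g ◁ σ) =
      (T.tComp f h g k).hom ≫ T.tHom f g ◁ T.tHom₂ τ σ ≫ (T.tComp f h' g k').inv :=
  T.map₂_whisker_left (a := (X, Y)) (b := (X', Y')) (c := (X'', Y'')) (f ×ₘ g)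
    (g := h ×ₘ k) (h := h' ×ₘ k') (τ ×ₘ σ)

lemma tHom₂_whiskerRight {f f' : X ⟶ X'} {g g' : Y ⟶ Y'} (τ : f ⟶ f') (σ : g ⟶ g')
    (h : X' ⟶ X'') (k : Y' ⟶ Y'') :
    T.tHom₂ (τ ▷ h) (σ ▷ k) =
      (T.tComp f h g k).hom ≫ T.tHom₂ τ σ ▷ T.tHom h k ≫ (T.tComp f' h g' k).inv :=
  T.map₂_whisker_right (a := (X, Y)) (b := (X', Y')) (c := (X'', Y'')) (f := f ×ₘ g)
    (g := f' ×ₘ g') (τ ×ₘ σ) (h ×ₘ k)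

lemma tHom₂_leftUnitor (f : X ⟶ X') (g : Y ⟶ Y') :
    T.tHom₂ (λ_ f).hom (λ_ g).hom =
      (T.tComp (𝟙 X) f (𝟙 Y) g).hom ≫ (T.tId X Y).hom ▷ T.tHom f g ≫ (λ_ (T.tHom f g)).hom :=
  T.map₂_left_unitor (a := (X, Y)) (b := (X', Y')) (f ×ₘ g)

lemma tHom₂_rightUnitor (f : X ⟶ X') (g : Y ⟶ Y') :
    T.tHom₂ (ρ_ f).hom (ρ_ g).hom =
      (T.tComp f (𝟙 X') g (𝟙 Y')).hom ≫ T.tHom f g ◁ (T.tId X' Y').hom ≫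
        (ρ_ (T.tHom f g)).hom :=
  T.map₂_right_unitor (a := (X, Y)) (b := (X', Y')) (f ×ₘ g)

lemma tHom₂_rightUnitor_inv (f : X ⟶ X') (g : Y ⟶ Y') :
    T.tHom₂ (ρ_ f).inv (ρ_ g).inv =
      (ρ_ (T.tHom f g)).inv ≫ T.tHom f g ◁ (T.tId X' Y').inv ≫
        (T.tComp f (𝟙 X') g (𝟙 Y')).inv := by
  rw [← cancel_epi (T.tHom₂ (ρ_ f).hom (ρ_ g).hom), tHom₂_comp, Iso.hom_inv_id, Iso.hom_inv_id,
    tHom₂_id, tHom₂_rightUnitor]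
  simp

/-- Tensoring `1_f` with a square of unitors. -/
lemma sqL_unitors (f : X ⟶ X') (g : Y ⟶ Y') :
    T.sqL f ((λ_ g).hom ≫ (ρ_ g).inv) =
      (T.tId X Y).hom ▷ T.tHom f g ≫ (λ_ _).hom ≫ (ρ_ _).inv ≫ T.tHom f g ◁ (T.tId X' Y').inv := by
  simp only [sqL]
  rw [← tHom₂_comp, tHom₂_leftUnitor, tHom₂_rightUnitor_inv]
  simp

lemma sqR_unitors (f : X ⟶ X') (g : Y ⟶ Y') :
    T.sqR ((λ_ g).hom ≫ (ρ_ g).inv) f =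
      (T.tId Y X).hom ▷ T.tHom g f ≫ (λ_ _).hom ≫ (ρ_ _).inv ≫ T.tHom g f ◁ (T.tId Y' X').inv := by
  simp only [sqR]
  rw [← tHom₂_comp, tHom₂_leftUnitor, tHom₂_rightUnitor_inv]
  simp

end
end TensorFunctor

/-! ### Contraction of loops in pasting diagrams of an arbitrary bicategory. -/

namespace CategoryTheory.Bicategory
variable {B : Type u} [Bicategory.{w, v} B]

/-- Contraction of a unit at the left end of a word. -/
def cL {X Y : B} {P : X ⟶ X} (p : P ⟶ 𝟙 X) (f : X ⟶ Y) : P ≫ f ⟶ f := p ▷ f ≫ (λ_ f).hom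

/-- Contraction of a unit at the right end of a word. -/
def cR {X Y : B} {P : Y ⟶ Y} (f : X ⟶ Y) (p : P ⟶ 𝟙 Y) : f ≫ P ⟶ f := f ◁ p ≫ (ρ_ f).hom

/-- By interchange and naturality of the unitor. This sliding rule and `cR_natural` are what moves
contractions through a pasting. -/
lemma cL_natural {X Y : B} {P : X ⟶ X} (p : P ⟶ 𝟙 X) {f g : X ⟶ Y} (η : f ⟶ g) :
    P ◁ η ≫ cL p g = cL p f ≫ η := by
  simp [cL, whisker_exchange_assoc]

lemma cL_natural_assoc {X Y : B} {P : X ⟶ X} (p : P ⟶ 𝟙 X) {f g : X ⟶ Y} (η : f ⟶ g)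
    {h : X ⟶ Y} (θ : g ⟶ h) : P ◁ η ≫ cL p g ≫ θ = cL p f ≫ η ≫ θ := by
  rw [← Category.assoc, cL_natural, Category.assoc]

lemma cR_natural {X Y : B} {P : Y ⟶ Y} (p : P ⟶ 𝟙 Y) {f g : X ⟶ Y} (η : f ⟶ g) :
    η ▷ P ≫ cR g p = cR f p ≫ η := by
  simp [cR, ← whisker_exchange_assoc]

/-- The side of the coherence relation containing `P.π`, with all loops abstract. Each cell comes
with the rule for exchanging the contraction of its target loops against that of its source loops,
at the cost of `m₁` or `m₂` for the two instances of `ω` and of nothing for the others. Starting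
from the contraction of the final loops, one works backwards through the cells and slides the
contraction past whatever lies beside it. -/
theorem contract_pentagon_left {X X' X'' Y Z : B}
    {P₁ P₂ W₀ : X ⟶ X} {Q R R' S W₁ : Y ⟶ Y} {Q' V W₂ : Z ⟶ Z}
    {l₁ : X ⟶ X'} {l₂ : X' ⟶ X''} {l₃ : X'' ⟶ Z} {b₁ : X ⟶ Y} {b₂ : Y ⟶ Z}
    {p₁ : P₁ ⟶ 𝟙 X} {p₂ : P₂ ⟶ 𝟙 X} {w₀ : W₀ ⟶ 𝟙 X} {q : Q ⟶ 𝟙 Y} {r : R ⟶ 𝟙 Y} {r' : R' ⟶ 𝟙 Y}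
    {s : S ⟶ 𝟙 Y} {w₁ : W₁ ⟶ 𝟙 Y} {w₂ : W₂ ⟶ 𝟙 Z} {q' : Q' ⟶ 𝟙 Z} {v : V ⟶ 𝟙 Z}
    (π : l₁ ≫ l₂ ≫ l₃ ⟶ b₁ ≫ b₂) {ω₁ : P₂ ≫ W₀ ≫ b₁ ⟶ b₁ ≫ R ≫ W₁}
    {ω₂ : S ≫ W₁ ≫ b₂ ⟶ b₂ ≫ V ≫ W₂} {h₁ : P₁ ≫ b₁ ⟶ b₁ ≫ Q} {h₂ : R' ≫ b₂ ⟶ b₂ ≫ Q'}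
    {mid : Q ≫ R ⟶ R' ≫ S} {m₁ : b₁ ⟶ b₁} {m₂ : b₂ ⟶ b₂}
    (hω₁ : ω₁ ≫ cR b₁ (cL r W₁ ≫ w₁) = cL p₂ (W₀ ≫ b₁) ≫ cL w₀ b₁ ≫ m₁)
    (hω₂ : ω₂ ≫ cR b₂ (cL v W₂ ≫ w₂) = cL s (W₁ ≫ b₂) ≫ cL w₁ b₂ ≫ m₂)
    (hh₁ : h₁ ≫ cR b₁ q = cL p₁ b₁) (hh₂ : h₂ ≫ cR b₂ q' = cL r' b₂)
    (hmid : mid ≫ cL r' S ≫ s = cL q R ≫ r) :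
    (𝟙 (P₁ ≫ P₂ ≫ W₀ ≫ l₁ ≫ l₂ ≫ l₃) ⊗≫ (P₁ ≫ P₂ ≫ W₀) ◁ π ⊗≫ P₁ ◁ ω₁ ▷ b₂ ⊗≫
      h₁ ▷ (R ≫ W₁ ≫ b₂) ⊗≫ b₁ ◁ mid ▷ (W₁ ≫ b₂) ⊗≫ (b₁ ≫ R') ◁ ω₂ ⊗≫ b₁ ◁ h₂ ▷ (V ≫ W₂) ⊗≫
      𝟙 (b₁ ≫ b₂ ≫ Q' ≫ V ≫ W₂)) ≫ b₁ ◁ cR b₂ (cR Q' (cL v W₂ ≫ w₂) ≫ q') =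
    (cL p₁ _ ≫ cL p₂ _ ≫ cL w₀ _) ≫ π ≫ m₁ ▷ b₂ ≫ b₁ ◁ m₂ := by
  calc _ = 𝟙 _ ⊗≫ (P₁ ≫ P₂ ≫ W₀) ◁ π ⊗≫ P₁ ◁ ω₁ ▷ b₂ ⊗≫
      h₁ ▷ (R ≫ W₁ ≫ b₂) ⊗≫ b₁ ◁ mid ▷ (W₁ ≫ b₂) ⊗≫ (b₁ ≫ R') ◁ ω₂ ⊗≫
      b₁ ◁ (h₂ ▷ (V ≫ W₂) ≫ (b₂ ≫ Q') ◁ (cL v W₂ ≫ w₂)) ⊗≫ b₁ ◁ cR b₂ q' := by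
        simp only [cR, cL]; bicategory
    _ = 𝟙 _ ⊗≫ (P₁ ≫ P₂ ≫ W₀) ◁ π ⊗≫ P₁ ◁ ω₁ ▷ b₂ ⊗≫
      h₁ ▷ (R ≫ W₁ ≫ b₂) ⊗≫ b₁ ◁ mid ▷ (W₁ ≫ b₂) ⊗≫ (b₁ ≫ R') ◁ (ω₂ ≫ cR b₂ (cL v W₂ ≫ w₂)) ⊗≫
      b₁ ◁ (h₂ ≫ cR b₂ q') := by
        -- Interchange moves the contraction of `V` and `W₂` ahead of `h₂`, so that it meets `ω₂`.
        rw [← whisker_exchange]; simp only [cR]; bicategory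
    _ = 𝟙 _ ⊗≫ (P₁ ≫ P₂ ≫ W₀) ◁ π ⊗≫ P₁ ◁ ω₁ ▷ b₂ ⊗≫
      h₁ ▷ (R ≫ W₁ ≫ b₂) ⊗≫ b₁ ◁ mid ▷ (W₁ ≫ b₂) ⊗≫
      b₁ ◁ (R' ◁ (cL s (W₁ ≫ b₂) ≫ cL w₁ b₂ ≫ m₂) ≫ cL r' b₂) := by
        rw [hω₂, hh₂]; bicategory
    _ = 𝟙 _ ⊗≫ (P₁ ≫ P₂ ≫ W₀) ◁ π ⊗≫ P₁ ◁ ω₁ ▷ b₂ ⊗≫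
      h₁ ▷ (R ≫ W₁ ≫ b₂) ⊗≫ b₁ ◁ (mid ≫ cL r' S ≫ s) ▷ (W₁ ≫ b₂) ⊗≫ b₁ ◁ (cL w₁ b₂ ≫ m₂) := by
        rw [cL_natural]; simp only [cL]; bicategory
    _ = 𝟙 _ ⊗≫ (P₁ ≫ P₂ ≫ W₀) ◁ π ⊗≫ P₁ ◁ ω₁ ▷ b₂ ⊗≫ h₁ ▷ (R ≫ W₁ ≫ b₂) ⊗≫
      b₁ ◁ (cL q (R ≫ W₁) ≫ cL r W₁ ≫ w₁) ▷ b₂ ⊗≫ b₁ ◁ m₂ := by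
        -- The middle cell trades the contraction of `R'` and `S` for that of `Q` and `R`, which
        -- `h₁` and `ω₁` can absorb.
        rw [hmid]; simp only [cL]; bicategory
    _ = 𝟙 _ ⊗≫ (P₁ ≫ P₂ ≫ W₀) ◁ π ⊗≫ P₁ ◁ ω₁ ▷ b₂ ⊗≫
      (h₁ ▷ (R ≫ W₁) ≫ (b₁ ≫ Q) ◁ (cL r W₁ ≫ w₁)) ▷ b₂ ⊗≫ cR b₁ q ▷ b₂ ⊗≫ b₁ ◁ m₂ := by
        rw [← cL_natural]; simp only [cL, cR]; bicategory
    _ = 𝟙 _ ⊗≫ (P₁ ≫ P₂ ≫ W₀) ◁ π ⊗≫ P₁ ◁ (ω₁ ≫ cR b₁ (cL r W₁ ≫ w₁)) ▷ b₂ ⊗≫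
      (h₁ ≫ cR b₁ q) ▷ b₂ ⊗≫ b₁ ◁ m₂ := by
        rw [← whisker_exchange]; simp only [cR]; bicategory
    _ = 𝟙 _ ⊗≫ (P₁ ◁ (P₂ ≫ W₀) ◁ π ≫ cL p₁ ((P₂ ≫ W₀) ≫ b₁ ≫ b₂)) ⊗≫ cL p₂ (W₀ ≫ b₁ ≫ b₂) ⊗≫ cL w₀ (b₁ ≫ b₂) ⊗≫
      m₁ ▷ b₂ ⊗≫ b₁ ◁ m₂ := by
        have : P₁ ◁ (cL p₂ (W₀ ≫ b₁) ≫ cL w₀ b₁ ≫ m₁) ≫ cL p₁ b₁ =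
          cL p₁ (P₂ ≫ W₀ ≫ b₁) ≫ cL p₂ (W₀ ≫ b₁) ≫ cL w₀ b₁ ≫ m₁ := cL_natural _ _
        calc _ = 𝟙 _ ⊗≫ (P₁ ≫ P₂ ≫ W₀) ◁ π ⊗≫
              (P₁ ◁ (cL p₂ (W₀ ≫ b₁) ≫ cL w₀ b₁ ≫ m₁) ≫ cL p₁ b₁) ▷ b₂ ⊗≫ b₁ ◁ m₂ := by
                rw [hω₁, hh₁]; bicategory
          _ = _ := by rw [this]; simp only [cL]; bicategory
    _ = cL p₁ (P₂ ≫ W₀ ≫ l₁ ≫ l₂ ≫ l₃) ⊗≫ (P₂ ◁ W₀ ◁ π ≫ cL p₂ (W₀ ≫ b₁ ≫ b₂)) ⊗≫ cL w₀ (b₁ ≫ b₂) ⊗≫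
      m₁ ▷ b₂ ⊗≫ b₁ ◁ m₂ := by
        rw [cL_natural p₁]; simp only [cL]; bicategory
    _ = cL p₁ (P₂ ≫ W₀ ≫ l₁ ≫ l₂ ≫ l₃) ⊗≫ cL p₂ (W₀ ≫ l₁ ≫ l₂ ≫ l₃) ⊗≫ (W₀ ◁ π ≫ cL w₀ (b₁ ≫ b₂)) ⊗≫ m₁ ▷ b₂ ⊗≫ b₁ ◁ m₂ := by
        rw [cL_natural]; bicategory
    _ = _ := by
        rw [cL_natural]; bicategory

/-- The side of the coherence relation containing `P'.π`, treated in the same way. Here `Ω₁`, `ω`,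
`Ω₂` stand for `1 ⊗ ω`, `ω`, `ω ⊗ 1` and leave `n₁`, `n₂`, `n₃` behind. The contractions of source
and target loops are those of `contract_pentagon_left`, so the two results can be compared. -/
theorem contract_pentagon_right {X Y Z X' : B}
    {P₁ P₂ W₀ : X ⟶ X} {G₁ G₂ W₁ : Y ⟶ Y} {J H W₂ : Z ⟶ Z} {Q V W₃ : X' ⟶ X'}
    {l₁ : X ⟶ Y} {l₂ : Y ⟶ Z} {l₃ : Z ⟶ X'} {Y' : B} {b₁ : X ⟶ Y'} {b₂ : Y' ⟶ X'}
    {p₁ : P₁ ⟶ 𝟙 X} {p₂ : P₂ ⟶ 𝟙 X} {w₀ : W₀ ⟶ 𝟙 X} {g₁ : G₁ ⟶ 𝟙 Y} {g₂ : G₂ ⟶ 𝟙 Y}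
    {w₁ : W₁ ⟶ 𝟙 Y} {j : J ⟶ 𝟙 Z} {h : H ⟶ 𝟙 Z} {w₂ : W₂ ⟶ 𝟙 Z} {q : Q ⟶ 𝟙 X'} {v : V ⟶ 𝟙 X'}
    {w₃ : W₃ ⟶ 𝟙 X'}
    {k₁ : W₀ ≫ l₁ ⟶ l₁ ≫ W₁} {Ω₁ : P₁ ≫ P₂ ≫ l₁ ⟶ l₁ ≫ G₁ ≫ G₂}
    {ω : G₂ ≫ W₁ ≫ l₂ ⟶ l₂ ≫ H ≫ W₂} {η : G₁ ≫ l₂ ⟶ l₂ ≫ J} {k₂ : W₂ ≫ l₃ ⟶ l₃ ≫ W₃}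
    {Ω₂ : J ≫ H ≫ l₃ ⟶ l₃ ≫ Q ≫ V} (π : l₁ ≫ l₂ ≫ l₃ ⟶ b₁ ≫ b₂)
    {n₁ : l₁ ⟶ l₁} {n₂ : l₂ ⟶ l₂} {n₃ : l₃ ⟶ l₃}
    (hk₁ : k₁ ≫ cR l₁ w₁ = cL w₀ l₁)
    (hΩ₁ : Ω₁ ≫ cR l₁ (cL g₁ G₂ ≫ g₂) = cL p₁ (P₂ ≫ l₁) ≫ cL p₂ l₁ ≫ n₁)
    (hω : ω ≫ cR l₂ (cL h W₂ ≫ w₂) = cL g₂ (W₁ ≫ l₂) ≫ cL w₁ l₂ ≫ n₂)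
    (hη : η ≫ cR l₂ j = cL g₁ l₂)
    (hk₂ : k₂ ≫ cR l₃ w₃ = cL w₂ l₃)
    (hΩ₂ : Ω₂ ≫ cR l₃ (cL q V ≫ v) = cL j (H ≫ l₃) ≫ cL h l₃ ≫ n₃) :
    (𝟙 (P₁ ≫ P₂ ≫ W₀ ≫ l₁ ≫ l₂ ≫ l₃) ⊗≫ (P₁ ≫ P₂) ◁ k₁ ▷ (l₂ ≫ l₃) ⊗≫
      Ω₁ ▷ (W₁ ≫ l₂ ≫ l₃) ⊗≫ (l₁ ≫ G₁) ◁ ω ▷ l₃ ⊗≫ l₁ ◁ η ▷ (H ≫ W₂ ≫ l₃) ⊗≫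
      (l₁ ≫ l₂ ≫ J ≫ H) ◁ k₂ ⊗≫ (l₁ ≫ l₂) ◁ Ω₂ ▷ W₃ ⊗≫ π ▷ (Q ≫ V ≫ W₃) ⊗≫
      𝟙 (b₁ ≫ b₂ ≫ Q ≫ V ≫ W₃)) ≫ b₁ ◁ cR b₂ (cR Q (cL v W₃ ≫ w₃) ≫ q) =
    (cL p₁ _ ≫ cL p₂ _ ≫ cL w₀ _) ≫ n₁ ▷ (l₂ ≫ l₃) ≫ l₁ ◁ n₂ ▷ l₃ ≫ l₁ ◁ l₂ ◁ n₃ ≫ π := by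
  -- Loops at one object can be contracted in any order, by interchange. On this side `W₃` has to go
  -- first, because it is created by `k₂` and lies beside `Ω₂`.
  have e : (cR Q (cL v W₃ ≫ w₃) ≫ q) = (α_ Q V W₃).inv ≫ cR (Q ≫ V) w₃ ≫ cL q V ≫ v := by
    have h₁ : cL v W₃ ≫ w₃ = cR V w₃ ≫ v := by
      rw [← cL_natural, ← cR_natural]; simp only [cL, cR, whisker_exchange_assoc]; bicategory
    have h₂ : cL q V ≫ v = cR Q v ≫ q := by
      rw [← cL_natural, ← cR_natural]; simp only [cL, cR, whisker_exchange_assoc]; bicategory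
    rw [h₁, h₂]; simp only [cR]; bicategory
  rw [e]
  calc _ = 𝟙 _ ⊗≫ (P₁ ≫ P₂) ◁ k₁ ▷ (l₂ ≫ l₃) ⊗≫
      Ω₁ ▷ (W₁ ≫ l₂ ≫ l₃) ⊗≫ (l₁ ≫ G₁) ◁ ω ▷ l₃ ⊗≫ l₁ ◁ η ▷ (H ≫ W₂ ≫ l₃) ⊗≫
      (l₁ ≫ l₂ ≫ J ≫ H) ◁ k₂ ⊗≫ (l₁ ≫ l₂) ◁ Ω₂ ▷ W₃ ⊗≫
      (π ▷ (Q ≫ V ≫ W₃) ≫ cR (b₁ ≫ b₂) ((α_ Q V W₃).inv ≫ cR (Q ≫ V) w₃ ≫ cL q V ≫ v)) := by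
        simp only [cR]; bicategory
    _ = 𝟙 _ ⊗≫ (P₁ ≫ P₂) ◁ k₁ ▷ (l₂ ≫ l₃) ⊗≫
      Ω₁ ▷ (W₁ ≫ l₂ ≫ l₃) ⊗≫ (l₁ ≫ G₁) ◁ ω ▷ l₃ ⊗≫ l₁ ◁ η ▷ (H ≫ W₂ ≫ l₃) ⊗≫
      (l₁ ≫ l₂ ≫ J ≫ H) ◁ k₂ ⊗≫ (l₁ ≫ l₂) ◁ (Ω₂ ▷ W₃ ≫ cR _ w₃) ⊗≫
      (l₁ ≫ l₂) ◁ cR l₃ (cL q V ≫ v) ⊗≫ π := by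
        rw [cR_natural]; simp only [cR]; bicategory
    _ = 𝟙 _ ⊗≫ (P₁ ≫ P₂) ◁ k₁ ▷ (l₂ ≫ l₃) ⊗≫
      Ω₁ ▷ (W₁ ≫ l₂ ≫ l₃) ⊗≫ (l₁ ≫ G₁) ◁ ω ▷ l₃ ⊗≫ l₁ ◁ η ▷ (H ≫ W₂ ≫ l₃) ⊗≫
      (l₁ ≫ l₂ ≫ J ≫ H) ◁ (k₂ ≫ cR l₃ w₃) ⊗≫ (l₁ ≫ l₂) ◁ (Ω₂ ≫ cR l₃ (cL q V ≫ v)) ⊗≫ π := by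
        rw [cR_natural]; simp only [cR]; bicategory
    _ = 𝟙 _ ⊗≫ (P₁ ≫ P₂) ◁ k₁ ▷ (l₂ ≫ l₃) ⊗≫
      Ω₁ ▷ (W₁ ≫ l₂ ≫ l₃) ⊗≫ (l₁ ≫ G₁) ◁ ω ▷ l₃ ⊗≫ l₁ ◁ η ▷ (H ≫ W₂ ≫ l₃) ⊗≫
      (l₁ ≫ l₂) ◁ (J ◁ (H ◁ cL w₂ l₃ ≫ cL h l₃) ≫ cL j l₃) ⊗≫ l₁ ◁ l₂ ◁ n₃ ⊗≫ π := by
        rw [hk₂, hΩ₂, ← cL_natural_assoc j (cL h l₃)]; bicategory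
    _ = 𝟙 _ ⊗≫ (P₁ ≫ P₂) ◁ k₁ ▷ (l₂ ≫ l₃) ⊗≫
      Ω₁ ▷ (W₁ ≫ l₂ ≫ l₃) ⊗≫ (l₁ ≫ G₁) ◁ ω ▷ l₃ ⊗≫ l₁ ◁ (η ▷ (H ≫ W₂) ≫ (l₂ ≫ J) ◁ (cL h W₂ ≫ w₂)) ▷ l₃ ⊗≫
      l₁ ◁ cR l₂ j ▷ l₃ ⊗≫ l₁ ◁ l₂ ◁ n₃ ⊗≫ π := by
        rw [cL_natural h (cL w₂ l₃)]; simp only [cL, cR]; bicategory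
    _ = 𝟙 _ ⊗≫ (P₁ ≫ P₂) ◁ k₁ ▷ (l₂ ≫ l₃) ⊗≫
      Ω₁ ▷ (W₁ ≫ l₂ ≫ l₃) ⊗≫ (l₁ ≫ G₁) ◁ (ω ≫ cR l₂ (cL h W₂ ≫ w₂)) ▷ l₃ ⊗≫
      l₁ ◁ (η ≫ cR l₂ j) ▷ l₃ ⊗≫ l₁ ◁ l₂ ◁ n₃ ⊗≫ π := by
        rw [← whisker_exchange]; simp only [cR]; bicategory
    _ = 𝟙 _ ⊗≫ (P₁ ≫ P₂) ◁ k₁ ▷ (l₂ ≫ l₃) ⊗≫ Ω₁ ▷ (W₁ ≫ l₂ ≫ l₃) ⊗≫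
      l₁ ◁ (cL g₁ (G₂ ≫ W₁ ≫ l₂) ≫ cL g₂ _ ≫ cL w₁ l₂) ▷ l₃ ⊗≫ l₁ ◁ n₂ ▷ l₃ ⊗≫
      l₁ ◁ l₂ ◁ n₃ ⊗≫ π := by
        have : G₁ ◁ (cL g₂ (W₁ ≫ l₂) ≫ cL w₁ l₂ ≫ n₂) ≫ cL g₁ l₂ =
          cL g₁ (G₂ ≫ W₁ ≫ l₂) ≫ cL g₂ (W₁ ≫ l₂) ≫ cL w₁ l₂ ≫ n₂ := cL_natural _ _
        calc _ = 𝟙 _ ⊗≫ (P₁ ≫ P₂) ◁ k₁ ▷ (l₂ ≫ l₃) ⊗≫ Ω₁ ▷ (W₁ ≫ l₂ ≫ l₃) ⊗≫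
              l₁ ◁ (G₁ ◁ (cL g₂ (W₁ ≫ l₂) ≫ cL w₁ l₂ ≫ n₂) ≫ cL g₁ l₂) ▷ l₃ ⊗≫
              l₁ ◁ l₂ ◁ n₃ ⊗≫ π := by rw [hω, hη]; bicategory
          _ = _ := by rw [this]; bicategory
    _ = 𝟙 _ ⊗≫ (P₁ ≫ P₂) ◁ k₁ ▷ (l₂ ≫ l₃) ⊗≫
      (Ω₁ ≫ cR l₁ (cL g₁ G₂ ≫ g₂)) ▷ (W₁ ≫ l₂ ≫ l₃) ⊗≫ cR l₁ w₁ ▷ (l₂ ≫ l₃) ⊗≫ l₁ ◁ n₂ ▷ l₃ ⊗≫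
      l₁ ◁ l₂ ◁ n₃ ⊗≫ π := by
        simp only [cL, cR]; bicategory
    _ = 𝟙 _ ⊗≫ ((P₁ ≫ P₂) ◁ k₁ ⊗≫ cL p₁ (P₂ ≫ l₁ ≫ W₁) ⊗≫ cL p₂ (l₁ ≫ W₁) ⊗≫
      (n₁ ▷ W₁ ≫ cR l₁ w₁)) ▷ (l₂ ≫ l₃) ⊗≫ l₁ ◁ n₂ ▷ l₃ ⊗≫ l₁ ◁ l₂ ◁ n₃ ⊗≫ π := by
        rw [hΩ₁]; simp only [cL]; bicategory
    _ = 𝟙 _ ⊗≫ ((P₁ ◁ P₂ ◁ k₁ ≫ cL p₁ (P₂ ≫ l₁ ≫ W₁)) ⊗≫ cL p₂ (l₁ ≫ W₁) ⊗≫ cR l₁ w₁ ⊗≫ n₁) ▷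
      (l₂ ≫ l₃) ⊗≫ l₁ ◁ n₂ ▷ l₃ ⊗≫ l₁ ◁ l₂ ◁ n₃ ⊗≫ π := by
        rw [cR_natural]; bicategory
    _ = 𝟙 _ ⊗≫ (cL p₁ (P₂ ≫ W₀ ≫ l₁) ⊗≫ (P₂ ◁ k₁ ≫ cL p₂ (l₁ ≫ W₁)) ⊗≫ cR l₁ w₁ ⊗≫ n₁) ▷
      (l₂ ≫ l₃) ⊗≫ l₁ ◁ n₂ ▷ l₃ ⊗≫ l₁ ◁ l₂ ◁ n₃ ⊗≫ π := by
        rw [cL_natural p₁]; bicategory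
    _ = 𝟙 _ ⊗≫ (cL p₁ (P₂ ≫ W₀ ≫ l₁) ⊗≫ cL p₂ (W₀ ≫ l₁) ⊗≫ (k₁ ≫ cR l₁ w₁) ⊗≫ n₁) ▷
      (l₂ ≫ l₃) ⊗≫ l₁ ◁ n₂ ▷ l₃ ⊗≫ l₁ ◁ l₂ ◁ n₃ ⊗≫ π := by
        rw [cL_natural p₂]; bicategory
    _ = _ := by
        rw [hk₁]; simp only [cL]; bicategory
end CategoryTheory.Bicategory

namespace CategoryTheory.Bicategory
variable {B : Type u} [Bicategory.{w, v} B]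

/-- Invertibility allows contractions to be cancelled, so that an identity between contracted
pastings is equivalent to the original one. -/
instance isIso_cL {X Y : B} {P : X ⟶ X} (p : P ⟶ 𝟙 X) [IsIso p] (f : X ⟶ Y) : IsIso (cL p f) := by
  unfold cL; infer_instance

instance isIso_cR {X Y : B} {P : Y ⟶ Y} (f : X ⟶ Y) (p : P ⟶ 𝟙 Y) [IsIso p] : IsIso (cR f p) := by
  unfold cR; infer_instance

/-- The same backward pushing of contractions for the naturality relation of `ω`. The naturality
cells of `ψ` only carry loops across `F`, so nothing but `H` and the reduced 2-morphism `m'` at the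
target objects survives. -/
theorem contract_naturality_left {X Y X' Y' : B} {P W : X ⟶ X} {P' W' : X' ⟶ X'}
    {R' V' : Y' ⟶ Y'} {a : X ⟶ Y} {a' : X' ⟶ Y'} {F : X ⟶ X'} {G : Y ⟶ Y'}
    {p : P ⟶ 𝟙 X} {w : W ⟶ 𝟙 X} {p' : P' ⟶ 𝟙 X'} {w' : W' ⟶ 𝟙 X'} {r' : R' ⟶ 𝟙 Y'}
    {v' : V' ⟶ 𝟙 Y'} (H : a ≫ G ⟶ F ≫ a') {k : W ≫ F ⟶ F ≫ W'} {s : P ≫ F ⟶ F ≫ P'}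
    {ω' : P' ≫ W' ≫ a' ⟶ a' ≫ R' ≫ V'} {m' : a' ⟶ a'}
    (hk : k ≫ cR F w' = cL w F) (hs : s ≫ cR F p' = cL p F)
    (hω : ω' ≫ cR a' (cL r' V' ≫ v') = cL p' (W' ≫ a') ≫ cL w' a' ≫ m') :
    (𝟙 ((P ≫ W ≫ a) ≫ G) ⊗≫ (P ≫ W) ◁ H ⊗≫ P ◁ k ▷ a' ⊗≫ s ▷ (W' ≫ a') ⊗≫ F ◁ ω') ≫
        F ◁ cR a' (cL r' V' ≫ v') =
      (cL p (W ≫ a) ≫ cL w a) ▷ G ≫ H ≫ F ◁ m' := by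
  calc _ = 𝟙 _ ⊗≫ (P ≫ W) ◁ H ⊗≫ P ◁ k ▷ a' ⊗≫ s ▷ (W' ≫ a') ⊗≫
        F ◁ (ω' ≫ cR a' (cL r' V' ≫ v')) := by bicategory
    _ = 𝟙 _ ⊗≫ (P ≫ W) ◁ H ⊗≫ P ◁ k ▷ a' ⊗≫ (s ≫ cR F p') ▷ (W' ≫ a') ⊗≫ F ◁ cL w' a' ⊗≫
        F ◁ m' := by rw [hω]; simp only [cL, cR]; bicategory
    _ = 𝟙 _ ⊗≫ (P ≫ W) ◁ H ⊗≫ (P ◁ k ≫ cL p (F ≫ W')) ▷ a' ⊗≫ F ◁ cL w' a' ⊗≫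
        F ◁ m' := by rw [hs]; simp only [cL]; bicategory
    _ = 𝟙 _ ⊗≫ (P ◁ W ◁ H ≫ cL p (W ≫ F ≫ a')) ⊗≫ (k ≫ cR F w') ▷ a' ⊗≫
        F ◁ m' := by rw [cL_natural p k]; simp only [cL, cR]; bicategory
    _ = 𝟙 _ ⊗≫ cL p (W ≫ a ≫ G) ⊗≫ (W ◁ H ≫ cL w (F ≫ a')) ⊗≫ F ◁ m' := by
        rw [cL_natural p, hk]; simp only [cL]; bicategory
    _ = _ := by rw [cL_natural w]; simp only [cL]; bicategory

/-- Here `ω` is the first cell, so the contraction has to travel past `H`, `s` and `k` before it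
turns `ω` into `m`. For this the loops `R'`, `V'` are contracted in the opposite order, as `e` and
`e'` permit. -/
theorem contract_naturality_right {X Y X' Y' : B} {P W : X ⟶ X} {R V : Y ⟶ Y}
    {R' V' : Y' ⟶ Y'} {a : X ⟶ Y} {a' : X' ⟶ Y'} {F : X ⟶ X'} {G : Y ⟶ Y'}
    {p : P ⟶ 𝟙 X} {w : W ⟶ 𝟙 X} {r : R ⟶ 𝟙 Y} {v : V ⟶ 𝟙 Y} {r' : R' ⟶ 𝟙 Y'}
    {v' : V' ⟶ 𝟙 Y'} (H : a ≫ G ⟶ F ≫ a') {k : V ≫ G ⟶ G ≫ V'} {s : R ≫ G ⟶ G ≫ R'}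
    {ω : P ≫ W ≫ a ⟶ a ≫ R ≫ V} {m : a ⟶ a}
    (hk : k ≫ cR G v' = cL v G) (hs : s ≫ cR G r' = cL r G)
    (hω : ω ≫ cR a (cL r V ≫ v) = cL p (W ≫ a) ≫ cL w a ≫ m) :
    (ω ▷ G ⊗≫ (a ≫ R) ◁ k ⊗≫ a ◁ s ▷ V' ⊗≫ H ▷ (R' ≫ V') ⊗≫ 𝟙 (F ≫ a' ≫ R' ≫ V')) ≫
        F ◁ cR a' (cL r' V' ≫ v') =
      (cL p (W ≫ a) ≫ cL w a) ▷ G ≫ m ▷ G ≫ H := by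
  have e : cL r' V' ≫ v' = cR R' v' ≫ r' := by
    rw [← cL_natural, ← cR_natural]; simp only [cL, cR, whisker_exchange_assoc]; bicategory
  have e' : cL r V ≫ v = cR R v ≫ r := by
    rw [← cL_natural, ← cR_natural]; simp only [cL, cR, whisker_exchange_assoc]; bicategory
  calc _ = ω ▷ G ⊗≫ (a ≫ R) ◁ k ⊗≫ a ◁ s ▷ V' ⊗≫
        (H ▷ (R' ≫ V') ≫ cR (F ≫ a') (cR R' v' ≫ r')) := by
          rw [e]; simp only [cR]; bicategory
    _ = ω ▷ G ⊗≫ (a ≫ R) ◁ k ⊗≫ a ◁ (s ▷ V' ≫ cR (G ≫ R') v') ⊗≫ a ◁ cR G r' ⊗≫ H := by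
          rw [cR_natural]; simp only [cR]; bicategory
    _ = ω ▷ G ⊗≫ (a ≫ R) ◁ (k ≫ cR G v') ⊗≫ a ◁ (s ≫ cR G r') ⊗≫ H := by
          rw [cR_natural]; simp only [cR]; bicategory
    _ = (ω ≫ cR a (cR R v ≫ r)) ▷ G ⊗≫ H := by
          rw [hk, hs]; simp only [cL, cR]; bicategory
    _ = _ := by rw [← e', hω]; bicategory

end CategoryTheory.Bicategory

/-! ### Compatibility of contractions with the tensor product. -/

namespace TensorFunctor
section
variable {C : Type u} [Bicategory.{w, v} C] (T : TensorFunctor C)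
variable {X X' X'' Y Y' Y'' : C}

lemma tComp_hom_whiskerRight {f f' : X ⟶ X'} {g g' : Y ⟶ Y'} (τ : f ⟶ f') (σ : g ⟶ g')
    (h : X' ⟶ X'') (k : Y' ⟶ Y'') :
    (T.tComp f h g k).hom ≫ T.tHom₂ τ σ ▷ T.tHom h k =
      T.tHom₂ (τ ▷ h) (σ ▷ k) ≫ (T.tComp f' h g' k).hom := by
  simp [tHom₂_whiskerRight]

lemma tComp_hom_whiskerLeft (f : X ⟶ X') (g : Y ⟶ Y') {h h' : X' ⟶ X''} {k k' : Y' ⟶ Y''}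
    (τ : h ⟶ h') (σ : k ⟶ k') :
    (T.tComp f h g k).hom ≫ T.tHom f g ◁ T.tHom₂ τ σ =
      T.tHom₂ (f ◁ τ) (g ◁ σ) ≫ (T.tComp f h' g k').hom := by
  simp [tHom₂_whiskerLeft]

/-- The contraction of `id_X ⊗ p` induced by a contraction of `p`. -/
def cUnitL (X : C) {p : Y ⟶ Y} (c : p ⟶ 𝟙 Y) : T.idL X p ⟶ 𝟙 (T.tObj X Y) :=
  T.tHom₂ (𝟙 (𝟙 X)) c ≫ (T.tId X Y).hom

/-- The contraction of `p ⊗ id_X` induced by a contraction of `p`. -/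
def cUnitR {p : Y ⟶ Y} (c : p ⟶ 𝟙 Y) (X : C) : T.idR p X ⟶ 𝟙 (T.tObj Y X) :=
  T.tHom₂ c (𝟙 (𝟙 X)) ≫ (T.tId Y X).hom

instance isIso_cUnitL (X : C) {p : Y ⟶ Y} (c : p ⟶ 𝟙 Y) [IsIso c] : IsIso (T.cUnitL X c) := by
  unfold cUnitL; infer_instance

instance isIso_cUnitR (X : C) {p : Y ⟶ Y} (c : p ⟶ 𝟙 Y) [IsIso c] : IsIso (T.cUnitR c X) := by
  unfold cUnitR; infer_instance

lemma cUnitL_id (X Y : C) : T.cUnitL X (𝟙 (𝟙 Y)) = (T.tId X Y).hom := by simp [cUnitL]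

lemma cUnitR_id (Y X : C) : T.cUnitR (𝟙 (𝟙 Y)) X = (T.tId Y X).hom := by simp [cUnitR]

/-- Naturality of `T.tComp` reduces the claim to the left unit axiom of the pseudofunctor, and the
unitor built into `idLComp` cancels. Thus contracting `id_X ⊗ p` after distributing `id_X ⊗ -` is
the same as contracting `p` inside the tensor product. -/
lemma idLComp_cL (X : C) {p : Y ⟶ Y} (c : p ⟶ 𝟙 Y) (g : Y ⟶ Y') :
    (T.idLComp X p g).hom ≫ cL (T.cUnitL X c) (T.idL X g) = T.tHom₂ (𝟙 (𝟙 X)) (cL c g) := by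
  have h := T.tComp_hom_whiskerRight (𝟙 (𝟙 X)) c (𝟙 X) g
  have e : (T.idLComp X p g).hom =
    T.tHom₂ (λ_ (𝟙 X)).inv (𝟙 (p ≫ g)) ≫ (T.tComp (𝟙 X) (𝟙 X) p g).hom := rfl
  rw [e, cL, cUnitL, comp_whiskerRight, Category.assoc, Category.assoc, reassoc_of% h,
    ← tHom₂_leftUnitor, tHom₂_comp, tHom₂_comp, cL]
  simp

/-- As for `idLComp_cL`, now with the right unit axiom. The left unitor in `idLComp` still cancels,
because the two unitors agree on an identity. -/
lemma idLComp_cR (X : C) (f : Y ⟶ Y') {p : Y' ⟶ Y'} (c : p ⟶ 𝟙 Y') :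
    (T.idLComp X f p).hom ≫ cR (T.idL X f) (T.cUnitL X c) = T.tHom₂ (𝟙 (𝟙 X)) (cR f c) := by
  have h := T.tComp_hom_whiskerLeft (𝟙 X) f (𝟙 (𝟙 X)) c
  have e : (T.idLComp X f p).hom =
    T.tHom₂ (λ_ (𝟙 X)).inv (𝟙 (f ≫ p)) ≫ (T.tComp (𝟙 X) (𝟙 X) f p).hom := rfl
  rw [e, cR, cUnitL, whiskerLeft_comp, Category.assoc, Category.assoc, reassoc_of% h,
    ← tHom₂_rightUnitor, tHom₂_comp, tHom₂_comp, cR]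
  simp

lemma idRComp_cL {p : Y ⟶ Y} (c : p ⟶ 𝟙 Y) (g : Y ⟶ Y') (X : C) :
    (T.idRComp p g X).hom ≫ cL (T.cUnitR c X) (T.idR g X) = T.tHom₂ (cL c g) (𝟙 (𝟙 X)) := by
  have h := T.tComp_hom_whiskerRight c (𝟙 (𝟙 X)) g (𝟙 X)
  have e : (T.idRComp p g X).hom =
    T.tHom₂ (𝟙 (p ≫ g)) (λ_ (𝟙 X)).inv ≫ (T.tComp p g (𝟙 X) (𝟙 X)).hom := rfl
  rw [e, cL, cUnitR, comp_whiskerRight, Category.assoc, Category.assoc, reassoc_of% h,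
    ← tHom₂_leftUnitor, tHom₂_comp, tHom₂_comp, cL]
  simp

lemma idRComp_cR (f : Y ⟶ Y') {p : Y' ⟶ Y'} (c : p ⟶ 𝟙 Y') (X : C) :
    (T.idRComp f p X).hom ≫ cR (T.idR f X) (T.cUnitR c X) = T.tHom₂ (cR f c) (𝟙 (𝟙 X)) := by
  have h := T.tComp_hom_whiskerLeft f (𝟙 X) c (𝟙 (𝟙 X))
  have e : (T.idRComp f p X).hom =
    T.tHom₂ (𝟙 (f ≫ p)) (λ_ (𝟙 X)).inv ≫ (T.tComp f p (𝟙 X) (𝟙 X)).hom := rfl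
  rw [e, cR, cUnitR, whiskerLeft_comp, Category.assoc, Category.assoc, reassoc_of% h,
    ← tHom₂_rightUnitor, tHom₂_comp, tHom₂_comp, cR]
  simp

/-- Two uses of `idLComp_cL`, with the inner distribution slid past the contraction of the first
loop. It serves to contract the source of `1 ⊗ ω`; `idLComp₃_cR` does the same for the target. -/
lemma idLComp₃_cL (X : C) {p q : Y ⟶ Y} (c : p ⟶ 𝟙 Y) (d : q ⟶ 𝟙 Y) (g : Y ⟶ Y') :
    (T.idLComp₃ X p q g).hom ≫ cL (T.cUnitL X c) (T.idL X q ≫ T.idL X g) ≫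
        cL (T.cUnitL X d) (T.idL X g) = T.tHom₂ (𝟙 (𝟙 X)) (cL c (q ≫ g) ≫ cL d g) := by
  have e : (T.idLComp₃ X p q g).hom =
    (T.idLComp X p (q ≫ g)).hom ≫ T.idL X p ◁ (T.idLComp X q g).hom := rfl
  rw [e, Category.assoc, cL_natural_assoc, idLComp_cL, ← Category.assoc, idLComp_cL, tHom₂_comp]
  simp

lemma idLComp₃_cR (X : C) (f : Y ⟶ Y') {p q : Y' ⟶ Y'} (c : p ⟶ 𝟙 Y') (d : q ⟶ 𝟙 Y') :
    (T.idLComp₃ X f p q).hom ≫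
        cR (T.idL X f) (cL (T.cUnitL X c) (T.idL X q) ≫ T.cUnitL X d) =
      T.tHom₂ (𝟙 (𝟙 X)) (cR f (cL c q ≫ d)) := by
  have e : (T.idLComp₃ X f p q).hom =
    (T.idLComp X f (p ≫ q)).hom ≫ T.idL X f ◁ (T.idLComp X p q).hom := rfl
  rw [← idLComp_cR, e, Category.assoc, cR, cR, ← whiskerLeft_comp_assoc, ← Category.assoc
    (T.idLComp X p q).hom, idLComp_cL, cUnitL, cUnitL, tHom₂_comp_assoc]
  simp

lemma idRComp₃_cL {p q : Y ⟶ Y} (c : p ⟶ 𝟙 Y) (d : q ⟶ 𝟙 Y) (g : Y ⟶ Y') (X : C) :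
    (T.idRComp₃ p q g X).hom ≫ cL (T.cUnitR c X) (T.idR q X ≫ T.idR g X) ≫
        cL (T.cUnitR d X) (T.idR g X) = T.tHom₂ (cL c (q ≫ g) ≫ cL d g) (𝟙 (𝟙 X)) := by
  have e : (T.idRComp₃ p q g X).hom =
    (T.idRComp p (q ≫ g) X).hom ≫ T.idR p X ◁ (T.idRComp q g X).hom := rfl
  rw [e, Category.assoc, cL_natural_assoc, idRComp_cL, ← Category.assoc, idRComp_cL, tHom₂_comp]
  simp

lemma idRComp₃_cR (f : Y ⟶ Y') {p q : Y' ⟶ Y'} (c : p ⟶ 𝟙 Y') (d : q ⟶ 𝟙 Y') (X : C) :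
    (T.idRComp₃ f p q X).hom ≫
        cR (T.idR f X) (cL (T.cUnitR c X) (T.idR q X) ≫ T.cUnitR d X) =
      T.tHom₂ (cR f (cL c q ≫ d)) (𝟙 (𝟙 X)) := by
  have e : (T.idRComp₃ f p q X).hom =
    (T.idRComp f (p ≫ q) X).hom ≫ T.idR f X ◁ (T.idRComp p q X).hom := rfl
  rw [← idRComp_cR, e, Category.assoc, cR, cR, ← whiskerLeft_comp_assoc, ← Category.assoc
    (T.idRComp p q X).hom, idRComp_cL, cUnitR, cUnitR, tHom₂_comp_assoc]
  simp

/-- Interchanging the contraction of units on the two sides of `⊗`. -/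
lemma interchange_contract {X Y : C} {Q : X ⟶ X} {R : Y ⟶ Y} (c : Q ⟶ 𝟙 X) (d : R ≅ 𝟙 Y)
    {k : Q ≫ 𝟙 X ⟶ 𝟙 X ≫ 𝟙 X} {l : 𝟙 Y ≫ 𝟙 Y ⟶ R ≫ 𝟙 Y} (hk : k = c ▷ 𝟙 X)
    (hl : l = d.inv ▷ 𝟙 Y) :
    ((T.tComp Q (𝟙 X) (𝟙 Y) (𝟙 Y)).inv ≫ T.tHom₂ k l ≫ (T.tComp (𝟙 X) (𝟙 X) R (𝟙 Y)).hom) ≫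
        cL (T.cUnitL X d.hom) (T.tHom (𝟙 X) (𝟙 Y)) ≫ (T.tId X Y).hom =
      cL (T.cUnitR c Y) (T.tHom (𝟙 X) (𝟙 Y)) ≫ (T.tId X Y).hom := by
  subst hk hl
  rw [← tComp_hom_whiskerRight, Iso.inv_hom_id_assoc, cL, cL, ← Category.assoc,
    ← Category.assoc, ← comp_whiskerRight, cUnitL, ← Category.assoc, tHom₂_comp, Category.comp_id,
    Iso.inv_hom_id]
  rfl

end
end TensorFunctor

/-! ### Contraction rules for `â`, for `ω` and for the naturality squares of `ψ`. -/

namespace TensorAssociator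
section
variable {C : Type u} [Bicategory.{w, v} C] {T : TensorFunctor C} (A : TensorAssociator T)

/-- The axiom `hat_id` expresses `â(id, id, id)` through the unit constraints alone, and the
contraction on the left cancels the inverse ones. So this cell carries a loop across `a` without
leaving a trace. -/
lemma hat_id_contract (X Y Z : C) :
    (A.hat (𝟙 X) (𝟙 Y) (𝟙 Z)).hom ≫ cL (T.cUnitL X (T.tId Y Z).hom) (A.a X Y Z) =
      cR (A.a X Y Z) (T.cUnitR (T.tId X Y).hom Z) := by
  have h : (T.tHom₂ (𝟙 (𝟙 X)) (T.tId Y Z).inv) ≫ T.tHom₂ (𝟙 (𝟙 X)) (T.tId Y Z).hom = 𝟙 _ := by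
    simp [TensorFunctor.tHom₂_comp]
  rw [hat_id, cL, cR, TensorFunctor.cUnitL, TensorFunctor.cUnitR]
  simp only [bicategoricalComp, Category.assoc, ← comp_whiskerRight_assoc, reassoc_of% h]
  simp

lemma hat_id_inv_contract (X Y Z : C) :
    (A.hat (𝟙 X) (𝟙 Y) (𝟙 Z)).inv ≫ cR (A.a X Y Z) (T.cUnitR (T.tId X Y).hom Z) =
      cL (T.cUnitL X (T.tId Y Z).hom) (A.a X Y Z) := by
  rw [← hat_id_contract, Iso.inv_hom_id_assoc]

/-- Contraction of the units in the source of `ω_{X,Y,Z}`. -/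
def ωSource (X Y Z : C) :
    T.idL X (𝟙 (T.tObj Y Z)) ≫ 𝟙 (T.tObj X (T.tObj Y Z)) ≫ A.a X Y Z ≅ A.a X Y Z :=
  whiskerRightIso (T.tId X (T.tObj Y Z)) (𝟙 _ ≫ A.a X Y Z) ≪≫ λ_ _ ≪≫ λ_ _

/-- Contraction of the units in the target of `ω_{X,Y,Z}`. -/
def ωTarget (X Y Z : C) :
    A.a X Y Z ≫ T.idR (𝟙 (T.tObj X Y)) Z ≫ 𝟙 (T.tObj (T.tObj X Y) Z) ≅ A.a X Y Z :=
  whiskerLeftIso (A.a X Y Z) (ρ_ _ ≪≫ T.tId (T.tObj X Y) Z) ≪≫ ρ_ _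

/-- The 2-morphism `(id_X ⊗ id_{Y⊗Z}) ≫ a_{X,Y,Z} ⟶ a_{X,Y,Z} ≫ (id_{X⊗Y} ⊗ id_Z)` given by
`n : a ⟶ a` and the unit constraints of `⊗`. -/
def ωOf (n : A.PseudoMod₃) (X Y Z : C) :
    T.idL X (𝟙 (T.tObj Y Z)) ≫ 𝟙 (T.tObj X (T.tObj Y Z)) ≫ A.a X Y Z ⟶
      A.a X Y Z ≫ T.idR (𝟙 (T.tObj X Y)) Z ≫ 𝟙 (T.tObj (T.tObj X Y) Z) :=
  (A.ωSource X Y Z).hom ≫ n X Y Z ≫ (A.ωTarget X Y Z).inv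

lemma ω₀_eq (X Y Z : C) : A.ω₀ X Y Z = A.ωOf (fun X Y Z => 𝟙 (A.a X Y Z)) X Y Z := by
  simp only [ω₀, ωOf, ωSource, ωTarget, Iso.trans_hom, Iso.trans_inv, whiskerRightIso_hom,
    whiskerLeftIso_inv]
  bicategory

lemma ωSource_hom (X Y Z : C) : (A.ωSource X Y Z).hom =
    cL (T.tId X (T.tObj Y Z)).hom (𝟙 _ ≫ A.a X Y Z) ≫ cL (𝟙 (𝟙 _)) (A.a X Y Z) := by
  simp [ωSource, cL]

lemma ωTarget_hom (X Y Z : C) : (A.ωTarget X Y Z).hom =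
    cR (A.a X Y Z) (cL (T.tId (T.tObj X Y) Z).hom (𝟙 _) ≫ 𝟙 (𝟙 _)) := by
  simp only [ωTarget, cL, cR, Iso.trans_hom, whiskerLeftIso_hom]
  bicategory

/-- Supplies the hypotheses about `ω` in the four contraction theorems: after contraction only `n`
is left. -/
lemma ωOf_contract (n : A.PseudoMod₃) (X Y Z : C) :
    A.ωOf n X Y Z ≫ cR (A.a X Y Z) (cL (T.tId (T.tObj X Y) Z).hom (𝟙 _) ≫ 𝟙 (𝟙 _)) =
      cL (T.tId X (T.tObj Y Z)).hom (𝟙 _ ≫ A.a X Y Z) ≫ cL (𝟙 (𝟙 _)) (A.a X Y Z) ≫ n X Y Z := by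
  rw [← ωTarget_hom, ωOf, ωSource_hom]
  simp

/-- `ωOf n` as a 2-isomorphism. -/
def ωIso (n : ∀ X Y Z : C, A.a X Y Z ≅ A.a X Y Z) (X Y Z : C) :
    T.idL X (𝟙 (T.tObj Y Z)) ≫ 𝟙 (T.tObj X (T.tObj Y Z)) ≫ A.a X Y Z ≅
      A.a X Y Z ≫ T.idR (𝟙 (T.tObj X Y)) Z ≫ 𝟙 (T.tObj (T.tObj X Y) Z) :=
  A.ωSource X Y Z ≪≫ n X Y Z ≪≫ (A.ωTarget X Y Z).symm

/-- With `ψ` the identity, this is the contraction rule for the cells `ψ̂`; `sqL_contract` and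
`sqR_contract` are its versions for `ψ̂` tensored with a 1-morphism. -/
lemma unitors_contract {X Y : C} (f : X ⟶ Y) :
    ((λ_ f).hom ≫ (ρ_ f).inv) ≫ cR f (𝟙 (𝟙 Y)) = cL (𝟙 (𝟙 X)) f := by
  simp [cL, cR]

lemma sqL_contract {X X' Y Y' : C} (f : X ⟶ X') (g : Y ⟶ Y') :
    T.sqL f ((λ_ g).hom ≫ (ρ_ g).inv) ≫ cR (T.tHom f g) (T.tId X' Y').hom =
      cL (T.tId X Y).hom (T.tHom f g) := by
  rw [TensorFunctor.sqL_unitors]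
  simp [cL, cR, ← whiskerLeft_comp_assoc]

lemma sqR_contract {X X' Y Y' : C} (f : X ⟶ X') (g : Y ⟶ Y') :
    T.sqR ((λ_ g).hom ≫ (ρ_ g).inv) f ≫ cR (T.tHom g f) (T.tId Y' X').hom =
      cL (T.tId Y X).hom (T.tHom g f) := by
  rw [TensorFunctor.sqR_unitors]
  simp [cL, cR, ← whiskerLeft_comp_assoc]

/-- Both distributions of `id_X ⊗ -` turn outer contractions into contractions inside the tensor
product, where `ωOf_contract` applies. What remains is `1 ⊗ n`. -/
lemma idL_ωOf_contract (n : A.PseudoMod₃) (X Y Z W : C) :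
    ((T.idLComp₃ X (T.idL Y (𝟙 (T.tObj Z W))) (𝟙 _) (A.a Y Z W)).inv ≫
        T.tHom₂ (𝟙 (𝟙 X)) (A.ωOf n Y Z W) ≫
        (T.idLComp₃ X (A.a Y Z W) (T.idR (𝟙 (T.tObj Y Z)) W) (𝟙 _)).hom) ≫
      cR (T.idL X (A.a Y Z W)) (cL (T.cUnitL X (T.tId (T.tObj Y Z) W).hom) (T.idL X (𝟙 _)) ≫
        (T.tId X _).hom) =
    cL (T.cUnitL X (T.tId Y (T.tObj Z W)).hom) (T.idL X (𝟙 _) ≫ T.idL X (A.a Y Z W)) ≫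
      cL (T.tId X _).hom (T.idL X (A.a Y Z W)) ≫ T.tHom₂ (𝟙 (𝟙 X)) (n Y Z W) := by
  rw [← T.cUnitL_id X (T.tObj (T.tObj Y Z) W), ← T.cUnitL_id X (T.tObj Y (T.tObj Z W)), Category.assoc, Category.assoc, TensorFunctor.idLComp₃_cR,
    TensorFunctor.tHom₂_comp, ωOf_contract, Iso.inv_comp_eq,
    reassoc_of% (T.idLComp₃_cL X (T.tId Y (T.tObj Z W)).hom
      (𝟙 (𝟙 _)) (A.a Y Z W)), TensorFunctor.tHom₂_comp]
  simp

lemma idR_ωOf_contract (n : A.PseudoMod₃) (X Y Z W : C) :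
    ((T.idRComp₃ (T.idL X (𝟙 (T.tObj Y Z))) (𝟙 _) (A.a X Y Z) W).inv ≫
        T.tHom₂ (A.ωOf n X Y Z) (𝟙 (𝟙 W)) ≫
        (T.idRComp₃ (A.a X Y Z) (T.idR (𝟙 (T.tObj X Y)) Z) (𝟙 _) W).hom) ≫
      cR (T.idR (A.a X Y Z) W) (cL (T.cUnitR (T.tId (T.tObj X Y) Z).hom W) (T.idR (𝟙 _) W) ≫
        (T.tId _ W).hom) =
    cL (T.cUnitR (T.tId X (T.tObj Y Z)).hom W) (T.idR (𝟙 _) W ≫ T.idR (A.a X Y Z) W) ≫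
      cL (T.tId _ W).hom (T.idR (A.a X Y Z) W) ≫ T.tHom₂ (n X Y Z) (𝟙 (𝟙 W)) := by
  rw [← T.cUnitR_id (T.tObj (T.tObj X Y) Z) W, ← T.cUnitR_id (T.tObj X (T.tObj Y Z)) W, Category.assoc, Category.assoc, TensorFunctor.idRComp₃_cR,
    TensorFunctor.tHom₂_comp, ωOf_contract, Iso.inv_comp_eq,
    reassoc_of% (T.idRComp₃_cL (T.tId X (T.tObj Y Z)).hom
      (𝟙 (𝟙 _)) (A.a X Y Z) W), TensorFunctor.tHom₂_comp]
  simp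

/-- The reduced form of the coherence relation for `(id, ωOf n)`. -/
def Intertwines (n : A.PseudoMod₃) (p p' : A.PseudoMod₄) : Prop :=
  ∀ X Y Z W : C,
    p X Y Z W ≫ n X Y (T.tObj Z W) ▷ A.a (T.tObj X Y) Z W ≫
        A.a X Y (T.tObj Z W) ◁ n (T.tObj X Y) Z W =
      T.tHom₂ (𝟙 (𝟙 X)) (n Y Z W) ▷ (A.a X (T.tObj Y Z) W ≫ T.idR (A.a X Y Z) W) ≫
        T.idL X (A.a Y Z W) ◁ n X (T.tObj Y Z) W ▷ T.idR (A.a X Y Z) W ≫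
        T.idL X (A.a Y Z W) ◁ A.a X (T.tObj Y Z) W ◁ T.tHom₂ (n X Y Z) (𝟙 (𝟙 W)) ≫ p' X Y Z W

end
end TensorAssociator

namespace TensorAssociator
section
variable {C : Type u} [Bicategory.{w, v} C] {T : TensorFunctor C} (A : TensorAssociator T)

/-- By naturality of the unitors, the two tensor factors of the middle cell of the coherence
relation are the unit constraints whiskered by an identity, the situation of `interchange_contract`.
This is the hypothesis `hmid` of `contract_pentagon_left`. -/
lemma interchange_unitors_contract (T : TensorFunctor C) (X Y Z W : C) :
    ((T.tComp (T.tHom (𝟙 X) (𝟙 Y)) (𝟙 (T.tObj X Y)) (𝟙 (T.tObj Z W)) (𝟙 (T.tObj Z W))).inv ≫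
        T.tHom₂ ((λ_ (T.tHom (𝟙 X) (𝟙 Y)) ≪≫ (ρ_ _).symm).inv ≫ 𝟙 (T.tObj X Y) ◁ (T.tId X Y).hom)
          (𝟙 (T.tObj Z W) ◁ (T.tId Z W).inv ≫ (λ_ (T.tHom (𝟙 Z) (𝟙 W)) ≪≫ (ρ_ _).symm).hom) ≫
        (T.tComp (𝟙 (T.tObj X Y)) (𝟙 (T.tObj X Y)) (T.tHom (𝟙 Z) (𝟙 W)) (𝟙 (T.tObj Z W))).hom) ≫
      cL (T.cUnitL (T.tObj X Y) (T.tId Z W).hom) (T.tHom (𝟙 (T.tObj X Y)) (𝟙 (T.tObj Z W))) ≫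
        (T.tId (T.tObj X Y) (T.tObj Z W)).hom =
    cL (T.cUnitR (T.tId X Y).hom (T.tObj Z W)) (T.tHom (𝟙 (T.tObj X Y)) (𝟙 (T.tObj Z W))) ≫
      (T.tId (T.tObj X Y) (T.tObj Z W)).hom :=
  T.interchange_contract (T.tId X Y).hom (T.tId Z W)
    (by simp only [Iso.trans_inv, Iso.symm_inv]; bicategory)
    (by simp only [Iso.trans_hom, Iso.symm_hom]; bicategory)

end
end TensorAssociator

/-! ### Semigroupal structures on the identity with trivial `ψ` are intertwining modifications. -/

namespace IdSemigroupal
section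
variable {C : Type u} [Bicategory.{w, v} C] {T : TensorFunctor C} {A : TensorAssociator T}
  {P P' : Pentagonator A}

/-- The semigroupal structure on the identity with identity 1-morphisms given by a modification
`n : a ⇛ a`. -/
def ofMod [Strict C] (n : ∀ X Y Z : C, A.a X Y Z ≅ A.a X Y Z) (hn : A.IsMod₃ fun X Y Z => (n X Y Z).hom)
    (h : A.Intertwines (fun X Y Z => (n X Y Z).hom) P.hom P'.hom) :
    IdSemigroupal P P' (fun X Y => 𝟙 (T.tObj X Y)) where
  -- Strictness enters here: a 1-isomorphism requires the equality `𝟙 ≫ 𝟙 = 𝟙`, not just a unitor.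
  ψ_isOneIso X Y := ⟨𝟙 _, Strict.id_comp _, Strict.id_comp _⟩
  hat f g := λ_ _ ≪≫ (ρ_ _).symm
  hat_natural τ σ := by simp
  hat_comp f f' g g' := by simp [bicategoricalComp]
  hat_id X Y := by simp [bicategoricalComp]
  ω := A.ωIso n
  ω_natural {X X' Y Y' Z Z'} f g h := by
    have hL := contract_naturality_left (A.hat f g h).hom
      (TensorAssociator.unitors_contract (T.tHom f (T.tHom g h)))
      (TensorAssociator.sqL_contract f (T.tHom g h))
      (A.ωOf_contract (fun X Y Z => (n X Y Z).hom) X' Y' Z')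
    have hR := contract_naturality_right (A.hat f g h).hom
      (TensorAssociator.unitors_contract (T.tHom (T.tHom f g) h))
      (TensorAssociator.sqR_contract h (T.tHom f g))
      (A.ωOf_contract (fun X Y Z => (n X Y Z).hom) X Y Z)
    -- The two sides agree after the invertible contraction of the target loops, which is then
    -- cancelled.
    exact (cancel_mono _).1 (hL.trans ((congrArg _ (hn f g h).symm).trans hR.symm))
  ω_coherence X Y Z W := by
    let n' : A.PseudoMod₃ := fun X Y Z => (n X Y Z).hom
    have hL := contract_pentagon_left (P.π X Y Z W).hom
      (A.ωOf_contract n' X Y (T.tObj Z W)) (A.ωOf_contract n' (T.tObj X Y) Z W)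
      (A.hat_id_inv_contract X Y (T.tObj Z W)) (A.hat_id_inv_contract (T.tObj X Y) Z W)
      (TensorAssociator.interchange_unitors_contract T X Y Z W)
    have hR := contract_pentagon_right (P'.π X Y Z W).hom
      (TensorAssociator.unitors_contract (T.tHom (𝟙 X) (A.a Y Z W)))
      (A.idL_ωOf_contract n' X Y Z W) (A.ωOf_contract n' X (T.tObj Y Z) W)
      (A.hat_id_inv_contract X (T.tObj Y Z) W)
      (TensorAssociator.unitors_contract (T.tHom (A.a X Y Z) (𝟙 W)))
      (A.idR_ωOf_contract n' X Y Z W)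
    refine (cancel_mono _).1 (hL.trans ((congrArg _ ?_).trans hR.symm))
    exact h X Y Z W


/-- Converse of `ofMod`: the contraction theorems are read in the other direction, and the
contraction of the source loops is cancelled. -/
theorem exists_mod (M : IdSemigroupal P P' (fun X Y => 𝟙 (T.tObj X Y)))
    (hM : ∀ {X X' Y Y' : C} (f : X ⟶ X') (g : Y ⟶ Y'), (M.hat f g).hom = (λ_ _).hom ≫ (ρ_ _).inv) :
    ∃ n : A.PseudoMod₃, (∀ X Y Z, (M.ω X Y Z).hom = A.ωOf n X Y Z) ∧ A.IsMod₃ n ∧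
      A.Intertwines n P.hom P'.hom := by
  have hM' {X X' Y Y' : C} (f : X ⟶ X') (g : Y ⟶ Y') :
    M.hat f g = λ_ (T.tHom f g) ≪≫ (ρ_ _).symm := Iso.ext (hM f g)
  -- Forced by `ωOf`: conjugate `ω` by the contractions of the units in its source and target.
  let n : A.PseudoMod₃ := fun X Y Z =>
    (A.ωSource X Y Z).inv ≫ (M.ω X Y Z).hom ≫ (A.ωTarget X Y Z).hom
  have hn (X Y Z : C) : (M.ω X Y Z).hom = A.ωOf n X Y Z := by simp [n, TensorAssociator.ωOf]
  refine ⟨n, hn, fun {X X' Y Y' Z Z'} f g h => ?_, fun X Y Z W => ?_⟩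
  · have hL := contract_naturality_left (A.hat f g h).hom
      (TensorAssociator.unitors_contract (T.tHom f (T.tHom g h)))
      (TensorAssociator.sqL_contract f (T.tHom g h)) (A.ωOf_contract n X' Y' Z')
    have hR := contract_naturality_right (A.hat f g h).hom
      (TensorAssociator.unitors_contract (T.tHom (T.tHom f g) h))
      (TensorAssociator.sqR_contract h (T.tHom f g)) (A.ωOf_contract n X Y Z)
    have e := M.ω_natural f g h
    simp only [hn, hM'] at e
    exact ((cancel_epi _).1 (hL.symm.trans ((congrArg (· ≫ _) e).trans hR))).symm
  · have hL := contract_pentagon_left (P.π X Y Z W).hom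
      (A.ωOf_contract n X Y (T.tObj Z W)) (A.ωOf_contract n (T.tObj X Y) Z W)
      (A.hat_id_inv_contract X Y (T.tObj Z W)) (A.hat_id_inv_contract (T.tObj X Y) Z W)
      (TensorAssociator.interchange_unitors_contract T X Y Z W)
    have hR := contract_pentagon_right (P'.π X Y Z W).hom
      (TensorAssociator.unitors_contract (T.tHom (𝟙 X) (A.a Y Z W)))
      (A.idL_ωOf_contract n X Y Z W) (A.ωOf_contract n X (T.tObj Y Z) W)
      (A.hat_id_inv_contract X (T.tObj Y Z) W)
      (TensorAssociator.unitors_contract (T.tHom (A.a X Y Z) (𝟙 W)))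
      (A.idR_ωOf_contract n X Y Z W)
    have e := M.ω_coherence X Y Z W
    simp only [hn, hM'] at e
    exact (cancel_epi _).1 (hL.symm.trans ((congrArg (· ≫ _) e).trans hR))

end
end IdSemigroupal

/-! ### Calculus of 2-morphisms `τ + σ ε` over the dual numbers. -/

namespace ScalarExt
section
variable {K : Type*} [CommRing K] {C : Type u} [Bicategory.{w, v} C]
  [∀ X Y : C, Preadditive (X ⟶ Y)] [∀ X Y : C, Linear K (X ⟶ Y)]
variable {X Y : ScalarExt K (DualNumber K) C} {f g h : X ⟶ Y}

/-- The coefficient of `ε`, `τ ⊗ (r + s ε) ↦ s • τ`. -/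
def coef (η : f ⟶ g) : f.as ⟶ g.as :=
  TensorProduct.rid K (f.as ⟶ g.as)
    (LinearMap.lTensor (f.as ⟶ g.as) (TrivSqZeroExt.sndHom K K) η)

lemma red_tm (τ : f.as ⟶ g.as) (r : DualNumber K) : red (tm τ r : f ⟶ g) = r.fst • τ :=
  TensorProduct.rid_tmul _ _

lemma coef_tm (τ : f.as ⟶ g.as) (r : DualNumber K) : coef (tm τ r : f ⟶ g) = r.snd • τ :=
  TensorProduct.rid_tmul _ _

lemma red_add (η θ : f ⟶ g) : red (η + θ) = red η + red θ := by
  unfold red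
  rw [← map_add, ← map_add]

lemma coef_add (η θ : f ⟶ g) : coef (η + θ) = coef η + coef θ := by
  unfold coef
  rw [← map_add, ← map_add]

lemma tm_add (τ σ : f.as ⟶ g.as) (r : DualNumber K) :
    (tm (τ + σ) r : f ⟶ g) = tm τ r + tm σ r := TensorProduct.add_tmul _ _ _

/-- The 2-morphism `τ + σ ε`. -/
def dual (τ σ : f.as ⟶ g.as) : f ⟶ g := tm τ (1 : DualNumber K) + tm σ DualNumber.eps

@[simp] lemma red_dual (τ σ : f.as ⟶ g.as) :
    red (dual τ σ : f ⟶ g) = τ := by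
  simp [dual, red_add, red_tm]

@[simp] lemma coef_dual (τ σ : f.as ⟶ g.as) :
    coef (dual τ σ : f ⟶ g) = σ := by
  simp [dual, coef_add, coef_tm]

/-- The dual numbers are free over `K` on `1` and `ε`; on a pure tensor the coordinates of the
scalar are moved into the left factor. -/
lemma dual_red_coef (η : f ⟶ g) : dual (red η) (coef η) = η := by
  refine ind (P := fun η => dual (red η) (coef η) = η) η (fun τ r => ?_) (fun a b ha hb => ?_)
  · rw [red_tm, coef_tm, dual]
    have h1 : (tm (r.fst • τ) (1 : DualNumber K) : f ⟶ g) = tm τ (r.fst • (1 : DualNumber K)) :=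
      TensorProduct.smul_tmul _ _ _
    have h2 : (tm (r.snd • τ) (DualNumber.eps : DualNumber K) : f ⟶ g) =
      tm τ (r.snd • DualNumber.eps) := TensorProduct.smul_tmul _ _ _
    rw [h1, h2]
    refine (TensorProduct.tmul_add τ _ _).symm.trans (congrArg (tm τ) ?_)
    ext <;> simp
  · rw [red_add, coef_add]
    conv_rhs => rw [← ha, ← hb]
    simp only [dual, tm_add]
    abel

lemma dual_inj {τ σ τ' σ' : f.as ⟶ g.as} :
    (dual τ σ : f ⟶ g) = dual τ' σ' ↔ τ = τ' ∧ σ = σ' := by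
  constructor
  · intro h
    exact ⟨by simpa using congrArg red h, by simpa using congrArg coef h⟩
  · rintro ⟨rfl, rfl⟩; rfl

/-- The Leibniz rule: the term `σ ≫ σ'` is killed by `ε² = 0`. -/
lemma dual_comp (τ σ : f.as ⟶ g.as) (τ' σ' : g.as ⟶ h.as) :
    (dual τ σ : f ⟶ g) ≫ (dual τ' σ' : g ⟶ h) = dual (τ ≫ τ') (τ ≫ σ' + σ ≫ τ') := by
  simp only [dual, Preadditive.add_comp, Preadditive.comp_add, tm_comp, tm_add, one_mul, mul_one,
    DualNumber.eps_mul_eps]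
  have : (tm (σ ≫ σ') (0 : DualNumber K) : f ⟶ h) = 0 := TensorProduct.tmul_zero _ _
  rw [this]; abel

lemma tm_comp_dual (ρ : f.as ⟶ g.as) (τ σ : g.as ⟶ h.as) :
    (tm ρ (1 : DualNumber K) : f ⟶ g) ≫ (dual τ σ : g ⟶ h) = dual (ρ ≫ τ) (ρ ≫ σ) := by
  simp only [dual, Preadditive.comp_add, tm_comp, one_mul]

lemma dual_comp_tm (τ σ : f.as ⟶ g.as) (ρ : g.as ⟶ h.as) :
    (dual τ σ : f ⟶ g) ≫ (tm ρ (1 : DualNumber K) : g ⟶ h) = dual (τ ≫ ρ) (σ ≫ ρ) := by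
  simp only [dual, Preadditive.add_comp, tm_comp, mul_one]

/-- Taking the expansions of the factors as hypotheses allows nesting, so that a long pasting is
expanded factor by factor. A factor with no `ε`-term is handled by the two variants that follow. -/
lemma comp_eq_dual {η : f ⟶ g} {θ : g ⟶ h} {τ σ : f.as ⟶ g.as} {τ' σ' : g.as ⟶ h.as}
    (hη : η = dual τ σ) (hθ : θ = dual τ' σ') :
    η ≫ θ = dual (τ ≫ τ') (τ ≫ σ' + σ ≫ τ') := by
  rw [hη, hθ, dual_comp]

lemma tm_comp_eq_dual {η : f ⟶ g} {θ : g ⟶ h} {ρ : f.as ⟶ g.as} {τ σ : g.as ⟶ h.as}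
    (hη : η = tm ρ (1 : DualNumber K)) (hθ : θ = dual τ σ) : η ≫ θ = dual (ρ ≫ τ) (ρ ≫ σ) := by
  rw [hη, hθ, tm_comp_dual]

lemma comp_tm_eq_dual {η : f ⟶ g} {θ : g ⟶ h} {τ σ : f.as ⟶ g.as} {ρ : g.as ⟶ h.as}
    (hη : η = dual τ σ) (hθ : θ = tm ρ (1 : DualNumber K)) : η ≫ θ = dual (τ ≫ ρ) (σ ≫ ρ) := by
  rw [hη, hθ, dual_comp_tm]

lemma id_eq_dual (f : X ⟶ Y) : 𝟙 f = dual (𝟙 f.as) 0 := by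
  have : (tm (0 : f.as ⟶ f.as) (DualNumber.eps : DualNumber K) : f ⟶ f) = 0 :=
    TensorProduct.zero_tmul _ _
  rw [dual, this, add_zero]; rfl

/-- A 2-morphism `τ + σ ε` with `τ` invertible is invertible. -/
def dualIso (τ : f.as ≅ g.as) (σ : f.as ⟶ g.as) : f ≅ g where
  hom := dual τ.hom σ
  inv := dual τ.inv (-(τ.inv ≫ σ ≫ τ.inv))
  hom_inv_id := by
    rw [dual_comp, id_eq_dual]; simp
  inv_hom_id := by
    rw [dual_comp, id_eq_dual]; simp

variable [LinearBicategory K C] (T : TensorFunctor C) [T.IsBilinear K]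

lemma whiskerLeft_dual {Z : ScalarExt K (DualNumber K) C} (k : X ⟶ Y) {f g : Y ⟶ Z}
    (τ σ : f.as ⟶ g.as) : k ◁ (dual τ σ : f ⟶ g) = dual (k.as ◁ τ) (k.as ◁ σ) :=
  whiskerLeft_add' _ _ _

lemma dual_whiskerRight {Z : ScalarExt K (DualNumber K) C} {f g : X ⟶ Y}
    (τ σ : f.as ⟶ g.as) (k : Y ⟶ Z) : (dual τ σ : f ⟶ g) ▷ k = dual (τ ▷ k.as) (σ ▷ k.as) :=
  whiskerRight_add' _ _ _

lemma tm_tHom₂_dual {X X' Y Y' : ScalarExt K (DualNumber K) C} {f f' : X ⟶ X'} {g g' : Y ⟶ Y'}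
    (ρ : f.as ⟶ f'.as) (τ σ : g.as ⟶ g'.as) :
    (tensorExt (K := K) (R := DualNumber K) T).tHom₂ (tm ρ (1 : DualNumber K) : f ⟶ f')
      (dual τ σ : g ⟶ g') = dual (T.tHom₂ ρ τ) (T.tHom₂ ρ σ) := by
  refine (tensorHom₂_add_right T _ _ _).trans ?_
  rw [tensorHom₂_tm, tensorHom₂_tm, one_mul, one_mul]; rfl

lemma dual_tHom₂_tm {X X' Y Y' : ScalarExt K (DualNumber K) C} {f f' : X ⟶ X'} {g g' : Y ⟶ Y'}
    (τ σ : f.as ⟶ f'.as) (ρ : g.as ⟶ g'.as) :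
    (tensorExt (K := K) (R := DualNumber K) T).tHom₂ (dual τ σ : f ⟶ f')
      (tm ρ (1 : DualNumber K) : g ⟶ g') = dual (T.tHom₂ τ ρ) (T.tHom₂ σ ρ) := by
  refine (tensorHom₂_add_left T _ _ _).trans ?_
  rw [tensorHom₂_tm, tensorHom₂_tm, mul_one, mul_one]; rfl

variable {T}

/-- The family `p + n ε`. -/
def dual₄ {A : TensorAssociator T} (p n : A.PseudoMod₄) :
    (associatorExt (K := K) (R := DualNumber K) A).PseudoMod₄ :=
  fun X Y Z W => dual (p X.as Y.as Z.as W.as) (n X.as Y.as Z.as W.as)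

end
end ScalarExt

/-! ### The cells of the extended associator over the dual numbers. -/

namespace ScalarExt
section
variable {K : Type*} [CommRing K] {C : Type u} [Bicategory.{w, v} C]
  [∀ X Y : C, Preadditive (X ⟶ Y)] [∀ X Y : C, Linear K (X ⟶ Y)] [LinearBicategory K C]
  {T : TensorFunctor C} [T.IsBilinear K]

/-- All structural 2-isomorphisms of the extension are those of `C` tensored with `1`, so the
pasting agrees by definition and only a product of ones has to be evaluated. -/
lemma a₄Hat_ext (A : TensorAssociator T) {X X' Y Y' Z Z' W W' : ScalarExt K (DualNumber K) C}
    (f : X ⟶ X') (g : Y ⟶ Y') (h : Z ⟶ Z') (k : W ⟶ W') :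
    (associatorExt (K := K) (R := DualNumber K) A).a₄Hat f g h k =
      tm (A.a₄Hat f.as g.as h.as k.as) 1 :=
  tm_congr rfl (by simp)

lemma b₄Hat_ext (A : TensorAssociator T) {X X' Y Y' Z Z' W W' : ScalarExt K (DualNumber K) C}
    (f : X ⟶ X') (g : Y ⟶ Y') (h : Z ⟶ Z') (k : W ⟶ W') :
    (associatorExt (K := K) (R := DualNumber K) A).b₄Hat f g h k =
      tm (A.b₄Hat f.as g.as h.as k.as) 1 :=
  tm_congr rfl (by simp)

lemma faceP₀_ext (A : TensorAssociator T) (X Y Z U V : ScalarExt K (DualNumber K) C) :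
    ((associatorExt (K := K) (R := DualNumber K) A).faceP₀ X Y Z U V).hom =
      tm (A.faceP₀ X.as Y.as Z.as U.as V.as).hom 1 :=
  tm_congr rfl (by simp)

lemma faceP₃_ext (A : TensorAssociator T) (X Y Z U V : ScalarExt K (DualNumber K) C) :
    (associatorExt (K := K) (R := DualNumber K) A).faceP₃ X Y Z U V =
      tm (A.faceP₃ X.as Y.as Z.as U.as V.as) 1 :=
  tm_congr rfl (by simp)

lemma faceQ₂_ext (A : TensorAssociator T) (X Y Z U V : ScalarExt K (DualNumber K) C) :
    (associatorExt (K := K) (R := DualNumber K) A).faceQ₂ X Y Z U V =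
      tm (A.faceQ₂ X.as Y.as Z.as U.as V.as) 1 :=
  tm_congr rfl (by simp)

lemma tensorExt_add_left {X X' Y Y' : ScalarExt K (DualNumber K) C} {f f' : X ⟶ X'}
    {g g' : Y ⟶ Y'} (τ τ' : f ⟶ f') (σ : g ⟶ g') :
    (tensorExt (K := K) (R := DualNumber K) T).tHom₂ (τ + τ') σ =
      (tensorExt (K := K) (R := DualNumber K) T).tHom₂ τ σ +
        (tensorExt (K := K) (R := DualNumber K) T).tHom₂ τ' σ :=
  tensorHom₂_add_left T τ τ' σ

lemma tensorExt_add_right {X X' Y Y' : ScalarExt K (DualNumber K) C} {f f' : X ⟶ X'}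
    {g g' : Y ⟶ Y'} (τ : f ⟶ f') (σ σ' : g ⟶ g') :
    (tensorExt (K := K) (R := DualNumber K) T).tHom₂ τ (σ + σ') =
      (tensorExt (K := K) (R := DualNumber K) T).tHom₂ τ σ +
        (tensorExt (K := K) (R := DualNumber K) T).tHom₂ τ σ' :=
  tensorHom₂_add_right T τ σ σ'

/-- A face contains its family exactly once and is therefore additive in it (`h'`), while on a
family `m ⊗ r` it is the face of `m` tensored with `r` (`h`). The other pentagonal faces are
expanded in the same way. -/
lemma faceP₁_ext (A : TensorAssociator T) (p n : A.PseudoMod₄)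
    (X Y Z U V : ScalarExt K (DualNumber K) C) :
    (associatorExt (K := K) (R := DualNumber K) A).faceP₁ X Y Z U V (dual₄ p n) =
      dual (A.faceP₁ X.as Y.as Z.as U.as V.as p) (A.faceP₁ X.as Y.as Z.as U.as V.as n) := by
  have h (m : A.PseudoMod₄) (r : DualNumber K) :
      (associatorExt (K := K) (R := DualNumber K) A).faceP₁ X Y Z U V
        (fun X Y Z W => tm (m X.as Y.as Z.as W.as) r) =
      tm (A.faceP₁ X.as Y.as Z.as U.as V.as m) r :=
    tm_congr rfl (by simp)
  have h' (m m' : (associatorExt (K := K) (R := DualNumber K) A).PseudoMod₄) :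
      (associatorExt (K := K) (R := DualNumber K) A).faceP₁ X Y Z U V (m + m') =
      (associatorExt (K := K) (R := DualNumber K) A).faceP₁ X Y Z U V m +
      (associatorExt (K := K) (R := DualNumber K) A).faceP₁ X Y Z U V m' := by
    simp only [TensorAssociator.faceP₁, bicategoricalComp, Pi.add_apply, whiskerLeft_add',
      Preadditive.add_comp, Preadditive.comp_add, tensorExt_add_left]
  exact (h' _ _).trans (congrArg₂ (· + ·) (h p 1) (h n _))

lemma faceP₂_ext (A : TensorAssociator T) (p n : A.PseudoMod₄)
    (X Y Z U V : ScalarExt K (DualNumber K) C) :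
    (associatorExt (K := K) (R := DualNumber K) A).faceP₂ X Y Z U V (dual₄ p n) =
      dual (A.faceP₂ X.as Y.as Z.as U.as V.as p) (A.faceP₂ X.as Y.as Z.as U.as V.as n) := by
  have h (m : A.PseudoMod₄) (r : DualNumber K) :
      (associatorExt (K := K) (R := DualNumber K) A).faceP₂ X Y Z U V
        (fun X Y Z W => tm (m X.as Y.as Z.as W.as) r) =
      tm (A.faceP₂ X.as Y.as Z.as U.as V.as m) r :=
    tm_congr rfl (by simp)
  have h' (m m' : (associatorExt (K := K) (R := DualNumber K) A).PseudoMod₄) :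
      (associatorExt (K := K) (R := DualNumber K) A).faceP₂ X Y Z U V (m + m') =
      (associatorExt (K := K) (R := DualNumber K) A).faceP₂ X Y Z U V m +
      (associatorExt (K := K) (R := DualNumber K) A).faceP₂ X Y Z U V m' := by
    simp only [TensorAssociator.faceP₂, bicategoricalComp, Pi.add_apply, whiskerLeft_add',
      whiskerRight_add', Preadditive.add_comp, Preadditive.comp_add]
  exact (h' _ _).trans (congrArg₂ (· + ·) (h p 1) (h n _))

lemma faceP₄_ext (A : TensorAssociator T) (p n : A.PseudoMod₄)
    (X Y Z U V : ScalarExt K (DualNumber K) C) :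
    (associatorExt (K := K) (R := DualNumber K) A).faceP₄ X Y Z U V (dual₄ p n) =
      dual (A.faceP₄ X.as Y.as Z.as U.as V.as p) (A.faceP₄ X.as Y.as Z.as U.as V.as n) := by
  have h (m : A.PseudoMod₄) (r : DualNumber K) :
      (associatorExt (K := K) (R := DualNumber K) A).faceP₄ X Y Z U V
        (fun X Y Z W => tm (m X.as Y.as Z.as W.as) r) =
      tm (A.faceP₄ X.as Y.as Z.as U.as V.as m) r :=
    tm_congr rfl (by simp)
  have h' (m m' : (associatorExt (K := K) (R := DualNumber K) A).PseudoMod₄) :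
      (associatorExt (K := K) (R := DualNumber K) A).faceP₄ X Y Z U V (m + m') =
      (associatorExt (K := K) (R := DualNumber K) A).faceP₄ X Y Z U V m +
      (associatorExt (K := K) (R := DualNumber K) A).faceP₄ X Y Z U V m' := by
    simp only [TensorAssociator.faceP₄, Pi.add_apply, whiskerLeft_add']
  exact (h' _ _).trans (congrArg₂ (· + ·) (h p 1) (h n _))

lemma faceQ₀_ext (A : TensorAssociator T) (p n : A.PseudoMod₄)
    (X Y Z U V : ScalarExt K (DualNumber K) C) :
    (associatorExt (K := K) (R := DualNumber K) A).faceQ₀ X Y Z U V (dual₄ p n) =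
      dual (A.faceQ₀ X.as Y.as Z.as U.as V.as p) (A.faceQ₀ X.as Y.as Z.as U.as V.as n) := by
  have h (m : A.PseudoMod₄) (r : DualNumber K) :
      (associatorExt (K := K) (R := DualNumber K) A).faceQ₀ X Y Z U V
        (fun X Y Z W => tm (m X.as Y.as Z.as W.as) r) =
      tm (A.faceQ₀ X.as Y.as Z.as U.as V.as m) r :=
    tm_congr rfl (by simp)
  have h' (m m' : (associatorExt (K := K) (R := DualNumber K) A).PseudoMod₄) :
      (associatorExt (K := K) (R := DualNumber K) A).faceQ₀ X Y Z U V (m + m') =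
      (associatorExt (K := K) (R := DualNumber K) A).faceQ₀ X Y Z U V m +
      (associatorExt (K := K) (R := DualNumber K) A).faceQ₀ X Y Z U V m' := by
    simp only [TensorAssociator.faceQ₀, bicategoricalComp, Pi.add_apply, whiskerRight_add',
      Preadditive.add_comp, Preadditive.comp_add, tensorExt_add_right]
  exact (h' _ _).trans (congrArg₂ (· + ·) (h p 1) (h n _))

lemma faceQ₁_ext (A : TensorAssociator T) (p n : A.PseudoMod₄)
    (X Y Z U V : ScalarExt K (DualNumber K) C) :
    (associatorExt (K := K) (R := DualNumber K) A).faceQ₁ X Y Z U V (dual₄ p n) =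
      dual (A.faceQ₁ X.as Y.as Z.as U.as V.as p) (A.faceQ₁ X.as Y.as Z.as U.as V.as n) := by
  have h (m : A.PseudoMod₄) (r : DualNumber K) :
      (associatorExt (K := K) (R := DualNumber K) A).faceQ₁ X Y Z U V
        (fun X Y Z W => tm (m X.as Y.as Z.as W.as) r) =
      tm (A.faceQ₁ X.as Y.as Z.as U.as V.as m) r :=
    tm_congr rfl (by simp)
  have h' (m m' : (associatorExt (K := K) (R := DualNumber K) A).PseudoMod₄) :
      (associatorExt (K := K) (R := DualNumber K) A).faceQ₁ X Y Z U V (m + m') =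
      (associatorExt (K := K) (R := DualNumber K) A).faceQ₁ X Y Z U V m +
      (associatorExt (K := K) (R := DualNumber K) A).faceQ₁ X Y Z U V m' := by
    simp only [TensorAssociator.faceQ₁, bicategoricalComp, Pi.add_apply, whiskerLeft_add',
      whiskerRight_add', Preadditive.add_comp, Preadditive.comp_add]
  exact (h' _ _).trans (congrArg₂ (· + ·) (h p 1) (h n _))

lemma faceQ₃_ext (A : TensorAssociator T) (p n : A.PseudoMod₄)
    (X Y Z U V : ScalarExt K (DualNumber K) C) :
    (associatorExt (K := K) (R := DualNumber K) A).faceQ₃ X Y Z U V (dual₄ p n) =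
      dual (A.faceQ₃ X.as Y.as Z.as U.as V.as p) (A.faceQ₃ X.as Y.as Z.as U.as V.as n) := by
  have h (m : A.PseudoMod₄) (r : DualNumber K) :
      (associatorExt (K := K) (R := DualNumber K) A).faceQ₃ X Y Z U V
        (fun X Y Z W => tm (m X.as Y.as Z.as W.as) r) =
      tm (A.faceQ₃ X.as Y.as Z.as U.as V.as m) r :=
    tm_congr rfl (by simp)
  have h' (m m' : (associatorExt (K := K) (R := DualNumber K) A).PseudoMod₄) :
      (associatorExt (K := K) (R := DualNumber K) A).faceQ₃ X Y Z U V (m + m') =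
      (associatorExt (K := K) (R := DualNumber K) A).faceQ₃ X Y Z U V m +
      (associatorExt (K := K) (R := DualNumber K) A).faceQ₃ X Y Z U V m' := by
    simp only [TensorAssociator.faceQ₃, bicategoricalComp, Pi.add_apply, whiskerRight_add',
      Preadditive.add_comp, Preadditive.comp_add]
  exact (h' _ _).trans (congrArg₂ (· + ·) (h p 1) (h n _))

end
end ScalarExt

/-! ### Naturality and the `K₅` relation to first order. -/

namespace ScalarExt
section
variable {K : Type*} [CommRing K] {C : Type u} [Bicategory.{w, v} C]
  [∀ X Y : C, Preadditive (X ⟶ Y)] [∀ X Y : C, Linear K (X ⟶ Y)] [LinearBicategory K C]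
  {T : TensorFunctor C} [T.IsBilinear K] {A : TensorAssociator T}

/-- The naturality equation is linear in the family and its other cells have no `ε`-term, so it
splits into its two coefficients. -/
lemma isMod₄_dual₄ (p n : A.PseudoMod₄) :
    (associatorExt (K := K) (R := DualNumber K) A).IsMod₄ (dual₄ p n) ↔
      A.IsMod₄ p ∧ A.IsMod₄ n := by
  have key {X X' Y Y' Z Z' W W' : ScalarExt K (DualNumber K) C} (f : X ⟶ X')
      (g : Y ⟶ Y') (h : Z ⟶ Z') (k : W ⟶ W') :
      (dual₄ (K := K) p n X Y Z W ▷ (tensorExt T).tHom ((tensorExt T).tHom ((tensorExt T).tHom f g) h) k ≫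
        (associatorExt A).b₄Hat f g h k = (associatorExt A).a₄Hat f g h k ≫
        (tensorExt T).tHom f ((tensorExt T).tHom g ((tensorExt T).tHom h k)) ◁ dual₄ p n X' Y' Z' W') ↔
      (p X.as Y.as Z.as W.as ▷ T.tHom (T.tHom (T.tHom f.as g.as) h.as) k.as ≫
          A.b₄Hat f.as g.as h.as k.as = A.a₄Hat f.as g.as h.as k.as ≫
          T.tHom f.as (T.tHom g.as (T.tHom h.as k.as)) ◁ p X'.as Y'.as Z'.as W'.as) ∧
      (n X.as Y.as Z.as W.as ▷ T.tHom (T.tHom (T.tHom f.as g.as) h.as) k.as ≫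
          A.b₄Hat f.as g.as h.as k.as = A.a₄Hat f.as g.as h.as k.as ≫
          T.tHom f.as (T.tHom g.as (T.tHom h.as k.as)) ◁ n X'.as Y'.as Z'.as W'.as) := by
    exact (Eq.congr (comp_tm_eq_dual (dual_whiskerRight _ _ _) (b₄Hat_ext A f g h k))
      (tm_comp_eq_dual (a₄Hat_ext A f g h k) (whiskerLeft_dual _ _ _))).trans dual_inj
  constructor
  · intro h
    have h' {X X' Y Y' Z Z' W W' : C} (f : X ⟶ X') (g : Y ⟶ Y') (k : Z ⟶ Z') (l : W ⟶ W') :=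
      (key (X := ⟨X⟩) (X' := ⟨X'⟩) (Y := ⟨Y⟩) (Y' := ⟨Y'⟩) (Z := ⟨Z⟩) (Z' := ⟨Z'⟩) (W := ⟨W⟩)
        (W' := ⟨W'⟩) ⟨f⟩ ⟨g⟩ ⟨k⟩ ⟨l⟩).1 (h _ _ _ _)
    exact ⟨fun f g k l => (h' f g k l).1, fun f g k l => (h' f g k l).2⟩
  · rintro ⟨h₁, h₂⟩ X X' Y Y' Z Z' W W' f g h k
    exact (key f g h k).2 ⟨h₁ _ _ _ _, h₂ _ _ _ _⟩

/-- The alternating signs of `δ₃` separate the faces of the two halves of the associahedron. The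
right-hand equation has the bracketing that iterating the Leibniz rule produces from the two sides
of `K₅`. -/
lemma δ₃_apply_eq_zero_iff (P : Pentagonator A) (n : A.PseudoMod₄) (X Y Z U V : C) :
    P.δ₃ K n X Y Z U V = 0 ↔
      (A.faceP₀ X Y Z U V).hom ≫ (A.faceP₁ X Y Z U V P.hom ≫ (A.faceP₂ X Y Z U V P.hom ≫
        A.faceP₃ X Y Z U V ≫ A.faceP₄ X Y Z U V n + A.faceP₂ X Y Z U V n ≫
        A.faceP₃ X Y Z U V ≫ A.faceP₄ X Y Z U V P.hom) + A.faceP₁ X Y Z U V n ≫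
        A.faceP₂ X Y Z U V P.hom ≫ A.faceP₃ X Y Z U V ≫ A.faceP₄ X Y Z U V P.hom) =
      A.faceQ₀ X Y Z U V P.hom ≫ (A.faceQ₁ X Y Z U V P.hom ≫ A.faceQ₂ X Y Z U V ≫
        A.faceQ₃ X Y Z U V n + A.faceQ₁ X Y Z U V n ≫ A.faceQ₂ X Y Z U V ≫
        A.faceQ₃ X Y Z U V P.hom) + A.faceQ₀ X Y Z U V n ≫ A.faceQ₁ X Y Z U V P.hom ≫
        A.faceQ₂ X Y Z U V ≫ A.faceQ₃ X Y Z U V P.hom := by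
  simp only [Pentagonator.δ₃, LinearMap.coe_mk, AddHom.coe_mk, Pi.sub_apply, Pi.add_apply,
    Pentagonator.pad₄₁, Pentagonator.pad₄₂, Pentagonator.pad₄₃, Pentagonator.pad₄₄,
    Pentagonator.pad₄₅, Pentagonator.pad₄₆, Preadditive.comp_add]
  conv_rhs => rw [eq_comm, ← sub_eq_zero]
  refine Eq.congr ?_ rfl
  abel

/-- The `K₅` relation for `P.hom + n ε`. -/
lemma k₅_dual₄ (P : Pentagonator A) (n : A.PseudoMod₄) (X Y Z U V : ScalarExt K (DualNumber K) C) :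
    (let E := associatorExt (K := K) (R := DualNumber K) A
     let p := dual₄ P.hom n
     (E.faceP₀ X Y Z U V).hom ≫ E.faceP₁ X Y Z U V p ≫ E.faceP₂ X Y Z U V p ≫
        E.faceP₃ X Y Z U V ≫ E.faceP₄ X Y Z U V p =
      E.faceQ₀ X Y Z U V p ≫ E.faceQ₁ X Y Z U V p ≫ E.faceQ₂ X Y Z U V ≫
        E.faceQ₃ X Y Z U V p) ↔ P.δ₃ K n X.as Y.as Z.as U.as V.as = 0 := by
  refine (Eq.congr
    (tm_comp_eq_dual (faceP₀_ext A X Y Z U V) (comp_eq_dual (faceP₁_ext A P.hom n X Y Z U V)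
      (comp_eq_dual (faceP₂_ext A P.hom n X Y Z U V) (tm_comp_eq_dual (faceP₃_ext A X Y Z U V)
        (faceP₄_ext A P.hom n X Y Z U V)))))
    (comp_eq_dual (faceQ₀_ext A P.hom n X Y Z U V) (comp_eq_dual (faceQ₁_ext A P.hom n X Y Z U V)
      (tm_comp_eq_dual (faceQ₂_ext A X Y Z U V) (faceQ₃_ext A P.hom n X Y Z U V))))).trans ?_
  refine dual_inj.trans ?_
  -- The constant term is the `K₅` relation of `P` itself.
  exact (and_iff_right (P.k₅ _ _ _ _ _)).trans (δ₃_apply_eq_zero_iff P n _ _ _ _ _).symm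

end
end ScalarExt

/-! ### Deformations and 3-cocycles. -/

section Deformations
open ScalarExt
variable {K : Type*} [CommRing K] {C : Type u} [Bicategory.{w, v} C]
  [∀ X Y : C, Preadditive (X ⟶ Y)] [∀ X Y : C, Linear K (X ⟶ Y)] [LinearBicategory K C]
  {T : TensorFunctor C} [T.IsBilinear K] {A : TensorAssociator T} {P : Pentagonator A}

namespace PentagonatorDeformation

/-- The first order term of a deformation. -/
def firstOrder (D : PentagonatorDeformation K P) : A.PseudoMod₄ := fun X Y Z W =>
  coef (D.toPentagonator.π ⟨X⟩ ⟨Y⟩ ⟨Z⟩ ⟨W⟩).hom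

lemma hom_eq (D : PentagonatorDeformation K P) :
    D.toPentagonator.hom = dual₄ P.hom D.firstOrder := by
  funext X Y Z W
  refine (dual_red_coef _).symm.trans ?_
  rw [D.red_π]; rfl

lemma firstOrder_mem (D : PentagonatorDeformation K P) : D.firstOrder ∈ P.Z₃ K := by
  have h₁ : (associatorExt A).IsMod₄ D.toPentagonator.hom := D.toPentagonator.isMod
  have h₂ := D.toPentagonator.k₅
  rw [hom_eq, isMod₄_dual₄] at h₁
  refine ⟨h₁.2, ?_⟩
  rw [SetLike.mem_coe, LinearMap.mem_ker]
  funext X Y Z U V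
  have h₃ := h₂ ⟨X⟩ ⟨Y⟩ ⟨Z⟩ ⟨U⟩ ⟨V⟩
  -- The relation is restated in terms of the family `hom`, for which `hom_eq` gives the expansion
  -- in `ε`.
  change (_ ≫ TensorAssociator.faceP₁ _ _ _ _ _ D.toPentagonator.hom ≫
    TensorAssociator.faceP₂ _ _ _ _ _ D.toPentagonator.hom ≫ _ ≫
    TensorAssociator.faceP₄ _ _ _ _ _ D.toPentagonator.hom) =
    (TensorAssociator.faceQ₀ _ _ _ _ _ D.toPentagonator.hom ≫
    TensorAssociator.faceQ₁ _ _ _ _ _ D.toPentagonator.hom ≫ _ ≫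
    TensorAssociator.faceQ₃ _ _ _ _ _ D.toPentagonator.hom) at h₃
  rw [hom_eq] at h₃
  exact (k₅_dual₄ P D.firstOrder ⟨X⟩ ⟨Y⟩ ⟨Z⟩ ⟨U⟩ ⟨V⟩).1 h₃

/-- The deformation with a given cocycle as first order term. -/
def ofCocycle (z : P.Z₃ K) : PentagonatorDeformation K P where
  toPentagonator :=
    { π X Y Z W := dualIso (P.π X.as Y.as Z.as W.as) (z.1 X.as Y.as Z.as W.as)
      isMod := (isMod₄_dual₄ P.hom z.1).2 ⟨P.isMod, z.2.1⟩
      k₅ X Y Z U V := (k₅_dual₄ P z.1 X Y Z U V).2 (by rw [z.2.2]; rfl) }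
  red_π X Y Z W := red_dual _ _

lemma firstOrder_ofCocycle (z : P.Z₃ K) : (ofCocycle z).firstOrder = z.1 := by
  funext X Y Z W
  exact coef_dual _ _

end PentagonatorDeformation
end Deformations

/-! ### Modifications of the form `1 + m ε` and the coboundary `δ₂`. -/

namespace TensorAssociator

lemma ωOf_injective {C : Type u} [Bicategory.{w, v} C] {T : TensorFunctor C}
    (A : TensorAssociator T) {n n' : A.PseudoMod₃} {X Y Z : C}
    (h : A.ωOf n X Y Z = A.ωOf n' X Y Z) : n X Y Z = n' X Y Z :=
  (cancel_mono _).1 ((cancel_epi _).1 h)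

lemma isMod₃_id {C : Type u} [Bicategory.{w, v} C] {T : TensorFunctor C}
    (A : TensorAssociator T) : A.IsMod₃ fun X Y Z => 𝟙 (A.a X Y Z) := fun f g h => by simp

end TensorAssociator

namespace ScalarExt
section
variable {K : Type*} [CommRing K] {C : Type u} [Bicategory.{w, v} C]
  [∀ X Y : C, Preadditive (X ⟶ Y)] [∀ X Y : C, Linear K (X ⟶ Y)] [LinearBicategory K C]
  {T : TensorFunctor C} [T.IsBilinear K] {A : TensorAssociator T}

/-- The family `p + n ε`. -/
def dual₃ (p n : A.PseudoMod₃) : (associatorExt (K := K) (R := DualNumber K) A).PseudoMod₃ :=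
  fun X Y Z => dual (p X.as Y.as Z.as) (n X.as Y.as Z.as)

lemma isMod₃_dual₃ (p n : A.PseudoMod₃) :
    (associatorExt (K := K) (R := DualNumber K) A).IsMod₃ (dual₃ p n) ↔
      A.IsMod₃ p ∧ A.IsMod₃ n := by
  have key {X X' Y Y' Z Z' : ScalarExt K (DualNumber K) C} (f : X ⟶ X') (g : Y ⟶ Y')
      (h : Z ⟶ Z') :
      (dual₃ (K := K) p n X Y Z ▷ (tensorExt T).tHom ((tensorExt T).tHom f g) h ≫
        ((associatorExt A).hat f g h).hom = ((associatorExt A).hat f g h).hom ≫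
        (tensorExt T).tHom f ((tensorExt T).tHom g h) ◁ dual₃ p n X' Y' Z') ↔
      (p X.as Y.as Z.as ▷ T.tHom (T.tHom f.as g.as) h.as ≫ (A.hat f.as g.as h.as).hom =
        (A.hat f.as g.as h.as).hom ≫ T.tHom f.as (T.tHom g.as h.as) ◁ p X'.as Y'.as Z'.as) ∧
      (n X.as Y.as Z.as ▷ T.tHom (T.tHom f.as g.as) h.as ≫ (A.hat f.as g.as h.as).hom =
        (A.hat f.as g.as h.as).hom ≫ T.tHom f.as (T.tHom g.as h.as) ◁ n X'.as Y'.as Z'.as) :=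
    (Eq.congr (comp_tm_eq_dual (dual_whiskerRight _ _ _) rfl)
      (tm_comp_eq_dual rfl (whiskerLeft_dual _ _ _))).trans dual_inj
  constructor
  · intro h
    have h' {X X' Y Y' Z Z' : C} (f : X ⟶ X') (g : Y ⟶ Y') (k : Z ⟶ Z') :=
      (key (X := ⟨X⟩) (X' := ⟨X'⟩) (Y := ⟨Y⟩) (Y' := ⟨Y'⟩) (Z := ⟨Z⟩) (Z' := ⟨Z'⟩)
        ⟨f⟩ ⟨g⟩ ⟨k⟩).1 (h _ _ _)
    exact ⟨fun f g k => (h' f g k).1, fun f g k => (h' f g k).2⟩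
  · rintro ⟨h₁, h₂⟩ X X' Y Y' Z Z' f g h
    exact (key f g h).2 ⟨h₁ _ _ _, h₂ _ _ _⟩

/-- Comparison of the first order terms of the two sides of `TensorAssociator.Intertwines`. -/
lemma δ₂_apply_eq_sub_iff (P : Pentagonator A) (m : A.PseudoMod₃) (z z' : A.PseudoMod₄)
    (X Y Z W : C) :
    (let i : A.PseudoMod₃ := fun X Y Z => 𝟙 (A.a X Y Z);
      P.hom X Y Z W ≫ (i X Y (T.tObj Z W) ▷ A.a (T.tObj X Y) Z W ≫
        A.a X Y (T.tObj Z W) ◁ m (T.tObj X Y) Z W + m X Y (T.tObj Z W) ▷ A.a (T.tObj X Y) Z W ≫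
        A.a X Y (T.tObj Z W) ◁ i (T.tObj X Y) Z W) + z X Y Z W ≫
        i X Y (T.tObj Z W) ▷ A.a (T.tObj X Y) Z W ≫ A.a X Y (T.tObj Z W) ◁ i (T.tObj X Y) Z W =
      T.tHom₂ (𝟙 (𝟙 X)) (i Y Z W) ▷ (A.a X (T.tObj Y Z) W ≫ T.idR (A.a X Y Z) W) ≫
        (T.idL X (A.a Y Z W) ◁ i X (T.tObj Y Z) W ▷ T.idR (A.a X Y Z) W ≫
          (T.idL X (A.a Y Z W) ◁ A.a X (T.tObj Y Z) W ◁ T.tHom₂ (i X Y Z) (𝟙 (𝟙 W)) ≫ z' X Y Z W +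
            T.idL X (A.a Y Z W) ◁ A.a X (T.tObj Y Z) W ◁ T.tHom₂ (m X Y Z) (𝟙 (𝟙 W)) ≫
              P.hom X Y Z W) +
          T.idL X (A.a Y Z W) ◁ m X (T.tObj Y Z) W ▷ T.idR (A.a X Y Z) W ≫
            T.idL X (A.a Y Z W) ◁ A.a X (T.tObj Y Z) W ◁ T.tHom₂ (i X Y Z) (𝟙 (𝟙 W)) ≫
              P.hom X Y Z W) +
        T.tHom₂ (𝟙 (𝟙 X)) (m Y Z W) ▷ (A.a X (T.tObj Y Z) W ≫ T.idR (A.a X Y Z) W) ≫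
          T.idL X (A.a Y Z W) ◁ i X (T.tObj Y Z) W ▷ T.idR (A.a X Y Z) W ≫
          T.idL X (A.a Y Z W) ◁ A.a X (T.tObj Y Z) W ◁ T.tHom₂ (i X Y Z) (𝟙 (𝟙 W)) ≫
            P.hom X Y Z W) ↔
      z X Y Z W - z' X Y Z W = P.δ₂ K m X Y Z W := by
  simp only [Pentagonator.δ₂, LinearMap.coe_mk, AddHom.coe_mk, Pi.sub_apply, Pi.add_apply,
    Pentagonator.pad₃₁, Pentagonator.pad₃₂, Pentagonator.pad₃₃, Pentagonator.pad₃₄,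
    Pentagonator.pad₃₅, TensorFunctor.tHom₂_id, id_whiskerRight, Bicategory.whiskerLeft_id, Category.id_comp,
    Category.comp_id, Preadditive.comp_add]
  rw [← sub_eq_zero, ← sub_eq_zero (a := z X Y Z W - z' X Y Z W)]
  refine Eq.congr ?_ rfl
  abel

/-- In the Leibniz expansion, `m` replaces one identity at a time. The two terms on the side of `z`
are the paddings with sign `-` in `δ₂`, the three on the side of `z'` those with sign `+`. -/
lemma intertwines_dual₃ (P : Pentagonator A) (m : A.PseudoMod₃) (z z' : A.PseudoMod₄) :
    (associatorExt (K := K) (R := DualNumber K) A).Intertwines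
      (dual₃ (fun X Y Z => 𝟙 (A.a X Y Z)) m) (dual₄ P.hom z) (dual₄ P.hom z') ↔
      z - z' = P.δ₂ K m := by
  have key (X Y Z W : ScalarExt K (DualNumber K) C) :
      (let E := associatorExt (K := K) (R := DualNumber K) A
       let S := tensorExt (K := K) (R := DualNumber K) T
       let n : E.PseudoMod₃ := dual₃ (fun X Y Z => 𝟙 (A.a X Y Z)) m
       let p : E.PseudoMod₄ := dual₄ P.hom z
       let p' : E.PseudoMod₄ := dual₄ P.hom z'
       p X Y Z W ≫ n X Y (S.tObj Z W) ▷ E.a (S.tObj X Y) Z W ≫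
        E.a X Y (S.tObj Z W) ◁ n (S.tObj X Y) Z W =
      S.tHom₂ (𝟙 (𝟙 X)) (n Y Z W) ▷ (E.a X (S.tObj Y Z) W ≫ S.idR (E.a X Y Z) W) ≫
        S.idL X (E.a Y Z W) ◁ n X (S.tObj Y Z) W ▷ S.idR (E.a X Y Z) W ≫
        S.idL X (E.a Y Z W) ◁ E.a X (S.tObj Y Z) W ◁ S.tHom₂ (n X Y Z) (𝟙 (𝟙 W)) ≫
          p' X Y Z W) ↔
      z X.as Y.as Z.as W.as - z' X.as Y.as Z.as W.as = P.δ₂ K m X.as Y.as Z.as W.as := by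
    have hR {X Y Z : ScalarExt K (DualNumber K) C} {f g : X ⟶ Y} {η : f ⟶ g}
        {τ σ : f.as ⟶ g.as} (h : η = dual τ σ) (k : Y ⟶ Z) :
        η ▷ k = dual (τ ▷ k.as) (σ ▷ k.as) := h ▸ dual_whiskerRight τ σ k
    have hL {X Y Z : ScalarExt K (DualNumber K) C} {f g : Y ⟶ Z} {η : f ⟶ g}
        {τ σ : f.as ⟶ g.as} (h : η = dual τ σ) (k : X ⟶ Y) :
        k ◁ η = dual (k.as ◁ τ) (k.as ◁ σ) := h ▸ whiskerLeft_dual k τ σ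
    refine (Eq.congr
      (comp_eq_dual rfl (comp_eq_dual (dual_whiskerRight _ _ _) (whiskerLeft_dual _ _ _)))
      (comp_eq_dual (hR (tm_tHom₂_dual T (f := 𝟙 X) (f' := 𝟙 X) (𝟙 (𝟙 X.as)) _ _) _)
        (comp_eq_dual (hL (dual_whiskerRight _ _ _) _)
          (comp_eq_dual (hL (hL (dual_tHom₂_tm T (g := 𝟙 W) (g' := 𝟙 W) _ _ (𝟙 (𝟙 W.as))) _) _)
            rfl)))).trans ?_
    refine dual_inj.trans ((and_iff_right ?_).trans
      (δ₂_apply_eq_sub_iff P m z z' X.as Y.as Z.as W.as))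
    -- The constant term: for `n = 1` both sides reduce to `π`.
    have h (X Y Z W : C) : P.hom X Y Z W ≫ 𝟙 (A.a X Y (T.tObj Z W)) ▷ A.a (T.tObj X Y) Z W ≫
          A.a X Y (T.tObj Z W) ◁ 𝟙 (A.a (T.tObj X Y) Z W) =
        T.tHom₂ (𝟙 (𝟙 X)) (𝟙 (A.a Y Z W)) ▷ (A.a X (T.tObj Y Z) W ≫ T.idR (A.a X Y Z) W) ≫
          T.idL X (A.a Y Z W) ◁ 𝟙 (A.a X (T.tObj Y Z) W) ▷ T.idR (A.a X Y Z) W ≫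
          T.idL X (A.a Y Z W) ◁ A.a X (T.tObj Y Z) W ◁ T.tHom₂ (𝟙 (A.a X Y Z)) (𝟙 (𝟙 W)) ≫
            P.hom X Y Z W := by
      simp
    exact h _ _ _ _
  constructor
  · intro h
    funext X Y Z W
    exact (key ⟨X⟩ ⟨Y⟩ ⟨Z⟩ ⟨W⟩).1 (h _ _ _ _)
  · intro h X Y Z W
    refine (key X Y Z W).2 ?_
    rw [← h]; rfl

lemma ωOf_dual₃ (p n : A.PseudoMod₃) (X Y Z : ScalarExt K (DualNumber K) C) :
    (associatorExt (K := K) (R := DualNumber K) A).ωOf (dual₃ p n) X Y Z =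
      dual (A.ωOf p X.as Y.as Z.as) (A.ωOf n X.as Y.as Z.as) := by
  refine tm_comp_eq_dual (ρ := (A.ωSource X.as Y.as Z.as).hom) (tm_congr rfl (by simp))
    (comp_tm_eq_dual (ρ := (A.ωTarget X.as Y.as Z.as).inv) rfl (tm_congr rfl (by simp)))

end
end ScalarExt

/-! ### `ω`-equivalence as equality of cohomology classes. -/

section Deformations
open ScalarExt
variable {K : Type*} [CommRing K] {C : Type u} [Bicategory.{w, v} C] [Strict C]
  [∀ X Y : C, Preadditive (X ⟶ Y)] [∀ X Y : C, Linear K (X ⟶ Y)] [LinearBicategory K C]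
  {T : TensorFunctor C} [T.IsBilinear K] {A : TensorAssociator T} {P : Pentagonator A}

namespace PentagonatorDeformation

/-- An `ω`-equivalence is a modification `1 + m ε` intertwining the two pentagonators, and its first
order part says that `m` bounds the difference. -/
theorem omegaEquivalent_iff (D D' : PentagonatorDeformation K P) :
    OmegaEquivalent D D' ↔ D.firstOrder - D'.firstOrder ∈ P.B₃ K := by
  constructor
  · rintro ⟨M, hM, hω⟩
    obtain ⟨n, hn, hmod, hint⟩ := M.exists_mod hM
    let m : A.PseudoMod₃ := fun X Y Z => coef (n ⟨X⟩ ⟨Y⟩ ⟨Z⟩)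
    have e₀ : n = dual₃ (fun X Y Z => red (n ⟨X⟩ ⟨Y⟩ ⟨Z⟩)) m := by
      funext X Y Z
      exact (dual_red_coef _).symm
    -- The condition on `ω` modulo `ε` fixes the constant term, since `ωOf` is injective in its
    -- family.
    have hred (X Y Z : C) : red (n ⟨X⟩ ⟨Y⟩ ⟨Z⟩) = 𝟙 (A.a X Y Z) := by
      have h := hω ⟨X⟩ ⟨Y⟩ ⟨Z⟩
      rw [hn, e₀, ωOf_dual₃] at h
      have h' : A.ωOf (fun X Y Z => red (n ⟨X⟩ ⟨Y⟩ ⟨Z⟩)) X Y Z =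
          A.ωOf (fun X Y Z => 𝟙 (A.a X Y Z)) X Y Z :=
        ((red_dual _ _).symm.trans h).trans (A.ω₀_eq X Y Z)
      exact A.ωOf_injective h'
    have e : n = dual₃ (fun X Y Z => 𝟙 (A.a X Y Z)) m := by
      rw [e₀]
      congr 1
      funext X Y Z
      exact hred X Y Z
    rw [e, isMod₃_dual₃] at hmod
    rw [e, D.hom_eq, D'.hom_eq, intertwines_dual₃] at hint
    exact ⟨m, hmod.2, hint.symm⟩
  · rintro ⟨m, hm, hmD⟩
    -- The family `1 + m ε`, invertible because its constant term is.
    let n (X Y Z : ScalarExt K (DualNumber K) C) :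
        (associatorExt (K := K) (R := DualNumber K) A).a X Y Z ≅ (associatorExt A).a X Y Z :=
      dualIso (Iso.refl (A.a X.as Y.as Z.as)) (m X.as Y.as Z.as)
    have hint : (associatorExt (K := K) (R := DualNumber K) A).Intertwines
        (fun X Y Z => (n X Y Z).hom) D.toPentagonator.hom D'.toPentagonator.hom := by
      rw [D.hom_eq, D'.hom_eq]
      exact (intertwines_dual₃ P m _ _).2 hmD.symm
    refine ⟨IdSemigroupal.ofMod n ((isMod₃_dual₃ _ m).2 ⟨A.isMod₃_id, hm⟩) hint,
      fun f g => rfl, fun X Y Z => ?_⟩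
    refine (congrArg red (ωOf_dual₃ (fun X Y Z => 𝟙 (A.a X Y Z)) m X Y Z)).trans ?_
    exact (red_dual _ _).trans (A.ω₀_eq _ _ _).symm

/-- Congruence modulo the subgroup of coboundaries is an equivalence relation, so semigroupal
structures need not be composed or inverted. -/
theorem equivalence_omegaEquivalent : Equivalence (OmegaEquivalent (K := K) (P := P)) where
  refl D := by
    rw [omegaEquivalent_iff, sub_self]
    exact zero_mem _
  symm {D D'} h := by
    rw [omegaEquivalent_iff] at h ⊢
    rw [← neg_sub]
    exact neg_mem h
  trans {D D' D''} h h' := by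
    rw [omegaEquivalent_iff] at h h' ⊢
    rw [← sub_add_sub_cancel]
    exact add_mem h h'

/-- The cohomology class of the first order term. -/
def cohomologyClass (D : PentagonatorDeformation K P) : P.H₃ K :=
  Submodule.Quotient.mk ⟨D.firstOrder, D.firstOrder_mem⟩

/-- The denominator of `H₃` is the preimage of `B₃` in `Z₃`, and the difference of two first order
terms is already a cocycle. Hence the inclusion of coboundaries in cocycles is not needed. -/
lemma cohomologyClass_eq_iff (D D' : PentagonatorDeformation K P) :
    D.cohomologyClass = D'.cohomologyClass ↔ OmegaEquivalent D D' := by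
  rw [omegaEquivalent_iff, cohomologyClass, cohomologyClass, Submodule.Quotient.eq]
  rfl

lemma cohomologyClass_surjective :
    Function.Surjective (cohomologyClass : PentagonatorDeformation K P → P.H₃ K) := by
  intro x
  obtain ⟨z, rfl⟩ := Submodule.Quotient.mk_surjective _ x
  exact ⟨ofCocycle z, congrArg Submodule.Quotient.mk (Subtype.ext (firstOrder_ofCocycle z))⟩

variable (K P) in
/-- Classes of deformations correspond to cohomology classes. -/
noncomputable def quotEquiv : Quot (OmegaEquivalent (K := K) (P := P)) ≃ P.H₃ K :=
  Equiv.ofBijective (Quot.lift cohomologyClass fun D D' h => (cohomologyClass_eq_iff D D').2 h) <| by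
    constructor
    · rintro ⟨D⟩ ⟨D'⟩ h
      exact Quot.sound ((cohomologyClass_eq_iff D D').1 h)
    · intro x
      obtain ⟨D, rfl⟩ := cohomologyClass_surjective x
      exact ⟨Quot.mk _ D, rfl⟩

end PentagonatorDeformation
end Deformations

/-- The expansion `π + z ε` determines `z`, so the last clause contains the cocycle property and
pins down the bijection as the one induced by the first order term. -/
theorem mainTheorem4 {K : Type*} [CommRing K] {C : Type u} [Bicategory.{w, v} C] [Strict C]
    [∀ X Y : C, Preadditive (X ⟶ Y)] [∀ X Y : C, Linear K (X ⟶ Y)] [LinearBicategory K C]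
    (T : TensorFunctor C) [T.IsBilinear K] (A : TensorAssociator T) (P : Pentagonator A) :
    Equivalence (OmegaEquivalent (K := K) (P := P)) ∧
      ∃ e : Quot (OmegaEquivalent (K := K) (P := P)) ≃ P.H₃ K,
        ∀ D : PentagonatorDeformation K P, ∃ z : P.Z₃ K,
          (∀ X Y Z W : ScalarExt K (DualNumber K) C,
            (D.toPentagonator.π X Y Z W).hom =
              ScalarExt.tm (P.π X.as Y.as Z.as W.as).hom (1 : DualNumber K) +
                ScalarExt.tm (z.1 X.as Y.as Z.as W.as) (DualNumber.eps : DualNumber K)) ∧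
          e (Quot.mk _ D) = Submodule.Quotient.mk z := by
  refine ⟨PentagonatorDeformation.equivalence_omegaEquivalent,
    PentagonatorDeformation.quotEquiv K P, fun D =>
      ⟨⟨D.firstOrder, D.firstOrder_mem⟩, fun X Y Z W => ?_, rfl⟩⟩
  exact congrFun (congrFun (congrFun (congrFun D.hom_eq X) Y) Z) W
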